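/- **Setting.** Let $I,T,B,P,R$ be natural numbers, $\Gamma\in\mathbb R^{B\times B}$ symmetric positive definite, $\Delta_1,\dots,\Delta_I\in\mathbb R^{P\times P}$ symmetric positive semidefinite, $W\in\mathbb R^{B\times R}$ and $V_1,\dots,V_I\in\mathbb R^{P\times R}$. Let $X_{it}$ ($1\le i\le I$, $1\le t\le T$) be independent random $B\times P$ matrices, $X_{it}\sim\mathcal N(0,\Gamma\otimes\Delta_i)$, i.e. centered Gaussian with $\mathbb E[(X_{it})_{bp}(X_{it})_{b'p'}]=\Gamma_{bb'}(\Delta_i)_{pp'}$, and let $y_{it}=\operatorname{tr}(W^TX_{it}V_i)$. **Algorithm.** Put $$\hat A=\frac1{IT^2}\sum_{i,t,t'}y_{it}y_{it'}X_{it}X_{it'}^T,\qquad \hat\Gamma=\frac1{ITP}\sum_{i,t}X_{it}X_{it}^T,\qquad \hat B=\hat\Gamma^{-1/2}\hat A\,\hat\Gamma^{-1/2},$$ and $\hat W=\hat\Gamma^{-1/2}U$, where the columns of $U\in\mathbb R^{B\times R}$ are orthonormal eigenvectors of $\hat B$ for its $R$ largest eigenvalues (any choice of them). For $B\times R$ matrices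 let $\operatorname{dist}(W_1,W_2)=\|\Pi_{W_1}-\Pi_{W_2}\|_2$, where $\Pi_{W_j}$ is the orthogonal projection onto the column space of $W_j$. Throughout, $\|\cdot\|_2$ is the spectral norm. **Coefficients.** Let $L_i=\|\Gamma\|_2^2\|W\|_2^2\|\Delta_i\|_2^2\|V_i\|_2^2$, $Q=\frac1I\sum_iV_i^T\Delta_i^2V_i$, and let $\lambda$ be the $R$-th largest eigenvalue of $\Gamma WQW^T\Gamma$ (its smallest nonzero eigenvalue if its rank is $R$). Assume $\lambda>0$. Define $$\eta=\frac{\frac1I\sum_iL_i}{\lambda},\quad \alpha=\frac{\frac1I\sum_iL_i^2}{\lambda^2},\quad \mu=\frac{\sqrt{\frac1I\sum_iL_i^4}}{\lambda^2},\quad \nu=\frac{\max_iL_i}{\lambda},$$ $$\psi=\frac{\frac1I\sum_i\|\Delta_i\|_2^2}{\big(\frac1{IP}\sum_i\operatorname{tr}\Delta_i\big)^2},\quad \chi=\frac{\max_i\|\Delta_i\|_2}{\frac1{IP}\sum_i\operatorname{tr}\Delta_i},\quad \kappa_\Gamma=\frac{\|\Gamma\|_2}{\lambda_{\min}(\Gamma)}.$$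 **Theorem.** There are absolute constants $c_1,c_2,c_3,D'>0$ and a function $c:\mathbb R\to(1,\infty)$ such that the following holds for all data as above, with $$k=c(\kappa_\Gamma)^2\Big(c_1\alpha+c_2\mu+c_3\max\{\nu,\nu^2\}+5D'\max\{\kappa_\Gamma\eta\chi,\ \kappa_\Gamma^2\eta^2\psi\}\Big).$$ If $\epsilon>0$, $R<T$ and $$IT\ \ge\ k\,\epsilon^{-2}R^4\max\Big\{\frac{\log(IT)}T,1\Big\}^2\max\Big\{\frac PT,1\Big\}B,$$ then $$\mathbb P\big(\operatorname{dist}(\hat W,W)\ge\epsilon\big)\ \le\ \frac1B+9e^{-B}.$$ -/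

import Mathlib

open Matrix MeasureTheory ProbabilityTheory
open scoped Kronecker

noncomputable section

namespace MultiTask

/-- The spectral norm of a real matrix (operator norm for the Euclidean norms). -/
def specNorm {m n : ℕ} (A : Matrix (Fin m) (Fin n) ℝ) : ℝ :=
  ‖(Matrix.toEuclideanLin A).toContinuousLinearMap‖

/-- The `r`-th largest eigenvalue (with multiplicity, `r = 1, …, n`) of a symmetric matrix. -/
def eig {n : ℕ} (A : Matrix (Fin n) (Fin n) ℝ) (r : ℕ) : ℝ :=
  open scoped Classical in
  if h : A.IsHermitian ∧ 1 ≤ r ∧ r ≤ n then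
    h.1.eigenvalues₀ ⟨r - 1, by rw [Fintype.card_fin]; omega⟩
  else 0

/-- The columns of `U` are orthonormal eigenvectors of `A` for its `R` largest eigenvalues. -/
def IsTopEigenframe {n R : ℕ} (A : Matrix (Fin n) (Fin n) ℝ) (U : Matrix (Fin n) (Fin R) ℝ) :
    Prop :=
  Uᵀ * U = 1 ∧ A * U = U * Matrix.diagonal (fun r : Fin R => eig A (r + 1))

open scoped MatrixOrder in
/-- `A^{-1/2}` for a positive definite matrix `A`. -/
def invSqrt {n : ℕ} (A : Matrix (Fin n) (Fin n) ℝ) : Matrix (Fin n) (Fin n) ℝ :=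
  (CFC.sqrt A)⁻¹

/-- The column space of a matrix, as a subspace of Euclidean space. -/
def colSpace {n R : ℕ} (W : Matrix (Fin n) (Fin R) ℝ) : Submodule ℝ (EuclideanSpace ℝ (Fin n)) :=
  LinearMap.range (Matrix.toEuclideanLin W)

/-- The distance between the column spaces: the operator norm of the difference of the orthogonal
projections onto them (the sine of the largest principal angle, if the dimensions agree). -/
def subspaceDist {n R : ℕ} (W₁ W₂ : Matrix (Fin n) (Fin R) ℝ) : ℝ :=
  ‖(colSpace W₁).starProjection - (colSpace W₂).starProjection‖

/-- The entries of a matrix, as a vector of Euclidean space. -/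
def vecOf {B P : ℕ} (X : Matrix (Fin B) (Fin P) ℝ) : EuclideanSpace ℝ (Fin B × Fin P) :=
  WithLp.toLp 2 (fun bp => X bp.1 bp.2)

/-- The model for the covariates: the matrices `X i t` are independent, and `X i t` is a centered
Gaussian matrix with covariance `Γ ⊗ Δ i`, that is
`E[(X i t) b p * (X i t) b' p'] = Γ b b' * Δ i p p'`. -/
def GaussianModel {I T B P : ℕ} {Ω : Type*} [MeasurableSpace Ω] (Pr : Measure Ω)
    (Γ : Matrix (Fin B) (Fin B) ℝ) (Δ : Fin I → Matrix (Fin P) (Fin P) ℝ)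
    (X : Fin I → Fin T → Ω → Matrix (Fin B) (Fin P) ℝ) : Prop :=
  (∀ i t, HasLaw (fun ω => vecOf (X i t ω)) (multivariateGaussian 0 (Γ ⊗ₖ Δ i)) Pr) ∧
  iIndepFun (fun (it : Fin I × Fin T) ω => vecOf (X it.1 it.2 ω)) Pr

/-! ### The algorithm, applied to a sample `x i t` with responses `y i t` -/

section Algorithm

variable {I T B P : ℕ}

/-- `Â = (1 / (I T²)) ∑_{i,t,t'} y_{it} y_{it'} X_{it} X_{it'}ᵀ`. -/
def AHat (x : Fin I → Fin T → Matrix (Fin B) (Fin P) ℝ) (y : Fin I → Fin T → ℝ) :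
    Matrix (Fin B) (Fin B) ℝ :=
  (1 / ((I : ℝ) * (T : ℝ) ^ 2)) •
    ∑ i, ∑ t, ∑ t', (y i t * y i t') • (x i t * (x i t')ᵀ)

/-- `Γ̂ = (1 / (I T P)) ∑_{i,t} X_{it} X_{it}ᵀ`. -/
def GammaHat (x : Fin I → Fin T → Matrix (Fin B) (Fin P) ℝ) : Matrix (Fin B) (Fin B) ℝ :=
  (1 / ((I : ℝ) * T * P)) • ∑ i, ∑ t, x i t * (x i t)ᵀ

/-- `B̂ = Γ̂^{-1/2} Â Γ̂^{-1/2}`. -/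
def BHat (x : Fin I → Fin T → Matrix (Fin B) (Fin P) ℝ) (y : Fin I → Fin T → ℝ) :
    Matrix (Fin B) (Fin B) ℝ :=
  invSqrt (GammaHat x) * AHat x y * invSqrt (GammaHat x)

/-- `Ŵ` is a possible output of the algorithm: `Ŵ = Γ̂^{-1/2} eigv_R(B̂)`, for some choice of
orthonormal eigenvectors for the `R` largest eigenvalues of `B̂`. -/
def IsOutput {R : ℕ} (x : Fin I → Fin T → Matrix (Fin B) (Fin P) ℝ) (y : Fin I → Fin T → ℝ)
    (What : Matrix (Fin B) (Fin R) ℝ) : Prop :=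
  ∃ U : Matrix (Fin B) (Fin R) ℝ,
    IsTopEigenframe (BHat x y) U ∧ What = invSqrt (GammaHat x) * U

end Algorithm

/-! ### The constant `k` -/

section Constant

variable {I B P R : ℕ} (Γ : Matrix (Fin B) (Fin B) ℝ) (Δ : Fin I → Matrix (Fin P) (Fin P) ℝ)
  (W : Matrix (Fin B) (Fin R) ℝ) (V : Fin I → Matrix (Fin P) (Fin R) ℝ)

/-- The average of a quantity over the `I` tasks. -/
def avg {I : ℕ} (f : Fin I → ℝ) : ℝ := (1 / (I : ℝ)) * ∑ i, f i

/-- `L_i = ‖Γ‖₂² ‖W‖₂² ‖Δ_i‖₂² ‖V_i‖₂²`. -/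
def Lcoef (i : Fin I) : ℝ :=
  specNorm Γ ^ 2 * specNorm W ^ 2 * specNorm (Δ i) ^ 2 * specNorm (V i) ^ 2

/-- `Q = (1 / I) ∑_i V_iᵀ Δ_i² V_i`. -/
def Qmat : Matrix (Fin R) (Fin R) ℝ := (1 / (I : ℝ)) • ∑ i, (V i)ᵀ * (Δ i * Δ i) * V i

/-- The `R`-th largest eigenvalue of the `B × B` matrix `Γ W Q Wᵀ Γ`, which has rank at most `R`:
its smallest nonzero eigenvalue when the rank is `R`. -/
def lamSignal : ℝ := eig (Γ * W * Qmat Δ V * Wᵀ * Γ) R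

/-- `η = (avg_i L_i) / λ`. -/
def etaCoef : ℝ := avg (fun i => Lcoef Γ Δ W V i) / lamSignal Γ Δ W V

/-- `α = (avg_i L_i²) / λ²`. -/
def alphaCoef : ℝ := avg (fun i => Lcoef Γ Δ W V i ^ 2) / lamSignal Γ Δ W V ^ 2

/-- `μ = √(avg_i L_i⁴) / λ²`. -/
def muCoef : ℝ := √(avg (fun i => Lcoef Γ Δ W V i ^ 4)) / lamSignal Γ Δ W V ^ 2

/-- `ν = (max_i L_i) / λ`. -/
def nuCoef : ℝ := (⨆ i, Lcoef Γ Δ W V i) / lamSignal Γ Δ W V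

/-- `(1 / (I P)) ∑_i tr Δ_i`. -/
def traceScale : ℝ := (1 / ((I : ℝ) * P)) * ∑ i, (Δ i).trace

/-- `ψ = (avg_i ‖Δ_i‖₂²) / ((1 / (I P)) ∑_i tr Δ_i)²`. -/
def psiCoef : ℝ := avg (fun i => specNorm (Δ i) ^ 2) / traceScale Δ ^ 2

/-- `χ = (max_i ‖Δ_i‖₂) / ((1 / (I P)) ∑_i tr Δ_i)`. -/
def chiCoef : ℝ := (⨆ i, specNorm (Δ i)) / traceScale Δ

/-- The condition number `κ_Γ = ‖Γ‖₂ / λ_min(Γ)`. -/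
def kappa : ℝ := specNorm Γ / eig Γ B

/-- `k' = c₁ α + c₂ μ + c₃ max{ν, ν²} + 5 D' max{κ η χ, κ² η² ψ}`. -/
def kPrime (c₁ c₂ c₃ D' : ℝ) : ℝ :=
  c₁ * alphaCoef Γ Δ W V + c₂ * muCoef Γ Δ W V
    + c₃ * max (nuCoef Γ Δ W V) (nuCoef Γ Δ W V ^ 2)
    + 5 * D' * max (kappa Γ * etaCoef Γ Δ W V * chiCoef Δ)
        (kappa Γ ^ 2 * etaCoef Γ Δ W V ^ 2 * psiCoef Δ)

/-- `k = c(κ_Γ)² k'`. -/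
def kConst (c₁ c₂ c₃ D' : ℝ) (c : ℝ → ℝ) : ℝ :=
  c (kappa Γ) ^ 2 * kPrime Γ Δ W V c₁ c₂ c₃ D'

end Constant

end MultiTask

end

namespace MultiTask

/-! ### Exponential moments of Gaussian quadratic forms -/

/-! Let `σ_i` be the variance of the responses of task `i`, `q_i = (1/T) ∑_t y_it²` and `M_i = Γ W
V_iᵀ Δ_i`, the covariance of response and covariates. Gaussian regression writes `X_it = y_it A_i +
Z_it` with `A_i = M_i / σ_i` and residuals `Z_it` independent of all the responses. Given the
responses, the mean of `Â` is therefore exactly `c Γ + H`, where `c ≥ 0` is a scalar and `H = (1/I)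
∑_i (q_i² - q_i σ_i / T) A_i A_iᵀ` has its range inside that of `Γ W`.

The term `c Γ` need not be small, but whitening makes it harmless: the columns of `Ŵ` solve `Â w = ρ
Γ̂ w`, and adding a multiple of `Γ̂` to `Â` only shifts `ρ`. If `Γ̂` is close to `s Γ` and `Â` to `c
Γ + H`, then for `x` in the column space of `Ŵ` the vector `Γ̂ x` is close to the range of `Γ W`, so
`x` is close to the column space of `W`. This deterministic argument is `subspaceDist_output_le`. It
asks that `H` be bounded below on an `R`-dimensional space, not that `H` concentrate: the identity
`q² - qσ/T = (q-σ)² + (2-1/T)(q-σ)σ + (1-1/T)σ²` allows the square to be dropped, and what remains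
is linear in `q` with mean a multiple of the signal `Γ W Q Wᵀ Γ` (`le_dotProduct_weightedReg`).

Three spectral norms remain: those of `Γ̂ - sΓ`, of the linear deviation in `q_i - σ_i`, and of `Â -
cΓ - H`. At a fixed unit vector the first two are centered quadratic forms in Gaussian vectors, and
the third is a quadratic polynomial in Gaussian residuals once the responses are frozen.
`lintegral_exp_block_quadratic_le` bounds their exponential moments,
`measure_le_of_lintegral_exp_le` turns these into Bernstein tails,
`measure_prodMk_mem_le_of_indepFun` removes the conditioning, and `exists_quadratic_net` passes to
the spectral norm by a union over `5 ^ B` vectors. The conditional bound needs responses of moderate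
size: `q_i ≤ 17 Λ σ_i` for all `i`, with `Λ = max (log(IT)/T) 1`, which fails with probability at
most `1/B`, and a bound on a weighted mean of the `q_i`. That mean and the three nets cost `5
e^{-B}` in total. -/

lemma inv_sqrt_one_sub_two_mul_le_exp {a : ℝ} (ha : |a| ≤ 1 / 4) :
    (√(1 - 2 * a))⁻¹ ≤ Real.exp (a + 2 * a ^ 2) := by
  obtain ⟨h1, h2⟩ := abs_le.1 ha
  have hpos : 0 < 1 - 2 * a := by linarith
  -- This is the square of the claim. Put `y = 2a` and `z = y + y²`. For `y ≥ 0` the bound `exp z ≥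
  -- 1 + z + z²/2` leaves the surplus `(y²/2)(1 - y - y² - y³)`, nonnegative since `y ≤ 1/2`; for `y
  -- ≤ 0` the bound `exp z ≥ 1 + z` is enough, as `(1 - y)(1 + y + y²) = 1 - y³`.
  have key : 1 ≤ (1 - 2 * a) * Real.exp (2 * a + (2 * a) ^ 2) := by
    rcases le_total 0 a with h | h
    · have := Real.quadratic_le_exp_of_nonneg (x := 2 * a + (2 * a) ^ 2) (by positivity)
      have h3 : 0 ≤ 1 - 2 * a - (2 * a) ^ 2 - (2 * a) ^ 3 := by
        have : (2 * a) ^ 2 ≤ 1 / 4 := by nlinarith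
        have : (2 * a) ^ 3 ≤ 1 / 8 := by nlinarith
        linarith
      calc (1 : ℝ) ≤ 1 + (2 * a) ^ 2 / 2 * (1 - 2 * a - (2 * a) ^ 2 - (2 * a) ^ 3) := by
            have := mul_nonneg (by positivity : 0 ≤ (2 * a) ^ 2 / 2) h3
            linarith
        _ = (1 - 2 * a) * (1 + (2 * a + (2 * a) ^ 2) + (2 * a + (2 * a) ^ 2) ^ 2 / 2) := by ring
        _ ≤ _ := by gcongr
    · have := Real.add_one_le_exp (2 * a + (2 * a) ^ 2)
      calc (1 : ℝ) ≤ 1 - (2 * a) ^ 3 := by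
            have : (2 * a) ^ 3 ≤ 0 := by
              have : 0 ≤ (-a) ^ 3 := pow_nonneg (by linarith) 3
              nlinarith
            linarith
        _ = (1 - 2 * a) * (2 * a + (2 * a) ^ 2 + 1) := by ring
        _ ≤ _ := by gcongr
  have h4 : Real.exp (2 * a + (2 * a) ^ 2) = Real.exp (a + 2 * a ^ 2) ^ 2 := by
    rw [← Real.exp_nat_mul]; congr 1; push_cast; ring
  rw [h4] at key
  rw [inv_le_iff_one_le_mul₀ (Real.sqrt_pos.2 hpos)]
  have h5 := Real.sqrt_le_sqrt key
  rw [Real.sqrt_one, Real.sqrt_mul hpos.le, Real.sqrt_sq (Real.exp_pos _).le] at h5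
  linarith

/-- Completing the square turns the Gaussian density times the integrand into a multiple of the
density with variance `v' = v / (1 - 2sv) ≤ 2v` and mean `2smv'`. The linear term `2mx` is kept
because the quadratic forms will be expanded around a nonzero conditional mean. -/
lemma lintegral_exp_quadratic_gaussianReal_le (v : NNReal) (s m : ℝ) (hs : |s| * v ≤ 1 / 4) :
    ∫⁻ x, ENNReal.ofReal (Real.exp (s * (x ^ 2 + 2 * m * x - v))) ∂(gaussianReal 0 v)
      ≤ ENNReal.ofReal (Real.exp (s ^ 2 * (2 * v ^ 2 + 4 * v * m ^ 2))) := by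
  by_cases hv : v = 0
  · subst hv; simp
  have hv0 : (0 : ℝ) < v := by positivity
  have hav : |s * v| ≤ 1 / 4 := by rwa [abs_mul, abs_of_pos hv0]
  obtain ⟨h1, h2⟩ := abs_le.1 hav
  have hd : 0 < 1 - 2 * (s * v) := by linarith
  have hd' : 1 - 2 * v * s ≠ 0 := by rw [mul_assoc, mul_comm (v : ℝ)]; exact hd.ne'
  let v' : NNReal := ⟨v / (1 - 2 * (s * v)), by positivity⟩
  have hv'c : (v' : ℝ) = v / (1 - 2 * (s * v)) := rfl
  have hv' : v' ≠ 0 := by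
    intro h
    have : (v' : ℝ) = 0 := by rw [h]; rfl
    rw [hv'c] at this
    have : 0 < (v : ℝ) / (1 - 2 * (s * v)) := by positivity
    linarith
  have hpt : ∀ x : ℝ, gaussianPDFReal 0 v x * Real.exp (s * (x ^ 2 + 2 * m * x - v))
      = ((√(1 - 2 * (s * v)))⁻¹ * Real.exp (2 * s ^ 2 * m ^ 2 * v' - s * v)) *
        gaussianPDFReal (2 * s * m * v') v' x := by
    intro x
    have e1 : √(2 * Real.pi * v) = √(1 - 2 * (s * v)) * √(2 * Real.pi * v') := by
      rw [← Real.sqrt_mul hd.le, hv'c, mul_div_assoc', mul_div_cancel₀ _ hd.ne']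
    have hsq : √(1 - 2 * (s * v)) ≠ 0 := (Real.sqrt_pos.2 hd).ne'
    rw [gaussianPDFReal, gaussianPDFReal, e1, mul_inv]
    have e2 : Real.exp (-(x - 0) ^ 2 / (2 * v)) * Real.exp (s * (x ^ 2 + 2 * m * x - v))
        = Real.exp (2 * s ^ 2 * m ^ 2 * v' - s * v)
          * Real.exp (-(x - 2 * s * m * v') ^ 2 / (2 * v')) := by
      rw [← Real.exp_add, ← Real.exp_add]; congr 1
      rw [hv'c]; field_simp; ring
    calc _ = (√(1 - 2 * (s * v)))⁻¹ * (√(2 * Real.pi * v'))⁻¹ *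
          (Real.exp (-(x - 0) ^ 2 / (2 * v)) * Real.exp (s * (x ^ 2 + 2 * m * x - v))) := by ring
      _ = _ := by rw [e2]; ring
  rw [gaussianReal_of_var_ne_zero _ hv, lintegral_withDensity_eq_lintegral_mul _
    (measurable_gaussianPDF 0 v) (by fun_prop)]
  have : ∀ x, (gaussianPDF 0 v * fun x => ENNReal.ofReal (Real.exp (s * (x ^ 2 + 2 * m * x - v)))) x
      = ENNReal.ofReal ((√(1 - 2 * (s * v)))⁻¹ * Real.exp (2 * s ^ 2 * m ^ 2 * v' - s * v)) *
        ENNReal.ofReal (gaussianPDFReal (2 * s * m * v') v' x) := by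
    intro x
    rw [Pi.mul_apply, gaussianPDF, ← ENNReal.ofReal_mul (gaussianPDFReal_nonneg _ _ _), hpt,
      ENNReal.ofReal_mul (by positivity)]
  simp_rw [this]
  rw [lintegral_const_mul _ (by fun_prop), lintegral_gaussianPDFReal_eq_one _ hv', mul_one]
  apply ENNReal.ofReal_le_ofReal
  have h3 := inv_sqrt_one_sub_two_mul_le_exp hav
  have h4 : (v' : ℝ) ≤ 2 * v := by
    rw [hv'c, div_le_iff₀ hd]; nlinarith
  calc _ ≤ Real.exp (s * v + 2 * (s * v) ^ 2) * Real.exp (2 * s ^ 2 * m ^ 2 * (2 * v) - s * v) := by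
        gcongr
    _ = _ := by rw [← Real.exp_add]; congr 1; ring

lemma lintegral_prod_comp_of_iIndepFun {Ω : Type*} [MeasurableSpace Ω] {μ : Measure Ω}
    {K : Type*} [Fintype K] {E : K → Type*} [∀ k, MeasurableSpace (E k)] {F : ∀ k, Ω → E k}
    (hF : iIndepFun F μ) (hm : ∀ k, AEMeasurable (F k) μ) {f : ∀ k, E k → ENNReal}
    (hf : ∀ k, Measurable (f k)) :
    ∫⁻ ω, ∏ k, f k (F k ω) ∂μ = ∏ k, ∫⁻ ω, f k (F k ω) ∂μ := by
  have hi : iIndepFun (fun k => (hm k).mk (F k)) μ := hF.congr fun k => (hm k).ae_eq_mk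
  have h1 := lintegral_prod_eq_prod_lintegral_of_indepFun Finset.univ
    (fun k ω => f k ((hm k).mk (F k) ω)) (hi.comp f hf)
    (fun k => (hf k).comp (hm k).measurable_mk)
  have h2 : ∀ k, ∫⁻ ω, f k (F k ω) ∂μ = ∫⁻ ω, f k ((hm k).mk (F k) ω) ∂μ := fun k =>
    lintegral_congr_ae ((hm k).ae_eq_mk.fun_comp (f k))
  simp_rw [h2, ← h1]
  apply lintegral_congr_ae
  have : ∀ᵐ ω ∂μ, ∀ k, F k ω = (hm k).mk (F k) ω := ae_all_iff.2 fun k => (hm k).ae_eq_mk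
  filter_upwards [this] with ω hω
  simp_rw [hω]

/-- Uncorrelated jointly Gaussian variables. -/
lemma lintegral_exp_quadratic_le_of_uncorrelated {Ω : Type*} [MeasurableSpace Ω] {μ : Measure Ω}
    {K : Type*} [Fintype K] {F : K → Ω → ℝ} (hG : HasGaussianLaw (fun ω k => F k ω) μ)
    (h0 : ∀ k, μ[F k] = 0) (hc : ∀ k l, k ≠ l → cov[F k, F l; μ] = 0) (m : K → ℝ) (s : ℝ)
    (hs : ∀ k, |s| * Var[F k; μ] ≤ 1 / 4) :
    ∫⁻ ω, ENNReal.ofReal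
        (Real.exp (s * ∑ k, (F k ω ^ 2 + 2 * m k * F k ω - Var[F k; μ]))) ∂μ
      ≤ ENNReal.ofReal
        (Real.exp (s ^ 2 * ∑ k, (2 * Var[F k; μ] ^ 2 + 4 * Var[F k; μ] * m k ^ 2))) := by
  have hi : iIndepFun F μ := hG.iIndepFun_of_covariance_eq_zero hc
  have hk : ∀ k, HasGaussianLaw (F k) μ := fun k => hG.eval k
  simp_rw [Finset.mul_sum, Real.exp_sum, ENNReal.ofReal_prod_of_nonneg
    (fun _ _ => (Real.exp_pos _).le)]
  rw [lintegral_prod_comp_of_iIndepFun (f := fun k x => ENNReal.ofReal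
    (Real.exp (s * (x ^ 2 + 2 * m k * x - Var[F k; μ])))) hi
    (fun k => (hk k).aemeasurable) (fun k => by fun_prop)]
  apply Finset.prod_le_prod' fun k _ => ?_
  have hlaw := (hk k).map_eq_gaussianReal
  rw [h0 k] at hlaw
  have h1 := lintegral_exp_quadratic_gaussianReal_le (Var[F k; μ]).toNNReal s (m k)
    (by rw [Real.coe_toNNReal _ (variance_nonneg _ _)]; exact hs k)
  rw [← hlaw, lintegral_map' (by fun_prop) (hk k).aemeasurable,
    Real.coe_toNNReal _ (variance_nonneg _ _)] at h1
  exact h1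

/-- Exponential moments of `∑ j, (‖Y j‖² + 2 ⟪m j, Y j⟫ - E ‖Y j‖²)` for uncorrelated jointly
Gaussian vectors `Y j` whose covariance operators are at most `τ j`. -/
lemma lintegral_exp_block_quadratic_le {Ω : Type*} [MeasurableSpace Ω] {μ : Measure Ω}
    {J κ : Type*} [Fintype J] [Fintype κ] [DecidableEq κ] {Y : J → κ → Ω → ℝ}
    (hG : HasGaussianLaw (fun ω (x : J × κ) => Y x.1 x.2 ω) μ)
    (h0 : ∀ j p, μ[Y j p] = 0) (hc : ∀ i j, i ≠ j → ∀ p q, cov[Y i p, Y j q; μ] = 0)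
    (τ : J → ℝ)
    (hτ : ∀ j (w : κ → ℝ), ∑ p, ∑ q, w p * (w q * cov[Y j p, Y j q; μ]) ≤ τ j * ∑ p, w p ^ 2)
    (m : J → κ → ℝ) (s : ℝ) (hs : ∀ j, |s| * τ j ≤ 1 / 4) :
    ∫⁻ ω, ENNReal.ofReal (Real.exp (s * ∑ j, ∑ p,
        (Y j p ω ^ 2 + 2 * m j p * Y j p ω - cov[Y j p, Y j p; μ]))) ∂μ
      ≤ ENNReal.ofReal (Real.exp (s ^ 2 * ∑ j,
        (2 * Fintype.card κ * τ j ^ 2 + 4 * τ j * ∑ p, m j p ^ 2))) := by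
  have hY : ∀ j p, HasGaussianLaw (Y j p) μ := fun j p => hG.eval (j, p)
  have hL : ∀ j p, MemLp (Y j p) 2 μ := fun j p => (hY j p).memLp_two
  have := hG.isProbabilityMeasure
  -- Each block is diagonalized. Its principal components are jointly Gaussian and uncorrelated,
  -- hence independent, with the eigenvalues of `S j`, at most `τ j`, as variances. The squared
  -- norm, the pairing with `m j` and the trace of the covariance do not depend on the orthonormal
  -- basis.
  let S : J → Matrix κ κ ℝ := fun j => Matrix.of fun p q => cov[Y j p, Y j q; μ]
  have hS : ∀ j, (S j).IsHermitian := fun j => by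
    ext p q; simp [S, covariance_comm]
  let b : ∀ j, OrthonormalBasis κ ℝ (EuclideanSpace ℝ κ) := fun j => (hS j).eigenvectorBasis
  let F : J × κ → Ω → ℝ := fun x ω => ∑ p, b x.1 x.2 p * Y x.1 p ω
  have hFin : ∀ j k ω, F (j, k) ω = inner ℝ (b j k) (WithLp.toLp 2 fun p => Y j p ω) := by
    intro j k ω
    simp [F, PiLp.inner_apply, mul_comm]
  have hcov : ∀ x y : J × κ, cov[F x, F y; μ]
      = ∑ p, ∑ q, b x.1 x.2 p * (b y.1 y.2 q * cov[Y x.1 p, Y y.1 q; μ]) := by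
    intro x y
    have := covariance_fun_sum_fun_sum (μ := μ) (X := fun p ω => b x.1 x.2 p * Y x.1 p ω)
      (Y := fun p ω => b y.1 y.2 p * Y y.1 p ω) (fun p => (hL _ p).const_mul _)
      (fun p => (hL _ p).const_mul _)
    simp only [covariance_const_mul_left, covariance_const_mul_right] at this
    exact this.trans (Finset.sum_congr rfl fun p _ => Finset.sum_congr rfl fun q _ =>
      mul_left_comm _ _ _)
  have hdiag : ∀ j k l, ∑ p, ∑ q, b j k p * (b j l q * cov[Y j p, Y j q; μ])
      = (hS j).eigenvalues l * inner ℝ (b j k) (b j l) := by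
    intro j k l
    have h1 := (hS j).mulVec_eigenvectorBasis l
    have : inner ℝ (b j k) (b j l) = ∑ p, b j k p * b j l p := by
      simp [PiLp.inner_apply, mul_comm]
    rw [this, Finset.mul_sum]
    refine Finset.sum_congr rfl fun p _ => ?_
    have h2 := congrFun h1 p
    simp only [mulVec, dotProduct, Pi.smul_apply, smul_eq_mul] at h2
    rw [← Finset.mul_sum]
    have : ∑ q, b j l q * cov[Y j p, Y j q; μ] = (hS j).eigenvalues l * b j l p := by
      rw [← h2]; exact Finset.sum_congr rfl fun q _ => mul_comm _ _
    rw [this]; ring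
  have hFvar : ∀ j k, Var[F (j, k); μ] = (hS j).eigenvalues k := by
    intro j k
    have hm : AEMeasurable (F (j, k)) μ :=
      Finset.aemeasurable_fun_sum _ fun p _ => (hY j p).aemeasurable.const_mul _
    rw [← covariance_self hm, hcov, hdiag]
    simp [(b j).orthonormal.1 k]
  have hFG : HasGaussianLaw (fun ω x => F x ω) μ := by
    have := hG.map_fun (ContinuousLinearMap.pi fun x : J × κ =>
      ∑ p, b x.1 x.2 p • ContinuousLinearMap.proj (R := ℝ) (φ := fun _ : J × κ => ℝ) (x.1, p))
    convert! this using 2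
    ext x
    simp [F]
  have hF0 : ∀ x, μ[F x] = 0 := by
    intro x
    rw [integral_finsetSum _ fun p _ => ((hY _ p).integrable).const_mul _]
    simp [integral_const_mul, h0]
  have hFc : ∀ x y, x ≠ y → cov[F x, F y; μ] = 0 := by
    rintro ⟨i, k⟩ ⟨j, l⟩ hne
    rw [hcov]
    by_cases hij : i = j
    · subst hij
      have hkl : k ≠ l := fun h => hne (by rw [h])
      rw [hdiag, (b i).orthonormal.2 hkl, mul_zero]
    · simp [hc i j hij]
  have hle : ∀ j k, (hS j).eigenvalues k ≤ τ j := by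
    intro j k
    rw [← hFvar j k, ← covariance_self (hFG.eval (j, k)).aemeasurable, hcov]
    refine (hτ j _).trans_eq ?_
    have := (b j).orthonormal.1 k
    have h2 : ∑ p, b j k p ^ 2 = ‖b j k‖ ^ 2 := by
      rw [EuclideanSpace.norm_sq_eq]; simp
    simp only
    rw [h2, this]; simp
  have hnn : ∀ j k, 0 ≤ (hS j).eigenvalues k := fun j k => by
    rw [← hFvar]; exact variance_nonneg _ _
  let m' : J × κ → ℝ := fun x => inner ℝ (WithLp.toLp 2 (m x.1)) (b x.1 x.2)
  have key := lintegral_exp_quadratic_le_of_uncorrelated hFG hF0 hFc m' s (by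
    rintro ⟨j, k⟩
    rw [hFvar]
    exact (mul_le_mul_of_nonneg_left (hle j k) (abs_nonneg s)).trans (hs j))
  have e1 : ∀ ω, ∑ x, (F x ω ^ 2 + 2 * m' x * F x ω - Var[F x; μ])
      = ∑ j, ∑ p, (Y j p ω ^ 2 + 2 * m j p * Y j p ω - cov[Y j p, Y j p; μ]) := by
    intro ω
    rw [Fintype.sum_prod_type]
    refine Finset.sum_congr rfl fun j _ => ?_
    rw [Finset.sum_sub_distrib, Finset.sum_sub_distrib, Finset.sum_add_distrib,
      Finset.sum_add_distrib]
    have a1 : ∑ k, F (j, k) ω ^ 2 = ∑ p, Y j p ω ^ 2 := by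
      have := (b j).sum_sq_norm_inner_right (WithLp.toLp 2 fun p => Y j p ω)
      simp only [← hFin, Real.norm_eq_abs, sq_abs] at this
      rw [this, EuclideanSpace.norm_sq_eq]; simp
    have a2 : ∑ k, 2 * m' (j, k) * F (j, k) ω = ∑ p, 2 * m j p * Y j p ω := by
      have := (b j).sum_inner_mul_inner (WithLp.toLp 2 (m j)) (WithLp.toLp 2 fun p => Y j p ω)
      simp only [← hFin] at this
      simp_rw [mul_assoc, ← Finset.mul_sum]
      congr 1
      rw [this]; simp [PiLp.inner_apply, mul_comm]
    have a3 : ∑ k, Var[F (j, k); μ] = ∑ p, cov[Y j p, Y j p; μ] := by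
      simp_rw [hFvar]
      have := (hS j).trace_eq_sum_eigenvalues
      simpa [Matrix.trace, S] using this.symm
    rw [a1, a2, a3]
  simp_rw [e1] at key
  refine key.trans (ENNReal.ofReal_le_ofReal (Real.exp_le_exp.2
    (mul_le_mul_of_nonneg_left ?_ (sq_nonneg s))))
  rw [Fintype.sum_prod_type]
  refine Finset.sum_le_sum fun j _ => ?_
  rw [Finset.sum_add_distrib]
  have a4 : ∑ k, m' (j, k) ^ 2 = ∑ p, m j p ^ 2 := by
    have := (b j).sum_sq_norm_inner_left (WithLp.toLp 2 (m j))
    simp only [Real.norm_eq_abs, sq_abs] at this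
    rw [EuclideanSpace.norm_sq_eq] at this
    simpa [m'] using this
  refine add_le_add ?_ ?_
  · calc ∑ k, 2 * Var[F (j, k); μ] ^ 2 ≤ ∑ _k : κ, 2 * τ j ^ 2 := by
          refine Finset.sum_le_sum fun k _ => ?_
          rw [hFvar]
          have := hle j k
          have := hnn j k
          gcongr
      _ = _ := by simp; ring
  · rw [← a4, Finset.mul_sum]
    refine Finset.sum_le_sum fun k _ => ?_
    rw [hFvar]
    have := hle j k
    gcongr

/-- A Bernstein-type tail bound. -/
lemma measure_le_of_lintegral_exp_le {Ω : Type*} [MeasurableSpace Ω] {μ : Measure Ω}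
    {ξ : Ω → ℝ} (hξ : AEMeasurable ξ μ) {V b x t : ℝ} (hb : 0 < b) (hV : 0 ≤ V)
    (h : ∀ s, 0 ≤ s → s * b ≤ 1 →
      ∫⁻ ω, ENNReal.ofReal (Real.exp (s * ξ ω)) ∂μ ≤ ENNReal.ofReal (Real.exp (s ^ 2 * V)))
    (ht : 0 ≤ t) (h1 : 4 * V * x ≤ t ^ 2) (h2 : 2 * b * x ≤ t) :
    μ {ω | t ≤ ξ ω} ≤ ENNReal.ofReal (Real.exp (-x)) := by
  -- The Chernoff exponent `s²V - st` is minimized at `s = t / (2V)`. If this leaves the admissible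
  -- range, or if `V = 0`, the endpoint `s = 1/b` is used; there `2V ≤ tb` gives the exponent at
  -- most `-t / (2b)`.
  obtain ⟨s, hs0, hsb, hsx⟩ : ∃ s, 0 ≤ s ∧ s * b ≤ 1 ∧ s ^ 2 * V - s * t ≤ -x := by
    by_cases hc : t * b ≤ 2 * V ∧ 0 < V
    · obtain ⟨hc, hV⟩ := hc
      refine ⟨t / (2 * V), by positivity, ?_, ?_⟩
      · rw [div_mul_eq_mul_div, div_le_one (by positivity)]; exact hc
      · have : (t / (2 * V)) ^ 2 * V - t / (2 * V) * t = -(t ^ 2 / (4 * V)) := by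
          field_simp; ring
        rw [this, neg_le_neg_iff, le_div_iff₀ (by positivity)]; linarith
    · have hc' : 2 * V ≤ t * b := by
        by_cases hV0 : 0 < V
        · by_contra hlt
          exact hc ⟨by linarith, hV0⟩
        · have : V = 0 := le_antisymm (not_lt.1 hV0) hV
          rw [this]; simp; positivity
      refine ⟨1 / b, by positivity, by field_simp; rfl, ?_⟩
      have : (1 / b) ^ 2 * V - 1 / b * t = (V - t * b) / b ^ 2 := by field_simp
      rw [this, div_le_iff₀ (by positivity)]
      nlinarith
  have hset : {ω | t ≤ ξ ω} ⊆ {ω | ENNReal.ofReal (Real.exp (s * t)) ≤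
      ENNReal.ofReal (Real.exp (s * ξ ω))} := by
    intro ω hω
    change t ≤ ξ ω at hω
    change ENNReal.ofReal _ ≤ ENNReal.ofReal _
    apply ENNReal.ofReal_le_ofReal
    gcongr
  refine (measure_mono hset).trans ?_
  have hm := meas_ge_le_lintegral_div (μ := μ)
    (f := fun ω => ENNReal.ofReal (Real.exp (s * ξ ω))) (by fun_prop)
    (ε := ENNReal.ofReal (Real.exp (s * t))) (by simp [Real.exp_pos]) ENNReal.ofReal_ne_top
  refine hm.trans ((ENNReal.div_le_div_right (h s hs0 hsb) _).trans ?_)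
  rw [← ENNReal.ofReal_div_of_pos (Real.exp_pos _), ← Real.exp_sub]
  exact ENNReal.ofReal_le_ofReal (Real.exp_le_exp.2 hsx)

/-- Tail bounds that hold conditionally on an independent variable hold unconditionally. -/
lemma measure_prodMk_mem_le_of_indepFun {Ω E F : Type*} [MeasurableSpace Ω] [MeasurableSpace E]
    [MeasurableSpace F] {μ : Measure Ω} [IsProbabilityMeasure μ] {Y : Ω → E} {Z : Ω → F}
    (hi : IndepFun Y Z μ) (hY : AEMeasurable Y μ) (hZ : AEMeasurable Z μ) {A : Set (E × F)}
    (hA : MeasurableSet A) {δ : ENNReal} (h : ∀ c, μ {ω | (c, Z ω) ∈ A} ≤ δ) :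
    μ {ω | (Y ω, Z ω) ∈ A} ≤ δ := by
  have h1 := (indepFun_iff_map_prod_eq_prod_map_map hY hZ).1 hi
  have : IsProbabilityMeasure (μ.map Y) := Measure.isProbabilityMeasure_map hY
  have : IsProbabilityMeasure (μ.map Z) := Measure.isProbabilityMeasure_map hZ
  have h2 : μ {ω | (Y ω, Z ω) ∈ A} = (μ.map fun ω => (Y ω, Z ω)) A := by
    rw [Measure.map_apply_of_aemeasurable (hY.prodMk hZ) hA]; rfl
  rw [h2, h1, Measure.prod_apply hA]
  calc ∫⁻ c, (μ.map Z) (Prod.mk c ⁻¹' A) ∂(μ.map Y) ≤ ∫⁻ _, δ ∂(μ.map Y) := by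
        refine lintegral_mono fun c => ?_
        rw [Measure.map_apply_of_aemeasurable hZ (measurable_prodMk_left hA)]
        exact h c
    _ = δ := by simp

/-! ### Spectral norms and quadratic forms -/

lemma dotProduct_self_eq_norm_sq {n : ℕ} (x : Fin n → ℝ) : x ⬝ᵥ x = ‖WithLp.toLp 2 x‖ ^ 2 := by
  rw [EuclideanSpace.norm_sq_eq]; simp [dotProduct, sq]

lemma dotProduct_eq_inner {n : ℕ} (x y : Fin n → ℝ) :
    x ⬝ᵥ y = inner ℝ (WithLp.toLp 2 x) (WithLp.toLp 2 y) := by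
  simp [dotProduct, PiLp.inner_apply, mul_comm]

lemma specNorm_nonneg {m n : ℕ} (A : Matrix (Fin m) (Fin n) ℝ) : 0 ≤ specNorm A := norm_nonneg _

lemma norm_mulVec_le {m n : ℕ} (A : Matrix (Fin m) (Fin n) ℝ) (x : Fin n → ℝ) :
    ‖WithLp.toLp 2 (A *ᵥ x)‖ ≤ specNorm A * ‖WithLp.toLp 2 x‖ :=
  (Matrix.toEuclideanLin A).toContinuousLinearMap.le_opNorm (WithLp.toLp 2 x)

lemma specNorm_le_of_forall {m n : ℕ} (A : Matrix (Fin m) (Fin n) ℝ) {c : ℝ} (hc : 0 ≤ c)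
    (h : ∀ x, ‖WithLp.toLp 2 (A *ᵥ x)‖ ≤ c * ‖WithLp.toLp 2 x‖) : specNorm A ≤ c :=
  ContinuousLinearMap.opNorm_le_bound _ hc fun x => h x.ofLp

lemma mulVec_dotProduct_self_le {m n : ℕ} (A : Matrix (Fin m) (Fin n) ℝ) (x : Fin n → ℝ) :
    A *ᵥ x ⬝ᵥ A *ᵥ x ≤ specNorm A ^ 2 * (x ⬝ᵥ x) := by
  rw [dotProduct_self_eq_norm_sq, dotProduct_self_eq_norm_sq, ← mul_pow]
  exact pow_le_pow_left₀ (norm_nonneg _) (norm_mulVec_le A x) 2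

lemma abs_dotProduct_mulVec_le {m n : ℕ} (A : Matrix (Fin m) (Fin n) ℝ) (x : Fin m → ℝ)
    (y : Fin n → ℝ) :
    |x ⬝ᵥ A *ᵥ y| ≤ specNorm A * (‖WithLp.toLp 2 x‖ * ‖WithLp.toLp 2 y‖) := by
  rw [dotProduct_eq_inner]
  refine (abs_real_inner_le_norm _ _).trans ?_
  have := mul_le_mul_of_nonneg_left (norm_mulVec_le A y) (norm_nonneg (WithLp.toLp 2 x))
  linarith

lemma abs_dotProduct_mulVec_self_le {n : ℕ} (A : Matrix (Fin n) (Fin n) ℝ) (x : Fin n → ℝ) :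
    |x ⬝ᵥ A *ᵥ x| ≤ specNorm A * (x ⬝ᵥ x) := by
  rw [dotProduct_self_eq_norm_sq, sq]; exact abs_dotProduct_mulVec_le A x x

open scoped Matrix.Norms.L2Operator in
lemma specNorm_transpose {m n : ℕ} (A : Matrix (Fin m) (Fin n) ℝ) : specNorm Aᵀ = specNorm A := by
  have := Matrix.l2_opNorm_conjTranspose A
  rwa [conjTranspose_eq_transpose_of_trivial] at this

open scoped Matrix.Norms.L2Operator in
lemma specNorm_mul_le {l m n : ℕ} (A : Matrix (Fin l) (Fin m) ℝ) (C : Matrix (Fin m) (Fin n) ℝ) :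
    specNorm (A * C) ≤ specNorm A * specNorm C := Matrix.l2_opNorm_mul A C

lemma specNorm_pos_of_ne_zero {m n : ℕ} {A : Matrix (Fin m) (Fin n) ℝ} (h : A ≠ 0) :
    0 < specNorm A := by
  refine lt_of_le_of_ne (specNorm_nonneg A) fun h0 => h ?_
  have h1 : (Matrix.toEuclideanLin A).toContinuousLinearMap = 0 := norm_eq_zero.1 h0.symm
  have h2 : Matrix.toEuclideanLin A = 0 := by
    ext x : 1
    exact congrArg (fun f => f x) h1
  exact (LinearEquiv.map_eq_zero_iff _).1 h2

/-- A `1`-separated set of maximal cardinality on the sphere is a net, since an uncovered point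
could be added to it. The radius is `2` to match the packing bound
`Besicovitch.card_le_of_separated`; halved, the set is a `1/2`-net of the unit sphere. -/
lemma exists_maximal_separated (E : Type*) [NormedAddCommGroup E] [NormedSpace ℝ E]
    [FiniteDimensional ℝ E] :
    ∃ s : Finset E, s.card ≤ 5 ^ Module.finrank ℝ E ∧ (∀ c ∈ s, ‖c‖ = 2) ∧
      ∀ x : E, ‖x‖ = 2 → ∃ c ∈ s, ‖x - c‖ < 1 := by
  classical
  let G : Finset E → Prop := fun s => (∀ c ∈ s, ‖c‖ = 2) ∧ ∀ c ∈ s, ∀ d ∈ s, c ≠ d → 1 ≤ ‖c - d‖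
  have hcard : ∀ s, G s → s.card ≤ 5 ^ Module.finrank ℝ E := fun s hs =>
    Besicovitch.card_le_of_separated s (fun c hc => (hs.1 c hc).le) hs.2
  let Q : ℕ → Prop := fun k => ∃ s, G s ∧ s.card = k
  have hQ0 : Q 0 := ⟨∅, ⟨by simp, by simp⟩, rfl⟩
  obtain ⟨s, hs, hsk⟩ := Nat.findGreatest_spec (P := Q) (Nat.zero_le (5 ^ Module.finrank ℝ E)) hQ0
  refine ⟨s, hcard s hs, hs.1, fun x hx => ?_⟩
  by_contra hcon
  push Not at hcon
  have hxs : x ∉ s := fun h => by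
    have := hcon x h
    simp at this
    linarith
  have hG : G (insert x s) := by
    refine ⟨?_, ?_⟩
    · intro c hc
      rcases Finset.mem_insert.1 hc with rfl | hc
      exacts [hx, hs.1 c hc]
    · intro c hc d hd hne
      rcases Finset.mem_insert.1 hc with rfl | hcs <;> rcases Finset.mem_insert.1 hd with rfl | hds
      · exact absurd rfl hne
      · exact hcon d hds
      · rw [norm_sub_rev]; exact hcon c hcs
      · exact hs.2 c hcs d hds hne
  have h1 : (insert x s).card ≤ Nat.findGreatest Q (5 ^ Module.finrank ℝ E) :=
    Nat.le_findGreatest (hcard _ hG) ⟨_, hG, rfl⟩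
  rw [Finset.card_insert_of_notMem hxs] at h1
  omega

/-- For symmetric `A`, `⟨x, Ax⟩ - ⟨u, Au⟩ = ⟨x - u, A(x + u)⟩`. With `d = ‖x - u‖ ≤ 1/2` the
parallelogram law gives `d² ‖x + u‖² = d²(4 - d²) ≤ 15/16 ≤ (31/32)²`. Since `‖A‖` is the supremum
of the absolute Rayleigh quotients, `‖A‖ ≤ t + (31/32) ‖A‖`. -/
lemma exists_quadratic_net (n : ℕ) : ∃ N : Finset (Fin n → ℝ), N.card ≤ 5 ^ n ∧
    (∀ u ∈ N, u ⬝ᵥ u = 1) ∧ ∀ A : Matrix (Fin n) (Fin n) ℝ, A.IsHermitian → ∀ t, 0 ≤ t →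
      (∀ u ∈ N, |u ⬝ᵥ A *ᵥ u| ≤ t) → specNorm A ≤ 32 * t := by
  classical
  obtain ⟨s, hs1, hs2, hs3⟩ := exists_maximal_separated (EuclideanSpace ℝ (Fin n))
  rw [finrank_euclideanSpace, Fintype.card_fin] at hs1
  refine ⟨s.image fun c => ((1 / 2 : ℝ) • c).ofLp, Finset.card_image_le.trans hs1, ?_, ?_⟩
  · intro u hu
    obtain ⟨c, hc, rfl⟩ := Finset.mem_image.1 hu
    rw [dotProduct_self_eq_norm_sq]
    simp [norm_smul, hs2 c hc]
  intro A hA t ht hN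
  set T := Matrix.toEuclideanCLM (n := Fin n) (𝕜 := ℝ) A with hT
  have hTA : ‖T‖ = specNorm A := rfl
  have hsym : (T : EuclideanSpace ℝ (Fin n) →ₗ[ℝ] EuclideanSpace ℝ (Fin n)).IsSymmetric :=
    isSymmetric_toEuclideanLin_iff.mpr hA
  have hin : ∀ x y : EuclideanSpace ℝ (Fin n), inner ℝ x (T y) = x.ofLp ⬝ᵥ A *ᵥ y.ofLp :=
    fun x y => Matrix.inner_toEuclideanCLM A x y
  have hunit : ∀ x : EuclideanSpace ℝ (Fin n), ‖x‖ = 1 →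
      |inner ℝ x (T x)| ≤ t + 31 / 32 * ‖T‖ := by
    intro x hx
    obtain ⟨c, hc, hxc⟩ := hs3 ((2 : ℝ) • x) (by simp [norm_smul, hx])
    set u := (1 / 2 : ℝ) • c with hu
    have hu1 : ‖u‖ = 1 := by simp [hu, norm_smul, hs2 c hc]
    have hd : ‖x - u‖ ≤ 1 / 2 := by
      have : x - u = (1 / 2 : ℝ) • ((2 : ℝ) • x - c) := by rw [hu]; module
      rw [this, norm_smul]; norm_num; linarith
    have hq := hN u.ofLp (Finset.mem_image.2 ⟨c, hc, rfl⟩)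
    rw [← hin] at hq
    have hsymm : inner ℝ u (T x) = inner ℝ x (T u) := by
      rw [real_inner_comm]; exact hsym x u
    have hdiff : inner ℝ x (T x) - inner ℝ u (T u) = inner ℝ (x - u) (T (x + u)) := by
      rw [map_add, inner_sub_left, inner_add_right, inner_add_right, hsymm]; ring
    have hpar := parallelogram_law_with_norm ℝ x u
    have hprod : ‖x - u‖ * ‖x + u‖ ≤ 31 / 32 := by
      rw [hx, hu1] at hpar
      have h1 : 0 ≤ ‖x - u‖ * ‖x + u‖ := by positivity
      have h2 : (‖x - u‖ * ‖x + u‖) ^ 2 ≤ (31 / 32) ^ 2 := by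
        have e : (‖x - u‖ * ‖x + u‖) ^ 2 = ‖x - u‖ ^ 2 * (4 - ‖x - u‖ ^ 2) := by
          have : ‖x + u‖ ^ 2 = 4 - ‖x - u‖ ^ 2 := by nlinarith
          rw [mul_pow, this]
        have h3 : ‖x - u‖ ^ 2 ≤ 1 / 4 := by nlinarith [norm_nonneg (x - u)]
        rw [e]; nlinarith [sq_nonneg (‖x - u‖)]
      exact le_of_sq_le_sq h2 (by norm_num)
    have h5 : |inner ℝ (x - u) (T (x + u))| ≤ 31 / 32 * ‖T‖ := by
      refine (abs_real_inner_le_norm _ _).trans ?_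
      calc ‖x - u‖ * ‖T (x + u)‖ ≤ ‖x - u‖ * (‖T‖ * ‖x + u‖) := by gcongr; exact T.le_opNorm _
        _ = ‖x - u‖ * ‖x + u‖ * ‖T‖ := by ring
        _ ≤ _ := by gcongr
    calc |inner ℝ x (T x)| = |inner ℝ u (T u) + inner ℝ (x - u) (T (x + u))| := by
          rw [← hdiff]; ring_nf
      _ ≤ |inner ℝ u (T u)| + |inner ℝ (x - u) (T (x + u))| := abs_add_le _ _
      _ ≤ _ := add_le_add hq h5
  have hle : ‖T‖ ≤ t + 31 / 32 * ‖T‖ := by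
    conv_lhs => rw [T.norm_eq_iSup_rayleighQuotient hsym]
    refine ciSup_le fun x => ?_
    by_cases hx : x = 0
    · subst hx; simp; positivity
    have hx0 : ‖x‖ ≠ 0 := norm_ne_zero_iff.2 hx
    have h6 := hunit (‖x‖⁻¹ • x) (by rw [norm_smul]; simp [hx0])
    have h7 : T.rayleighQuotient x = inner ℝ (‖x‖⁻¹ • x) (T (‖x‖⁻¹ • x)) := by
      rw [map_smul, inner_smul_left, inner_smul_right, ContinuousLinearMap.rayleighQuotient,
        ContinuousLinearMap.reApplyInnerSelf_apply, real_inner_comm]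
      simp; field_simp
    rw [h7]; exact h6
  rw [hTA] at hle
  linarith

/-! ### Eigenvalues -/

lemma eig_eq_zero {n : ℕ} {A : Matrix (Fin n) (Fin n) ℝ} {r : ℕ}
    (h : ¬ (A.IsHermitian ∧ 1 ≤ r ∧ r ≤ n)) : eig A r = 0 := dif_neg h

lemma eig_anti {n : ℕ} {A : Matrix (Fin n) (Fin n) ℝ} (hA : A.IsHermitian) {r R : ℕ} (hr : 1 ≤ r)
    (hrR : r ≤ R) (hR : R ≤ n) : eig A R ≤ eig A r := by
  rw [eig, eig, dif_pos ⟨hA, hr.trans hrR, hR⟩, dif_pos ⟨hA, hr, hrR.trans hR⟩]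
  apply hA.eigenvalues₀_antitone
  simp only [Fin.mk_le_mk]
  omega

lemma exists_eigenbasis {n : ℕ} {A : Matrix (Fin n) (Fin n) ℝ} (hA : A.IsHermitian) :
    ∃ b : OrthonormalBasis (Fin n) ℝ (EuclideanSpace ℝ (Fin n)),
      ∀ x : Fin n → ℝ, x ⬝ᵥ A *ᵥ x =
        ∑ k : Fin n, eig A (k + 1) * inner ℝ (b k) (WithLp.toLp 2 x) ^ 2 := by
  let b₀ := (isSymmetric_toEuclideanLin_iff.mpr hA).eigenvectorBasis finrank_euclideanSpace
  have hb₀ : ∀ k, Matrix.toEuclideanLin A (b₀ k) = hA.eigenvalues₀ k • b₀ k := fun k =>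
    (isSymmetric_toEuclideanLin_iff.mpr hA).apply_eigenvectorBasis finrank_euclideanSpace k
  let b := b₀.reindex (finCongr (Fintype.card_fin n))
  have hb : ∀ k : Fin n, Matrix.toEuclideanLin A (b k) = eig A (k + 1) • b k := by
    intro k
    rw [OrthonormalBasis.reindex_apply, hb₀, eig, dif_pos ⟨hA, by omega, by omega⟩]
    rfl
  refine ⟨b, fun x => ?_⟩
  rw [dotProduct_eq_inner]
  have h1 : WithLp.toLp 2 (A *ᵥ x) = Matrix.toEuclideanLin A (WithLp.toLp 2 x) := rfl
  rw [h1, ← b.sum_inner_mul_inner]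
  refine Finset.sum_congr rfl fun k _ => ?_
  have h2 := (isSymmetric_toEuclideanLin_iff.mpr hA) (b k) (WithLp.toLp 2 x)
  rw [← h2, hb, inner_smul_left, real_inner_comm]
  simp; ring

/-- The frame consists of the first `R` eigenvectors. This and `le_eig_of_frame` are the two halves
of Courant–Fischer, stated for injective frames rather than orthonormal ones because the frame of
the signal will be multiplied by `Γ̂^{1/2}`. -/
lemma exists_frame_eig_le {n R : ℕ} {A : Matrix (Fin n) (Fin n) ℝ} (hA : A.IsHermitian)
    (hR : R ≤ n) :
    ∃ Y : Matrix (Fin n) (Fin R) ℝ, (∀ a, Y *ᵥ a = 0 → a = 0) ∧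
      ∀ a, eig A R * (Y *ᵥ a ⬝ᵥ Y *ᵥ a) ≤ Y *ᵥ a ⬝ᵥ A *ᵥ (Y *ᵥ a) := by
  obtain ⟨b, hb⟩ := exists_eigenbasis hA
  let Y : Matrix (Fin n) (Fin R) ℝ := Matrix.of fun i r => b (Fin.castLE hR r) i
  have hY : ∀ a : Fin R → ℝ, WithLp.toLp 2 (Y *ᵥ a) = ∑ r, a r • b (Fin.castLE hR r) := by
    intro a
    ext i
    simp [Y, mulVec, dotProduct, mul_comm]
  have hin : ∀ (a : Fin R → ℝ) (k : Fin n), inner ℝ (b k) (WithLp.toLp 2 (Y *ᵥ a))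
      = if h : (k : ℕ) < R then a ⟨k, h⟩ else 0 := by
    intro a k
    rw [hY, inner_sum]
    simp_rw [inner_smul_right, b.inner_eq_ite]
    split_ifs with h
    · rw [Finset.sum_eq_single ⟨k, h⟩]
      · simp
      · intro r _ hr
        rw [if_neg, mul_zero]
        intro hk; apply hr; ext; simp [hk]
      · simp
    · refine Finset.sum_eq_zero fun r _ => ?_
      rw [if_neg, mul_zero]
      intro hk; apply h; rw [hk]; simp
  refine ⟨Y, fun a ha => ?_, fun a => ?_⟩
  · ext r
    have := hin a (Fin.castLE hR r)
    rw [ha] at this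
    simpa using this.symm
  · rw [hb, dotProduct_self_eq_norm_sq, ← b.sum_sq_norm_inner_right, Finset.mul_sum]
    refine Finset.sum_le_sum fun k _ => ?_
    simp only [Real.norm_eq_abs, sq_abs]
    by_cases h : (k : ℕ) < R
    · exact mul_le_mul_of_nonneg_right (eig_anti hA (by omega) (by omega) hR) (sq_nonneg _)
    · rw [hin, dif_neg h]; simp

/-- By dimension, the `R`-dimensional range of `Y` contains a nonzero vector orthogonal to the first
`R - 1` eigenvectors; its Rayleigh quotient is at most the `R`-th eigenvalue. -/
lemma le_eig_of_frame {n R : ℕ} {A : Matrix (Fin n) (Fin n) ℝ} (hA : A.IsHermitian)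
    (h1 : 1 ≤ R) (hR : R ≤ n) {Y : Matrix (Fin n) (Fin R) ℝ} (hY : ∀ a, Y *ᵥ a = 0 → a = 0)
    {m : ℝ} (h : ∀ a, m * (Y *ᵥ a ⬝ᵥ Y *ᵥ a) ≤ Y *ᵥ a ⬝ᵥ A *ᵥ (Y *ᵥ a)) : m ≤ eig A R := by
  obtain ⟨b, hb⟩ := exists_eigenbasis hA
  let φ : (Fin R → ℝ) →ₗ[ℝ] (Fin (R - 1) → ℝ) := LinearMap.pi fun k =>
    (innerₛₗ ℝ (b ⟨k, by omega⟩)) ∘ₗ (WithLp.linearEquiv 2 ℝ (Fin n → ℝ)).symm.toLinearMap ∘ₗ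
      Y.mulVecLin
  have hφ : ∀ a k, φ a k = inner ℝ (b ⟨k, by omega⟩) (WithLp.toLp 2 (Y *ᵥ a)) := fun a k => rfl
  have hker : LinearMap.ker φ ≠ ⊥ := LinearMap.ker_ne_bot_of_finrank_lt (by simp; omega)
  obtain ⟨a, ha, ha0⟩ := (Submodule.ne_bot_iff _).1 hker
  have hpos : 0 < Y *ᵥ a ⬝ᵥ Y *ᵥ a := by
    rw [dotProduct_self_eq_norm_sq]
    have : WithLp.toLp 2 (Y *ᵥ a) ≠ 0 := fun h0 => ha0 (hY a (by
      simpa using congrArg WithLp.ofLp h0))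
    positivity
  have hle : Y *ᵥ a ⬝ᵥ A *ᵥ (Y *ᵥ a) ≤ eig A R * (Y *ᵥ a ⬝ᵥ Y *ᵥ a) := by
    rw [hb, dotProduct_self_eq_norm_sq, ← b.sum_sq_norm_inner_right, Finset.mul_sum]
    refine Finset.sum_le_sum fun k _ => ?_
    simp only [Real.norm_eq_abs, sq_abs]
    by_cases hk : (k : ℕ) < R - 1
    · have h2 : φ a ⟨k, hk⟩ = 0 := by rw [LinearMap.mem_ker.1 ha]; rfl
      rw [hφ] at h2
      simp only [Fin.eta] at h2
      rw [h2]; simp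
    · exact mul_le_mul_of_nonneg_right (eig_anti hA h1 (by omega) (by omega)) (sq_nonneg _)
  exact le_of_mul_le_mul_right ((h a).trans hle) hpos

lemma eig_mul_dotProduct_le {n : ℕ} {A : Matrix (Fin n) (Fin n) ℝ} (hA : A.IsHermitian)
    (x : Fin n → ℝ) : eig A n * (x ⬝ᵥ x) ≤ x ⬝ᵥ A *ᵥ x := by
  obtain ⟨b, hb⟩ := exists_eigenbasis hA
  rw [hb, dotProduct_self_eq_norm_sq, ← b.sum_sq_norm_inner_right, Finset.mul_sum]
  refine Finset.sum_le_sum fun k _ => ?_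
  simp only [Real.norm_eq_abs, sq_abs]
  exact mul_le_mul_of_nonneg_right (eig_anti hA (by omega) (by omega) le_rfl) (sq_nonneg _)

/-! ### Distances between column spaces -/

/-- One-sided closeness suffices, and `W₂` may be rank deficient a priori: the projection onto `L`
restricted to `K` is injective because `δ < 1`, so `dim L ≤ R = dim K` forces it to be bijective.
Inverting it shows that `L` is also close to `K`, at the price of a factor `2`. -/
lemma subspaceDist_le {n R : ℕ} {W₁ W₂ : Matrix (Fin n) (Fin R) ℝ} {δ : ℝ} (hδ0 : 0 ≤ δ)
    (hδ : δ ≤ 1 / 2) (hinj : ∀ a, W₁ *ᵥ a = 0 → a = 0)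
    (h : ∀ x ∈ colSpace W₁, ∃ w ∈ colSpace W₂, ‖x - w‖ ≤ δ * ‖x‖) :
    subspaceDist W₁ W₂ ≤ 3 * δ := by
  set K := colSpace W₁ with hK
  set L := colSpace W₂ with hL
  have hproj : ∀ x ∈ K, ‖x - L.starProjection x‖ ≤ δ * ‖x‖ := by
    intro x hx
    obtain ⟨w, hw, hle⟩ := h x hx
    refine le_trans ?_ hle
    rw [L.starProjection_minimal]
    exact ciInf_le ⟨0, by rintro _ ⟨y, rfl⟩; positivity⟩ (⟨w, hw⟩ : L)
  have hrK : Module.finrank ℝ K = R := by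
    have hi : Function.Injective (Matrix.toEuclideanLin W₁) := by
      rw [injective_iff_map_eq_zero]
      intro a ha
      have := hinj a.ofLp (congrArg WithLp.ofLp ha)
      ext i
      exact congrFun this i
    rw [hK, colSpace, LinearMap.finrank_range_of_inj hi]
    simp
  have hrL : Module.finrank ℝ L ≤ R := by
    rw [hL, colSpace]
    refine (LinearMap.finrank_range_le _).trans ?_
    simp
  let f : K →ₗ[ℝ] L := L.orthogonalProjectionOnto.toLinearMap ∘ₗ K.subtype
  have hf : ∀ x : K, ((f x : L) : EuclideanSpace ℝ (Fin n)) = L.starProjection x := fun x => rfl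
  have hfinj : Function.Injective f := by
    rw [injective_iff_map_eq_zero]
    intro x hx
    have h1 := hproj x x.2
    rw [← hf, hx] at h1
    simp only [ZeroMemClass.coe_zero, sub_zero] at h1
    have h2 : ‖(x : EuclideanSpace ℝ (Fin n))‖ = 0 := by
      nlinarith [norm_nonneg (x : EuclideanSpace ℝ (Fin n))]
    exact Subtype.ext (norm_eq_zero.1 h2)
  have hdim : Module.finrank ℝ K = Module.finrank ℝ L :=
    le_antisymm (LinearMap.finrank_le_finrank_of_injective hfinj) (hrL.trans hrK.ge)
  have hfsurj : Function.Surjective f :=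
    (LinearMap.injective_iff_surjective_of_finrank_eq_finrank hdim).1 hfinj
  have hback : ∀ v ∈ L, ‖v - K.starProjection v‖ ≤ 2 * δ * ‖v‖ := by
    intro v hv
    obtain ⟨x, hx⟩ := hfsurj ⟨v, hv⟩
    have hxv : L.starProjection x = v := by rw [← hf, hx]
    have h1 := hproj x x.2
    rw [hxv] at h1
    have h2 : ‖(x : EuclideanSpace ℝ (Fin n))‖ ≤ 2 * ‖v‖ := by
      have := norm_sub_norm_le (x : EuclideanSpace ℝ (Fin n)) v
      nlinarith [norm_nonneg (x : EuclideanSpace ℝ (Fin n))]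
    calc ‖v - K.starProjection v‖ ≤ ‖v - x‖ := by
          rw [K.starProjection_minimal]
          exact ciInf_le ⟨0, by rintro _ ⟨y, rfl⟩; positivity⟩ x
      _ = ‖(x : EuclideanSpace ℝ (Fin n)) - v‖ := norm_sub_rev _ _
      _ ≤ δ * ‖(x : EuclideanSpace ℝ (Fin n))‖ := h1
      _ ≤ δ * (2 * ‖v‖) := by gcongr
      _ = _ := by ring
  refine ContinuousLinearMap.opNorm_le_bound _ (by positivity) fun z => ?_
  have hz1 : ‖K.starProjection z - L.starProjection (K.starProjection z)‖ ≤ δ * ‖z‖ := by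
    refine (hproj _ (K.starProjection_apply_mem z)).trans ?_
    gcongr
    exact K.norm_starProjection_apply_le z
  -- Here `P_K - P_L = (P_K - P_L P_K) - P_L (1 - P_K)`. The first term has norm at most `δ`. The
  -- second is handled by duality, `‖v‖² = ⟨v, z - P_K z⟩ = ⟨v - P_K v, z⟩`, and contributes `2δ`.
  set v := L.starProjection (z - K.starProjection z) with hv
  have hz2 : ‖v‖ ≤ 2 * δ * ‖z‖ := by
    have h1 : ‖v‖ ^ 2 = inner ℝ (v - K.starProjection v) z := by
      have a1 : inner ℝ v v = inner ℝ v (z - K.starProjection z) := by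
        rw [hv, L.inner_starProjection_left_eq_right, L.starProjection_eq_self_iff.2
          (L.starProjection_apply_mem _), ← L.inner_starProjection_left_eq_right]
      rw [← real_inner_self_eq_norm_sq, a1, inner_sub_right, inner_sub_left,
        K.inner_starProjection_left_eq_right]
    have h2 : ‖v‖ ^ 2 ≤ 2 * δ * ‖v‖ * ‖z‖ := by
      rw [h1]
      refine (real_inner_le_norm _ _).trans ?_
      gcongr
      exact hback v (L.starProjection_apply_mem _)
    by_cases hv0 : ‖v‖ = 0
    · rw [hv0]; positivity
    · have : 0 < ‖v‖ := lt_of_le_of_ne (norm_nonneg _) (Ne.symm hv0)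
      nlinarith
  have : (K.starProjection - L.starProjection) z
      = (K.starProjection z - L.starProjection (K.starProjection z)) - v := by
    rw [hv, map_sub]; simp
  rw [this]
  refine (norm_sub_le _ _).trans ?_
  linarith

/-- `P_K - P_L = P_K (1 - P_L) - (1 - P_K) P_L`; the two parts are orthogonal and their norms are
controlled by the orthogonal components of `z` with respect to `L`, so Pythagoras applies twice.
This disposes of `ε > 1`. -/
lemma subspaceDist_le_one {n R : ℕ} (W₁ W₂ : Matrix (Fin n) (Fin R) ℝ) :
    subspaceDist W₁ W₂ ≤ 1 := by
  set K := colSpace W₁ with hK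
  set L := colSpace W₂ with hL
  refine ContinuousLinearMap.opNorm_le_bound _ zero_le_one fun z => ?_
  set a := K.starProjection (z - L.starProjection z) with ha
  set b := L.starProjection z - K.starProjection (L.starProjection z) with hb
  have hz : (K.starProjection - L.starProjection) z = a - b := by
    rw [ha, hb, map_sub]; simp
  have hab : inner ℝ a b = 0 := by
    rw [real_inner_comm]
    exact K.starProjection_inner_eq_zero _ _ (K.starProjection_apply_mem _)
  have h1 : ‖a - b‖ ^ 2 = ‖a‖ ^ 2 + ‖b‖ ^ 2 := by
    rw [norm_sub_sq_real, hab]; ring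
  have h2 : ‖a‖ ≤ ‖z - L.starProjection z‖ := K.norm_starProjection_apply_le _
  have h3 : ‖b‖ ≤ ‖L.starProjection z‖ := by
    rw [hb, K.starProjection_minimal]
    refine (ciInf_le ⟨0, by rintro _ ⟨y, rfl⟩; positivity⟩ (0 : K)).trans_eq ?_
    simp
  have h4 : ‖z‖ ^ 2 = ‖z - L.starProjection z‖ ^ 2 + ‖L.starProjection z‖ ^ 2 := by
    have h5 : inner ℝ (z - L.starProjection z) (L.starProjection z) = 0 :=
      L.starProjection_inner_eq_zero _ _ (L.starProjection_apply_mem _)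
    have h6 := norm_add_sq_real (z - L.starProjection z) (L.starProjection z)
    rw [sub_add_cancel, h5] at h6
    linarith
  rw [hz, one_mul]
  refine le_of_sq_le_sq ?_ (norm_nonneg _)
  rw [h1, h4]
  gcongr

/-! ### The algorithm on perturbed data -/

open scoped MatrixOrder in
lemma invSqrt_spec {n : ℕ} {G : Matrix (Fin n) (Fin n) ℝ} (hG : G.PosDef) :
    ∃ Q : Matrix (Fin n) (Fin n) ℝ, Qᵀ = Q ∧ Q * Q = G ∧ invSqrt G * Q = 1 ∧ Q * invSqrt G = 1 ∧
      (invSqrt G)ᵀ = invSqrt G := by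
  have h1 : CFC.sqrt G * CFC.sqrt G = G := CFC.sqrt_mul_sqrt_self G hG.posSemidef.nonneg
  have h2 : (CFC.sqrt G)ᵀ = CFC.sqrt G := by
    have := (CFC.sqrt_nonneg G).isSelfAdjoint
    rwa [IsSelfAdjoint, star_eq_conjTranspose, conjTranspose_eq_transpose_of_trivial] at this
  have h3 : IsUnit (CFC.sqrt G).det := by
    have h4 : (CFC.sqrt G).det * (CFC.sqrt G).det = G.det := by rw [← det_mul, h1]
    have h5 := hG.det_pos
    refine isUnit_iff_ne_zero.2 fun h0 => ?_
    rw [h0] at h4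
    simp at h4
    linarith
  refine ⟨CFC.sqrt G, h2, h1, Matrix.nonsing_inv_mul _ h3, Matrix.mul_nonsing_inv _ h3, ?_⟩
  rw [invSqrt, Matrix.transpose_nonsing_inv, h2]

lemma dotProduct_mulVec_mulVec {m n : ℕ} (A : Matrix (Fin m) (Fin n) ℝ) (x : Fin m → ℝ)
    (y : Fin n → ℝ) : x ⬝ᵥ A *ᵥ y = Aᵀ *ᵥ x ⬝ᵥ y := by
  rw [dotProduct_mulVec, mulVec_transpose]

lemma dotProduct_self_nonneg' {n : ℕ} (x : Fin n → ℝ) : 0 ≤ x ⬝ᵥ x := by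
  rw [dotProduct_self_eq_norm_sq]; positivity

/-- The deterministic core. With `Ah = (c/ts) Γh + H + E` and `H = Γ W K`, the eigenvector equation
says `Γh x = H z + E z` for each `x` in the column space of `What`, where `z` is obtained from `x`
by dividing its eigencoordinates by the shifted eigenvalues. As `H z = Γ W (K z)` and `Γh` is close
to `ts • Γ`, this puts `x` near the column space of `W`. -/
lemma subspaceDist_output_le {B R : ℕ} {Γ Γh Ah : Matrix (Fin B) (Fin B) ℝ}
    {W What U Y : Matrix (Fin B) (Fin R) ℝ} {K : Matrix (Fin R) (Fin B) ℝ}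
    {l ts e c h t δ : ℝ} (h1R : 1 ≤ R) (hRB : R ≤ B) (hl : 0 < l)
    (hlΓ : ∀ x, l * (x ⬝ᵥ x) ≤ x ⬝ᵥ Γ *ᵥ x) (hlg : l ≤ specNorm Γ)
    (hΓh : Γh.IsHermitian) (hts : 0 < ts) (he0 : 0 ≤ e)
    (he : specNorm (Γh - ts • Γ) ≤ ts * (specNorm Γ * e)) (hel : specNorm Γ * e ≤ l / 2)
    (hAh : Ah.IsHermitian) (hc : 0 ≤ c) (ht0 : 0 ≤ t)
    (hE : specNorm (Ah - c • Γ - Γ * W * K) ≤ t)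
    (hY : ∀ a, Y *ᵥ a = 0 → a = 0)
    (hYH : ∀ a, h * (Y *ᵥ a ⬝ᵥ Y *ᵥ a) ≤ Y *ᵥ a ⬝ᵥ (Γ * W * K) *ᵥ (Y *ᵥ a))
    (hh : 0 < h) (hth : 2 * (t + c * (specNorm Γ * e)) ≤ h)
    (hU : IsTopEigenframe (invSqrt Γh * Ah * invSqrt Γh) U) (hWhat : What = invSqrt Γh * U)
    (hδ : δ = 6 * (specNorm Γ / l) ^ 2 * ((t + c * (specNorm Γ * e)) / h) + specNorm Γ * e / l)
    (hδ2 : δ ≤ 1 / 2) :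
    subspaceDist What W ≤ 3 * δ := by
  set g := specNorm Γ with hg
  have hg0 : 0 < g := hl.trans_le hlg
  set t2 := t + c * (g * e) with ht2
  have ht20 : 0 ≤ t2 := by positivity
  set H := Γ * W * K with hH
  -- bounds for the sample covariance
  have hΓx : ∀ x, Γh *ᵥ x = (Γh - ts • Γ) *ᵥ x + ts • (Γ *ᵥ x) := by
    intro x; rw [sub_mulVec, smul_mulVec]; abel
  have hΓq : ∀ x, |x ⬝ᵥ Γh *ᵥ x - ts * (x ⬝ᵥ Γ *ᵥ x)| ≤ ts * (g * e) * (x ⬝ᵥ x) := by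
    intro x
    rw [hΓx, dotProduct_add, dotProduct_smul, smul_eq_mul, add_sub_cancel_right]
    exact (abs_dotProduct_mulVec_self_le _ x).trans
      (mul_le_mul_of_nonneg_right he (dotProduct_self_nonneg' x))
  have hlow : ∀ x, ts * l / 2 * (x ⬝ᵥ x) ≤ x ⬝ᵥ Γh *ᵥ x := by
    intro x
    have a1 := (abs_le.1 (hΓq x)).1
    have a2 := mul_le_mul_of_nonneg_left (hlΓ x) hts.le
    have a3 : ts * (g * e) * (x ⬝ᵥ x) ≤ ts * (l / 2) * (x ⬝ᵥ x) :=
      mul_le_mul_of_nonneg_right (mul_le_mul_of_nonneg_left hel hts.le) (dotProduct_self_nonneg' x)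
    linarith
  have hupp : ∀ x, x ⬝ᵥ Γh *ᵥ x ≤ 3 / 2 * (ts * g) * (x ⬝ᵥ x) := by
    intro x
    have a1 := (abs_le.1 (hΓq x)).2
    have a2 := mul_le_mul_of_nonneg_left
      ((le_abs_self _).trans (abs_dotProduct_mulVec_self_le Γ x)) hts.le
    have a3 : ts * (g * e) * (x ⬝ᵥ x) ≤ ts * (g / 2) * (x ⬝ᵥ x) :=
      mul_le_mul_of_nonneg_right (mul_le_mul_of_nonneg_left (by linarith) hts.le)
        (dotProduct_self_nonneg' x)
    rw [← hg] at a2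
    linarith
  have hpd : Γh.PosDef := by
    refine Matrix.PosDef.of_dotProduct_mulVec_pos hΓh fun x hx => ?_
    have hx0 : 0 < x ⬝ᵥ x := by
      rw [dotProduct_self_eq_norm_sq]
      have : WithLp.toLp 2 x ≠ 0 := fun h0 => hx (by simpa using congrArg WithLp.ofLp h0)
      positivity
    have : 0 < ts * l / 2 * (x ⬝ᵥ x) := by positivity
    simpa using this.trans_le (hlow x)
  obtain ⟨Q, hQt, hQQ, hQ1, hQ2, hQi⟩ := invSqrt_spec hpd
  set N := invSqrt Γh with hN
  -- the residual
  set E := Ah - (c / ts) • Γh - H with hEdef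
  have hEn : specNorm E ≤ t2 := by
    have : E = (Ah - c • Γ - H) - (c / ts) • (Γh - ts • Γ) := by
      rw [hEdef, smul_sub, smul_smul, div_mul_cancel₀ _ hts.ne']; abel
    refine specNorm_le_of_forall _ ht20 fun x => ?_
    rw [this, sub_mulVec, smul_mulVec, WithLp.toLp_sub, WithLp.toLp_smul]
    refine (norm_sub_le _ _).trans ?_
    rw [norm_smul, Real.norm_of_nonneg (by positivity)]
    calc _ ≤ t * ‖WithLp.toLp 2 x‖ + c / ts * (ts * (g * e) * ‖WithLp.toLp 2 x‖) := by
          gcongr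
          · exact (norm_mulVec_le _ x).trans (by gcongr)
          · exact (norm_mulVec_le _ x).trans (by gcongr)
      _ = _ := by rw [ht2]; field_simp
  have hAx : ∀ x, Ah *ᵥ x = (c / ts) • (Γh *ᵥ x) + H *ᵥ x + E *ᵥ x := by
    intro x
    rw [hEdef, sub_mulVec, sub_mulVec, smul_mulVec]; abel
  -- lower bound for the top eigenvalues
  set d := h / (3 * (ts * g)) with hd
  have hd0 : 0 < d := by positivity
  set Bh := N * Ah * N with hBh
  have hBherm : Bh.IsHermitian := by
    have hA' : Ahᵀ = Ah := by rw [← conjTranspose_eq_transpose_of_trivial]; exact hAh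
    rw [IsHermitian, conjTranspose_eq_transpose_of_trivial, hBh, transpose_mul, transpose_mul,
      hQi, hA', Matrix.mul_assoc]
  have heigR : c / ts + d ≤ eig Bh R := by
    refine le_eig_of_frame hBherm h1R hRB (Y := Q * Y) (fun a ha => hY a ?_) fun a => ?_
    · have : N *ᵥ ((Q * Y) *ᵥ a) = Y *ᵥ a := by
        rw [mulVec_mulVec, ← Matrix.mul_assoc, hQ1, Matrix.one_mul]
      rw [← this, ha, mulVec_zero]
    · set x := Y *ᵥ a with hx
      have hQx : (Q * Y) *ᵥ a = Q *ᵥ x := by rw [hx, mulVec_mulVec]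
      have e1 : Q *ᵥ x ⬝ᵥ Q *ᵥ x = x ⬝ᵥ Γh *ᵥ x := by
        rw [← hQQ, ← mulVec_mulVec, dotProduct_mulVec_mulVec Q x, hQt]
      have e2 : Q *ᵥ x ⬝ᵥ Bh *ᵥ (Q *ᵥ x) = x ⬝ᵥ Ah *ᵥ x := by
        have e3 : N *ᵥ (Q *ᵥ x) = x := by rw [mulVec_mulVec, hQ1, one_mulVec]
        rw [hBh, ← mulVec_mulVec, ← mulVec_mulVec, e3, dotProduct_mulVec_mulVec N, hQi, e3]
      rw [hQx, e1, e2, hAx, dotProduct_add, dotProduct_add, dotProduct_smul, smul_eq_mul]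
      have a1 := (abs_le.1 (abs_dotProduct_mulVec_self_le E x)).1
      have a2 : specNorm E * (x ⬝ᵥ x) ≤ h / 2 * (x ⬝ᵥ x) :=
        mul_le_mul_of_nonneg_right (by linarith) (dotProduct_self_nonneg' x)
      have a3 := hYH a
      have a4 : d * (x ⬝ᵥ Γh *ᵥ x) ≤ h / 2 * (x ⬝ᵥ x) := by
        refine (mul_le_mul_of_nonneg_left (hupp x) hd0.le).trans_eq ?_
        rw [hd]; field_simp
      linarith
  have hDr : ∀ r : Fin R, d ≤ eig Bh (r + 1) - c / ts := fun r => by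
    have := eig_anti hBherm (r := r + 1) (R := R) (by omega) (by omega) hRB
    linarith
  obtain ⟨hU1, hU2⟩ := hU
  have hWΓ : ∀ a, What *ᵥ a ⬝ᵥ Γh *ᵥ (What *ᵥ a) = a ⬝ᵥ a := by
    intro a
    have e1 : Q *ᵥ (What *ᵥ a) = U *ᵥ a := by
      rw [hWhat, mulVec_mulVec, ← Matrix.mul_assoc, hQ2, Matrix.one_mul]
    rw [← hQQ, ← mulVec_mulVec, dotProduct_mulVec_mulVec Q, hQt, e1,
      dotProduct_mulVec_mulVec, mulVec_mulVec, hU1, one_mulVec]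
  refine subspaceDist_le ?_ hδ2 ?_ ?_
  · rw [hδ]; positivity
  · intro a ha
    have := hWΓ a
    rw [ha] at this
    simp only [zero_dotProduct] at this
    exact dotProduct_self_eq_zero.1 this.symm
  rintro _ ⟨a', rfl⟩
  obtain ⟨a, rfl⟩ : ∃ a, a' = WithLp.toLp 2 a := ⟨a'.ofLp, rfl⟩
  -- `b` solves `(D - c/ts) b = a` for the diagonal matrix `D` of top eigenvalues, all of which
  -- exceed `c/ts` by at least `d`.
  let b : Fin R → ℝ := fun r => (eig Bh (r + 1) - c / ts)⁻¹ * a r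
  have hb : ∀ r : Fin R, eig Bh (r + 1) * b r = c / ts * b r + a r := by
    intro r
    have : eig Bh (r + 1) - c / ts ≠ 0 := (hd0.trans_le (hDr r)).ne'
    have h3 : (eig Bh (r + 1) - c / ts) * b r = a r := by
      simp only [b]; rw [← mul_assoc, mul_inv_cancel₀ this, one_mul]
    linarith
  have hAW : Ah *ᵥ (What *ᵥ b) = Γh *ᵥ (What *ᵥ ((c / ts) • b + a)) := by
    have e1 : Ah * What = Q * (Bh * U) := by
      rw [hBh, hWhat]
      calc Ah * (N * U) = (Q * N) * (Ah * (N * U)) := by rw [hQ2, Matrix.one_mul]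
        _ = _ := by simp only [Matrix.mul_assoc]
    have e2 : Γh * What = Q * U := by
      rw [← hQQ, hWhat]
      calc Q * Q * (N * U) = Q * ((Q * N) * U) := by simp only [Matrix.mul_assoc]
        _ = _ := by rw [hQ2, Matrix.one_mul]
    rw [mulVec_mulVec, mulVec_mulVec, e1, e2, hU2, ← Matrix.mul_assoc, ← mulVec_mulVec]
    congr 1
    ext r
    rw [mulVec_diagonal, hb]
    simp
  rw [mulVec_add, mulVec_add, mulVec_smul, mulVec_smul, hAx, add_assoc] at hAW
  have hres : H *ᵥ (What *ᵥ b) + E *ᵥ (What *ᵥ b) = Γh *ᵥ (What *ᵥ a) := add_left_cancel hAW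
  set x := What *ᵥ a with hx
  set z := What *ᵥ b with hz
  let w : Fin R → ℝ := ts⁻¹ • (K *ᵥ z)
  have hΓdiff : Γ *ᵥ (x - W *ᵥ w) = ts⁻¹ • (E *ᵥ z - (Γh - ts • Γ) *ᵥ x) := by
    have e1 : Γ *ᵥ (W *ᵥ w) = ts⁻¹ • (H *ᵥ z) := by
      simp only [w, mulVec_smul, hH, mulVec_mulVec, Matrix.mul_assoc]
    have e2 : Γ *ᵥ x = ts⁻¹ • (Γh *ᵥ x - (Γh - ts • Γ) *ᵥ x) := by
      rw [hΓx x, add_sub_cancel_left, smul_smul, inv_mul_cancel₀ hts.ne', one_smul]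
    rw [mulVec_sub, e1, e2, ← smul_sub, ← hres]
    congr 1; abel
  have hnz : ‖WithLp.toLp 2 z‖ ≤ 2 * (g / l) / d * ‖WithLp.toLp 2 x‖ := by
    refine le_of_sq_le_sq ?_ (by positivity)
    rw [mul_pow, ← dotProduct_self_eq_norm_sq, ← dotProduct_self_eq_norm_sq]
    have b1 : b ⬝ᵥ b ≤ d⁻¹ ^ 2 * (a ⬝ᵥ a) := by
      rw [dotProduct, dotProduct, Finset.mul_sum]
      refine Finset.sum_le_sum fun r _ => ?_
      have b2 : (eig Bh (r + 1) - c / ts)⁻¹ ≤ d⁻¹ := inv_anti₀ hd0 (hDr r)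
      have b3 : 0 ≤ (eig Bh (r + 1) - c / ts)⁻¹ := inv_nonneg.2 (hd0.le.trans (hDr r))
      calc b r * b r = (eig Bh (r + 1) - c / ts)⁻¹ ^ 2 * (a r * a r) := by simp only [b]; ring
        _ ≤ _ := by
          have := mul_self_nonneg (a r)
          gcongr
    have b4 := hlow z
    rw [hz, hWΓ, ← hz] at b4
    have b5 := hupp x
    rw [hx, hWΓ, ← hx] at b5
    have b6 : z ⬝ᵥ z ≤ 2 / (ts * l) * (d⁻¹ ^ 2 * (3 / 2 * (ts * g) * (x ⬝ᵥ x))) := by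
      calc z ⬝ᵥ z = 2 / (ts * l) * (ts * l / 2 * (z ⬝ᵥ z)) := by field_simp
        _ ≤ 2 / (ts * l) * (d⁻¹ ^ 2 * (3 / 2 * (ts * g) * (x ⬝ᵥ x))) := by
          refine mul_le_mul_of_nonneg_left (b4.trans (b1.trans ?_)) (by positivity)
          exact mul_le_mul_of_nonneg_left b5 (by positivity)
    -- Relaxing `3 (g/l)` to `4 (g/l)²` makes the bound a perfect square.
    have hκ : 1 ≤ g / l := (one_le_div hl).2 hlg
    calc z ⬝ᵥ z ≤ _ := b6
      _ = 3 * (g / l) * (d⁻¹ ^ 2 * (x ⬝ᵥ x)) := by field_simp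
      _ ≤ 4 * (g / l) ^ 2 * (d⁻¹ ^ 2 * (x ⬝ᵥ x)) := by
        have := dotProduct_self_nonneg' x
        gcongr ?_ * _
        nlinarith
      _ = _ := by ring
  refine ⟨WithLp.toLp 2 (W *ᵥ w), ⟨WithLp.toLp 2 w, rfl⟩, ?_⟩
  change ‖WithLp.toLp 2 (x - W *ᵥ w)‖ ≤ δ * ‖WithLp.toLp 2 x‖
  set v := x - W *ᵥ w with hv
  have hv1 : l * ‖WithLp.toLp 2 v‖ ≤ ‖WithLp.toLp 2 (Γ *ᵥ v)‖ := by
    have c1 := hlΓ v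
    rw [dotProduct_self_eq_norm_sq, dotProduct_eq_inner] at c1
    have c2 := c1.trans (real_inner_le_norm _ _)
    by_cases h0 : ‖WithLp.toLp 2 v‖ = 0
    · rw [h0]; simp
    · have : 0 < ‖WithLp.toLp 2 v‖ := lt_of_le_of_ne (norm_nonneg _) (Ne.symm h0)
      refine le_of_mul_le_mul_left ?_ this
      linarith
  have hv2 : ‖WithLp.toLp 2 (Γ *ᵥ v)‖
      ≤ ts⁻¹ * (t2 * (2 * (g / l) / d * ‖WithLp.toLp 2 x‖)
        + ts * (g * e) * ‖WithLp.toLp 2 x‖) := by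
    rw [hΓdiff, WithLp.toLp_smul, norm_smul, Real.norm_of_nonneg (by positivity), WithLp.toLp_sub]
    gcongr
    refine (norm_sub_le _ _).trans (add_le_add ?_ ?_)
    · exact (norm_mulVec_le _ _).trans (by gcongr)
    · exact (norm_mulVec_le _ _).trans (by gcongr)
  refine le_of_mul_le_mul_left (hv1.trans (hv2.trans_eq ?_)) hl
  rw [hδ, hd]; field_simp; ring

/-! ### Linear forms in independent Gaussian vectors -/

section LinearForms

variable {Ω J κ : Type*} [Fintype κ]

/-- The linear form with coefficients `a` in the vectors `V j`. -/
noncomputable def linearForm [Fintype J] (V : J → Ω → EuclideanSpace ℝ κ) (a : J → κ → ℝ)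
    (ω : Ω) : ℝ :=
  ∑ j, a j ⬝ᵥ (V j ω).ofLp

/-- `linearForm` as a continuous linear map in the vectors. -/
noncomputable def linearFormCLM [Fintype J] (a : J → κ → ℝ) : (J → EuclideanSpace ℝ κ) →L[ℝ] ℝ :=
  ∑ j, (innerSL ℝ (WithLp.toLp 2 (a j))) ∘L
    ContinuousLinearMap.proj (R := ℝ) (φ := fun _ : J => EuclideanSpace ℝ κ) j

lemma linearFormCLM_apply [Fintype J] (V : J → Ω → EuclideanSpace ℝ κ) (a : J → κ → ℝ) (ω : Ω) :
    linearFormCLM a (fun j => V j ω) = linearForm V a ω := by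
  simp [linearFormCLM, linearForm, PiLp.inner_apply, dotProduct, mul_comm]

variable [MeasurableSpace Ω] {μ : Measure Ω} [DecidableEq κ]
  {V : J → Ω → EuclideanSpace ℝ κ} {S : J → Matrix κ κ ℝ}

lemma hasGaussianLaw_joint [Fintype J]
    (hV : ∀ j, HasLaw (V j) (multivariateGaussian 0 (S j)) μ)
    (hi : iIndepFun V μ) : HasGaussianLaw (fun ω j => V j ω) μ :=
  hi.hasGaussianLaw fun j => (hV j).hasGaussianLaw

lemma hasGaussianLaw_linearForm [Fintype J]
    (hV : ∀ j, HasLaw (V j) (multivariateGaussian 0 (S j)) μ)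
    (hi : iIndepFun V μ) {K : Type*} [Fintype K] (a : K → J → κ → ℝ) :
    HasGaussianLaw (fun ω k => linearForm V (a k) ω) μ := by
  have := (hasGaussianLaw_joint hV hi).map_fun
    (ContinuousLinearMap.pi fun k => linearFormCLM (a k))
  convert! this using 2
  ext k
  exact (linearFormCLM_apply V (a k) _).symm

lemma memLp_dotProduct (hV : ∀ j, HasLaw (V j) (multivariateGaussian 0 (S j)) μ) (j : J)
    (a : κ → ℝ) : MemLp (fun ω => a ⬝ᵥ (V j ω).ofLp) 2 μ := by
  have h := ((hV j).hasGaussianLaw.map_fun (innerSL ℝ (WithLp.toLp 2 a))).memLp_two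
  convert! h using 2
  simp [PiLp.inner_apply, dotProduct, mul_comm]

lemma integral_dotProduct (hV : ∀ j, HasLaw (V j) (multivariateGaussian 0 (S j)) μ) (j : J)
    (a : κ → ℝ) : ∫ ω, a ⬝ᵥ (V j ω).ofLp ∂μ = 0 := by
  have h1 : ∀ v : EuclideanSpace ℝ κ, a ⬝ᵥ v.ofLp = innerSL ℝ (WithLp.toLp 2 a) v := fun v => by
    simp [PiLp.inner_apply, dotProduct, mul_comm]
  simp_rw [h1]
  rw [ContinuousLinearMap.integral_comp_comm _ (hV j).hasGaussianLaw.integrable,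
    (hV j).integral_eq]
  simp

lemma integral_linearForm [Fintype J]
    (hV : ∀ j, HasLaw (V j) (multivariateGaussian 0 (S j)) μ)
    (a : J → κ → ℝ) : ∫ ω, linearForm V a ω ∂μ = 0 := by
  simp only [linearForm]
  rw [integral_finsetSum]
  · exact Finset.sum_eq_zero fun j _ => integral_dotProduct hV j (a j)
  · intro j _
    have h := ((hV j).hasGaussianLaw.map_fun (innerSL ℝ (WithLp.toLp 2 (a j)))).integrable
    convert! h using 2
    simp [PiLp.inner_apply, dotProduct, mul_comm]

lemma covariance_dotProduct (hV : ∀ j, HasLaw (V j) (multivariateGaussian 0 (S j)) μ)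
    (hS : ∀ j, (S j).PosSemidef) (j : J) (a b : κ → ℝ) :
    cov[fun ω => a ⬝ᵥ (V j ω).ofLp, fun ω => b ⬝ᵥ (V j ω).ofLp; μ] = a ⬝ᵥ S j *ᵥ b := by
  have h1 := (hV j).covariance_fun_comp
    (f := fun v => inner ℝ (WithLp.toLp 2 a : EuclideanSpace ℝ κ) v)
    (g := fun v => inner ℝ (WithLp.toLp 2 b : EuclideanSpace ℝ κ) v) (by fun_prop) (by fun_prop)
  rw [← covarianceBilin_apply_eq_cov IsGaussian.memLp_two_id,
    covarianceBilin_multivariateGaussian (hS j)] at h1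
  rw [← h1]
  congr 1 <;> ext ω <;> simp [PiLp.inner_apply, dotProduct, mul_comm]

lemma covariance_linearForm [Fintype J]
    (hV : ∀ j, HasLaw (V j) (multivariateGaussian 0 (S j)) μ)
    (hS : ∀ j, (S j).PosSemidef) (hi : iIndepFun V μ) (a b : J → κ → ℝ) :
    cov[linearForm V a, linearForm V b; μ] = ∑ j, a j ⬝ᵥ S j *ᵥ b j := by
  have := hi.isProbabilityMeasure
  have h := covariance_fun_sum_fun_sum (μ := μ) (X := fun j ω => a j ⬝ᵥ (V j ω).ofLp)
    (Y := fun j ω => b j ⬝ᵥ (V j ω).ofLp) (fun j => memLp_dotProduct hV j _)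
    (fun j => memLp_dotProduct hV j _)
  change cov[fun ω => ∑ j, a j ⬝ᵥ (V j ω).ofLp, fun ω => ∑ j, b j ⬝ᵥ (V j ω).ofLp; μ] = _
  rw [h]
  refine Finset.sum_congr rfl fun j _ => ?_
  rw [Finset.sum_eq_single j]
  · exact covariance_dotProduct hV hS j _ _
  · intro k _ hk
    have hjk := (hi.indepFun hk.symm).comp (φ := fun v => a j ⬝ᵥ v.ofLp)
      (ψ := fun v => b k ⬝ᵥ v.ofLp) (by simp only [dotProduct]; fun_prop)
      (by simp only [dotProduct]; fun_prop)
    exact hjk.covariance_eq_zero (memLp_dotProduct hV j _) (memLp_dotProduct hV k _)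
  · simp

end LinearForms

/-! ### Regression of Gaussian vectors on their responses -/

section Regression

variable {Ω ι τ κ π : Type*} [Fintype κ]

/-- The variance of the response `c ⬝ᵥ V` to a Gaussian vector `V` with covariance `S`. -/
noncomputable def respVar (S : Matrix κ κ ℝ) (c : κ → ℝ) : ℝ := c ⬝ᵥ S *ᵥ c

/-- The coefficient of the regression of `V` on its response `c ⬝ᵥ V`. -/
noncomputable def regCoef (S : Matrix κ κ ℝ) (c : κ → ℝ) : κ → ℝ := (respVar S c)⁻¹ • (S *ᵥ c)

/-- If the response has variance zero, then `regCoef` is zero by the convention for inverses, and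
positive semidefiniteness gives `S c = 0`, so degenerate tasks need no separate treatment. -/
lemma respVar_smul_regCoef {S : Matrix κ κ ℝ} (hS : S.PosSemidef) (c : κ → ℝ) :
    respVar S c • regCoef S c = S *ᵥ c := by
  by_cases h : respVar S c = 0
  · have h1 : S *ᵥ c = 0 := by
      classical
      refine (hS.dotProduct_mulVec_zero_iff c).1 ?_
      simpa [respVar] using h
    rw [h, h1, zero_smul]
  · rw [regCoef, smul_smul, mul_inv_cancel₀ h, one_smul]

lemma respVar_nonneg {S : Matrix κ κ ℝ} (hS : S.PosSemidef) (c : κ → ℝ) : 0 ≤ respVar S c := by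
  have := hS.dotProduct_mulVec_nonneg c
  simpa [respVar] using this

lemma dotProduct_mulVec_comm_of_isHermitian {S : Matrix κ κ ℝ} (hS : S.IsHermitian)
    (a b : κ → ℝ) : a ⬝ᵥ S *ᵥ b = b ⬝ᵥ S *ᵥ a := by
  have h : Sᵀ = S := by rw [← conjTranspose_eq_transpose_of_trivial]; exact hS
  rw [dotProduct_mulVec, ← mulVec_transpose, h, dotProduct_comm]

/-- The residual has covariance `S - σ A Aᵀ`, with `σ = respVar S c` and `A = regCoef S c`. In
particular it is at most `S`, so bounds for `S` carry over to the residuals. -/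
lemma residual_form {S : Matrix κ κ ℝ} (hS : S.PosSemidef) (c f g : κ → ℝ) :
    (f - (f ⬝ᵥ regCoef S c) • c) ⬝ᵥ S *ᵥ (g - (g ⬝ᵥ regCoef S c) • c)
      = f ⬝ᵥ S *ᵥ g - respVar S c * ((f ⬝ᵥ regCoef S c) * (g ⬝ᵥ regCoef S c)) := by
  have h1 : ∀ f, f ⬝ᵥ S *ᵥ c = respVar S c * (f ⬝ᵥ regCoef S c) := fun f => by
    rw [← respVar_smul_regCoef hS, dotProduct_smul, smul_eq_mul]
  have h2 : c ⬝ᵥ S *ᵥ g = respVar S c * (g ⬝ᵥ regCoef S c) := by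
    rw [dotProduct_mulVec_comm_of_isHermitian hS.1, h1]
  have h3 : c ⬝ᵥ S *ᵥ c = respVar S c := rfl
  rw [mulVec_sub, mulVec_smul, sub_dotProduct, dotProduct_sub, dotProduct_sub, smul_dotProduct,
    smul_dotProduct, dotProduct_smul, dotProduct_smul, h1, h2, h3]
  simp only [smul_eq_mul]; ring

/-- The residual of the regression of `v` on its response `c ⬝ᵥ v`. -/
noncomputable def residual (S : Matrix κ κ ℝ) (c v : κ → ℝ) : κ → ℝ :=
  v - (c ⬝ᵥ v) • regCoef S c

lemma dotProduct_residual (S : Matrix κ κ ℝ) (c f v : κ → ℝ) :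
    f ⬝ᵥ residual S c v = (f - (f ⬝ᵥ regCoef S c) • c) ⬝ᵥ v := by
  rw [residual, dotProduct_sub, dotProduct_smul, sub_dotProduct, smul_dotProduct]
  simp only [smul_eq_mul]; ring

lemma linearForm_single {J : Type*} [Fintype J] [DecidableEq J] (V : J → Ω → EuclideanSpace ℝ κ)
    (j : J) (a : κ → ℝ) (ω : Ω) :
    linearForm V (Pi.single j a) ω = a ⬝ᵥ (V j ω).ofLp := by
  rw [linearForm, Finset.sum_eq_single j]
  · simp
  · intro k _ hk
    simp [Pi.single_eq_of_ne hk]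
  · simp

/-- The deviation of the quadratic form of the aggregated vectors from its mean given the
responses `r`, as a function of `r` and the residuals `z`. -/
noncomputable def condDev [Fintype ι] [Fintype τ] [Fintype π] (S : ι → Matrix κ κ ℝ)
    (c : ι → κ → ℝ) (f : π → κ → ℝ) (n : ℝ)
    (r : ι × τ → ℝ) (z : (ι × τ) × κ → ℝ) : ℝ :=
  ∑ i, ∑ p, (((∑ t, r (i, t) ^ 2) / n * (f p ⬝ᵥ regCoef (S i) (c i))
      + (∑ t, r (i, t) * (f p ⬝ᵥ fun k => z ((i, t), k))) / n) ^ 2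
    - ((∑ t, r (i, t) ^ 2) / n * (f p ⬝ᵥ regCoef (S i) (c i))) ^ 2
    - (∑ t, r (i, t) ^ 2) / n ^ 2 * (f p ⬝ᵥ S i *ᵥ f p
        - respVar (S i) (c i) * (f p ⬝ᵥ regCoef (S i) (c i)) ^ 2))

/-- The residuals of all the vectors. -/
noncomputable def residuals (V : ι × τ → Ω → EuclideanSpace ℝ κ) (S : ι → Matrix κ κ ℝ)
    (c : ι → κ → ℝ) (ω : Ω) (x : (ι × τ) × κ) : ℝ :=
  residual (S x.1.1) (c x.1.1) (V x.1 ω).ofLp x.2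

lemma measurable_condDev [Fintype ι] [Fintype τ] [Fintype π] (S : ι → Matrix κ κ ℝ)
    (c : ι → κ → ℝ) (f : π → κ → ℝ) (n : ℝ) :
    Measurable fun rz : (ι × τ → ℝ) × ((ι × τ) × κ → ℝ) => condDev S c f n rz.1 rz.2 := by
  simp only [condDev, dotProduct]
  fun_prop

variable [MeasurableSpace Ω] {μ : Measure Ω} [DecidableEq κ]
  {V : ι × τ → Ω → EuclideanSpace ℝ κ} {S : ι → Matrix κ κ ℝ}

lemma aemeasurable_residuals [Fintype ι] [Fintype τ]
    (hV : ∀ j, HasLaw (V j) (multivariateGaussian 0 (S j.1)) μ)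
    (c : ι → κ → ℝ) : AEMeasurable (residuals V S c) μ := by
  refine aemeasurable_pi_lambda _ fun x => ?_
  have := (memLp_dotProduct hV x.1
    (Pi.single x.2 1 - (Pi.single x.2 1 ⬝ᵥ regCoef (S x.1.1) (c x.1.1)) • c x.1.1)).1.aemeasurable
  simp_rw [← dotProduct_residual, single_one_dotProduct] at this
  exact this

variable [Fintype ι] [Fintype τ] [DecidableEq ι]

/-- Both families are linear forms in jointly Gaussian vectors, so vanishing covariance is enough,
and `(f - (f ⬝ᵥ A) c) ⬝ᵥ S c = 0` because `S c = σ A`. -/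
lemma indepFun_response_residual [DecidableEq τ]
    (hV : ∀ j, HasLaw (V j) (multivariateGaussian 0 (S j.1)) μ)
    (hS : ∀ i, (S i).PosSemidef) (hi : iIndepFun V μ) (c : ι → κ → ℝ) :
    IndepFun (fun ω (j : ι × τ) => c j.1 ⬝ᵥ (V j ω).ofLp)
      (fun ω (x : (ι × τ) × κ) => residual (S x.1.1) (c x.1.1) (V x.1 ω).ofLp x.2) μ := by
  let a : ι × τ → ι × τ → κ → ℝ := fun j => Pi.single j (c j.1)
  let b : (ι × τ) × κ → ι × τ → κ → ℝ := fun x => Pi.single x.1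
    (Pi.single x.2 1 - (Pi.single x.2 1 ⬝ᵥ regCoef (S x.1.1) (c x.1.1)) • c x.1.1)
  have ha : ∀ ω j, c j.1 ⬝ᵥ (V j ω).ofLp = linearForm V (a j) ω := fun ω j =>
    (linearForm_single V j _ ω).symm
  have hb : ∀ ω (x : (ι × τ) × κ), residual (S x.1.1) (c x.1.1) (V x.1 ω).ofLp x.2
      = linearForm V (b x) ω := by
    intro ω x
    rw [linearForm_single, ← dotProduct_residual, single_one_dotProduct]
  simp_rw [ha, hb]
  refine HasGaussianLaw.indepFun_of_covariance_eval ?_ ?_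
  · have := (hasGaussianLaw_joint hV hi).map_fun
      ((ContinuousLinearMap.pi fun j => linearFormCLM (a j)).prod
        (ContinuousLinearMap.pi fun x => linearFormCLM (b x)))
    convert! this using 2
    refine Prod.ext ?_ ?_
    · ext j; exact (linearFormCLM_apply V (a j) _).symm
    · ext j; exact (linearFormCLM_apply V (b j) _).symm
  · intro j x
    rw [covariance_linearForm hV (fun j => hS j.1) hi]
    refine Finset.sum_eq_zero fun k _ => ?_
    by_cases hkj : k = j
    · subst hkj
      by_cases hkx : k = x.1
      · subst hkx
        simp only [a, b, Pi.single_eq_same]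
        rw [dotProduct_mulVec_comm_of_isHermitian (hS _).1]
        have h1 : ∀ f, f ⬝ᵥ S x.1.1 *ᵥ c x.1.1
            = respVar (S x.1.1) (c x.1.1) * (f ⬝ᵥ regCoef (S x.1.1) (c x.1.1)) := fun f => by
          rw [← respVar_smul_regCoef (hS _), dotProduct_smul, smul_eq_mul]
        have h3 : c x.1.1 ⬝ᵥ S x.1.1 *ᵥ c x.1.1 = respVar (S x.1.1) (c x.1.1) := rfl
        rw [sub_dotProduct, smul_dotProduct, h3, h1, smul_eq_mul]; ring
      · simp only [b]; rw [Pi.single_eq_of_ne hkx]; simp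
    · simp only [a]; rw [Pi.single_eq_of_ne hkj]; simp

/-- For frozen responses `r` the aggregated residual `(1/n) ∑_t r_t Z_t` is Gaussian and independent
across tasks, with covariance multiplied by `∑ r_t² / n²`. The regression part becomes the shift `m`
in `lintegral_exp_block_quadratic_le`. -/
lemma lintegral_exp_condDev_le [Fintype π] [DecidableEq π]
    (hV : ∀ j, HasLaw (V j) (multivariateGaussian 0 (S j.1)) μ)
    (hS : ∀ i, (S i).PosSemidef) (hi : iIndepFun V μ) (c : ι → κ → ℝ) (f : π → κ → ℝ) (n : ℝ)
    (r : ι × τ → ℝ) (v : ι → ℝ)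
    (hf : ∀ i (w : π → ℝ), (∑ p, w p • f p) ⬝ᵥ S i *ᵥ (∑ p, w p • f p) ≤ v i * ∑ p, w p ^ 2)
    (s : ℝ) (hs : ∀ i, |s| * (v i * ((∑ t, r (i, t) ^ 2) / n ^ 2)) ≤ 1 / 4) :
    ∫⁻ ω, ENNReal.ofReal (Real.exp (s * condDev S c f n r
        (fun x => residual (S x.1.1) (c x.1.1) (V x.1 ω).ofLp x.2))) ∂μ
      ≤ ENNReal.ofReal (Real.exp (s ^ 2 * ∑ i,
        (2 * Fintype.card π * (v i * ((∑ t, r (i, t) ^ 2) / n ^ 2)) ^ 2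
          + 4 * (v i * ((∑ t, r (i, t) ^ 2) / n ^ 2)) *
            ∑ p, ((∑ t, r (i, t) ^ 2) / n * (f p ⬝ᵥ regCoef (S i) (c i))) ^ 2))) := by
  have := hi.isProbabilityMeasure
  let g : ι → π → κ → ℝ := fun i p => f p - (f p ⬝ᵥ regCoef (S i) (c i)) • c i
  -- These coefficients express the aggregated residual as a linear form in the original vectors,
  -- without a separate law for the residuals.
  let a : ι → π → ι × τ → κ → ℝ := fun i p j => if j.1 = i then (r j / n) • g i p else 0
  let Y : ι → π → Ω → ℝ := fun i p ω => linearForm V (a i p) ω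
  have hYv : ∀ i p ω, Y i p ω = (∑ t, r (i, t) *
      (f p ⬝ᵥ fun k => residual (S i) (c i) (V (i, t) ω).ofLp k)) / n := by
    intro i p ω
    simp only [Y, linearForm, a]
    rw [Fintype.sum_prod_type, Finset.sum_eq_single i]
    · rw [Finset.sum_div]
      refine Finset.sum_congr rfl fun t _ => ?_
      have : (f p ⬝ᵥ fun k => residual (S i) (c i) (V (i, t) ω).ofLp k)
          = g i p ⬝ᵥ (V (i, t) ω).ofLp := dotProduct_residual _ _ _ _
      rw [this]
      simp only [if_true, smul_dotProduct, smul_eq_mul]; ring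
    · intro i' _ hne
      simp [hne]
    · simp
  have hcov : ∀ i p q, cov[Y i p, Y i q; μ] = (∑ t, r (i, t) ^ 2) / n ^ 2 *
      (f p ⬝ᵥ S i *ᵥ f q - respVar (S i) (c i) *
        ((f p ⬝ᵥ regCoef (S i) (c i)) * (f q ⬝ᵥ regCoef (S i) (c i)))) := by
    intro i p q
    have h := covariance_linearForm hV (fun j => hS j.1) hi (a i p) (a i q)
    refine h.trans ?_
    simp only [a]
    rw [Fintype.sum_prod_type, Finset.sum_eq_single i]
    · rw [Finset.sum_div, Finset.sum_mul]
      refine Finset.sum_congr rfl fun t _ => ?_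
      rw [← residual_form (hS i)]
      simp only [if_true, mulVec_smul, smul_dotProduct, dotProduct_smul, smul_eq_mul, g]
      ring
    · intro i' _ hne
      simp [hne]
    · simp
  have hYG : HasGaussianLaw (fun ω (x : ι × π) => Y x.1 x.2 ω) μ :=
    hasGaussianLaw_linearForm hV hi fun x : ι × π => a x.1 x.2
  have hY0 : ∀ i p, μ[Y i p] = 0 := fun i p => integral_linearForm hV (a i p)
  have hYc : ∀ i j, i ≠ j → ∀ p q, cov[Y i p, Y j q; μ] = 0 := by
    intro i j hij p q
    have h := covariance_linearForm hV (fun j => hS j.1) hi (a i p) (a j q)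
    refine h.trans (Finset.sum_eq_zero fun k _ => ?_)
    simp only [a]
    by_cases hk : k.1 = i
    · rw [if_neg (show ¬ k.1 = j by rw [hk]; exact hij)]; simp
    · rw [if_neg hk]; simp
  have hYτ : ∀ i (w : π → ℝ), ∑ p, ∑ q, w p * (w q * cov[Y i p, Y i q; μ])
      ≤ v i * ((∑ t, r (i, t) ^ 2) / n ^ 2) * ∑ p, w p ^ 2 := by
    intro i w
    set ρ := (∑ t, r (i, t) ^ 2) / n ^ 2 with hρ
    have hρ0 : 0 ≤ ρ := by positivity
    have e1 : ∑ p, ∑ q, w p * (w q * cov[Y i p, Y i q; μ])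
        = ρ * ((∑ p, w p • f p) ⬝ᵥ S i *ᵥ (∑ p, w p • f p)
          - respVar (S i) (c i) * (∑ p, w p * (f p ⬝ᵥ regCoef (S i) (c i))) ^ 2) := by
      have e2 : (∑ p, w p • f p) ⬝ᵥ S i *ᵥ (∑ p, w p • f p)
          = ∑ p, ∑ q, w p * (w q * (f p ⬝ᵥ S i *ᵥ f q)) := by
        rw [mulVec_sum, sum_dotProduct]
        refine Finset.sum_congr rfl fun p _ => ?_
        rw [dotProduct_sum]
        refine Finset.sum_congr rfl fun q _ => ?_
        rw [mulVec_smul, smul_dotProduct, dotProduct_smul]; rfl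
      rw [e2, sq, Finset.sum_mul_sum, Finset.mul_sum, ← Finset.sum_sub_distrib, Finset.mul_sum]
      refine Finset.sum_congr rfl fun p _ => ?_
      rw [Finset.mul_sum, ← Finset.sum_sub_distrib, Finset.mul_sum]
      refine Finset.sum_congr rfl fun q _ => ?_
      rw [hcov]; ring
    rw [e1]
    have h1 := hf i w
    have h2 := respVar_nonneg (hS i) (c i)
    calc _ ≤ ρ * (v i * ∑ p, w p ^ 2) := by
          gcongr
          have : 0 ≤ respVar (S i) (c i) *
            (∑ p, w p * (f p ⬝ᵥ regCoef (S i) (c i))) ^ 2 := by positivity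
          linarith
      _ = _ := by ring
  have key := lintegral_exp_block_quadratic_le hYG hY0 hYc
    (fun i => v i * ((∑ t, r (i, t) ^ 2) / n ^ 2)) hYτ
    (fun i p => (∑ t, r (i, t) ^ 2) / n * (f p ⬝ᵥ regCoef (S i) (c i))) s hs
  refine le_of_eq_of_le ?_ key
  refine lintegral_congr fun ω => ?_
  congr 3
  rw [condDev]
  refine Finset.sum_congr rfl fun i _ => Finset.sum_congr rfl fun p _ => ?_
  rw [hcov, hYv]; ring

lemma measure_abs_condDev_ge_le [Fintype π] [DecidableEq π]
    (hV : ∀ j, HasLaw (V j) (multivariateGaussian 0 (S j.1)) μ)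
    (hS : ∀ i, (S i).PosSemidef) (hi : iIndepFun V μ) (c : ι → κ → ℝ) (f : π → κ → ℝ) (n : ℝ)
    (v : ι → ℝ)
    (hf : ∀ i (w : π → ℝ), (∑ p, w p • f p) ⬝ᵥ S i *ᵥ (∑ p, w p • f p) ≤ v i * ∑ p, w p ^ 2)
    (r : ι × τ → ℝ) {b Q x t : ℝ} (hb : 0 < b) (hQ : 0 ≤ Q)
    (hGb : ∀ i, 4 * (v i * ((∑ t, r (i, t) ^ 2) / n ^ 2)) ≤ b)
    (hGQ : ∑ i, (2 * Fintype.card π * (v i * ((∑ t, r (i, t) ^ 2) / n ^ 2)) ^ 2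
          + 4 * (v i * ((∑ t, r (i, t) ^ 2) / n ^ 2)) *
            ∑ p, ((∑ t, r (i, t) ^ 2) / n * (f p ⬝ᵥ regCoef (S i) (c i))) ^ 2) ≤ Q)
    (ht : 0 ≤ t) (h1 : 4 * Q * x ≤ t ^ 2) (h2 : 2 * b * x ≤ t) :
    μ {ω | t ≤ |condDev S c f n r (residuals V S c ω)|} ≤ 2 * ENNReal.ofReal (Real.exp (-x)) := by
  set ξ : Ω → ℝ := fun ω => condDev S c f n r (residuals V S c ω) with hξ
  have hm : Measurable fun z : (ι × τ) × κ → ℝ => condDev S c f n r z := by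
    simp only [condDev, dotProduct]
    fun_prop
  have hξm : AEMeasurable ξ μ := hm.comp_aemeasurable (aemeasurable_residuals hV c)
  have hmgf : ∀ s : ℝ, |s| * b ≤ 1 → ∫⁻ ω, ENNReal.ofReal (Real.exp (s * ξ ω)) ∂μ
      ≤ ENNReal.ofReal (Real.exp (s ^ 2 * Q)) := by
    intro s hs
    refine (lintegral_exp_condDev_le hV hS hi c f n r v hf s fun i => ?_).trans
      (ENNReal.ofReal_le_ofReal (Real.exp_le_exp.2
        (mul_le_mul_of_nonneg_left hGQ (sq_nonneg s))))
    have h3 := mul_le_mul_of_nonneg_left (hGb i) (abs_nonneg s)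
    linarith
  have hset : {ω | t ≤ |ξ ω|} ⊆ {ω | t ≤ ξ ω} ∪ {ω | t ≤ -ξ ω} := by
    intro ω hω
    have hω' : t ≤ |ξ ω| := hω
    rcases le_abs.1 hω' with h | h
    exacts [Or.inl h, Or.inr h]
  refine (measure_mono hset).trans ((measure_union_le _ _).trans ?_)
  rw [two_mul]
  refine add_le_add ?_ ?_
  · exact measure_le_of_lintegral_exp_le hξm hb hQ
      (fun s hs0 hs => hmgf s (by rwa [abs_of_nonneg hs0])) ht h1 h2
  · refine measure_le_of_lintegral_exp_le hξm.neg hb hQ (fun s hs0 hs => ?_) ht h1 h2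
    have := hmgf (-s) (by rwa [abs_neg, abs_of_nonneg hs0])
    simpa using this

/-- The tail bound is uniform over frozen responses in `G`; outside `G` the section of the event is
empty. Independence of responses and residuals then removes the conditioning. -/
lemma measure_mem_and_abs_condDev_ge_le [DecidableEq τ] [Fintype π] [DecidableEq π]
    [IsProbabilityMeasure μ]
    (hV : ∀ j, HasLaw (V j) (multivariateGaussian 0 (S j.1)) μ)
    (hS : ∀ i, (S i).PosSemidef) (hi : iIndepFun V μ) (c : ι → κ → ℝ) (f : π → κ → ℝ) (n : ℝ)
    (v : ι → ℝ)
    (hf : ∀ i (w : π → ℝ), (∑ p, w p • f p) ⬝ᵥ S i *ᵥ (∑ p, w p • f p) ≤ v i * ∑ p, w p ^ 2)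
    {G : Set (ι × τ → ℝ)} (hG : MeasurableSet G) {b Q x t : ℝ} (hb : 0 < b) (hQ : 0 ≤ Q)
    (hGb : ∀ r ∈ G, ∀ i, 4 * (v i * ((∑ t, r (i, t) ^ 2) / n ^ 2)) ≤ b)
    (hGQ : ∀ r ∈ G, ∑ i, (2 * Fintype.card π * (v i * ((∑ t, r (i, t) ^ 2) / n ^ 2)) ^ 2
          + 4 * (v i * ((∑ t, r (i, t) ^ 2) / n ^ 2)) *
            ∑ p, ((∑ t, r (i, t) ^ 2) / n * (f p ⬝ᵥ regCoef (S i) (c i))) ^ 2) ≤ Q)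
    (ht : 0 ≤ t) (h1 : 4 * Q * x ≤ t ^ 2) (h2 : 2 * b * x ≤ t) :
    μ {ω | (fun j : ι × τ => c j.1 ⬝ᵥ (V j ω).ofLp) ∈ G ∧
      t ≤ |condDev S c f n (fun j : ι × τ => c j.1 ⬝ᵥ (V j ω).ofLp) (residuals V S c ω)|}
      ≤ 2 * ENNReal.ofReal (Real.exp (-x)) := by
  have hYm : AEMeasurable (fun ω (j : ι × τ) => c j.1 ⬝ᵥ (V j ω).ofLp) μ :=
    aemeasurable_pi_lambda _ fun j => (memLp_dotProduct hV j _).1.aemeasurable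
  have hA : MeasurableSet {rz : (ι × τ → ℝ) × ((ι × τ) × κ → ℝ) |
      rz.1 ∈ G ∧ t ≤ |condDev S c f n rz.1 rz.2|} :=
    (measurable_fst hG).inter (measurableSet_le measurable_const (measurable_condDev S c f n).abs)
  refine measure_prodMk_mem_le_of_indepFun (indepFun_response_residual hV hS hi c) hYm
    (aemeasurable_residuals hV c) hA fun r => ?_
  by_cases hr : r ∈ G
  · exact (measure_mono fun ω hω => hω.2).trans (measure_abs_condDev_ge_le hV hS hi c f n v hf r hb
      hQ (hGb r hr) (hGQ r hr) ht h1 h2)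
  · exact (measure_mono_null (t := ∅) (fun ω hω => hr hω.1) measure_empty).trans_le zero_le

end Regression

/-! ### Unconditional tail bounds for Gaussian quadratic forms -/

section Tails

variable {Ω J κ π : Type*} [Fintype κ] [DecidableEq κ] [MeasurableSpace Ω] {μ : Measure Ω}
  {V : J → Ω → EuclideanSpace ℝ κ} {S : J → Matrix κ κ ℝ}

lemma response_ae_eq_zero
    (hV : ∀ j, HasLaw (V j) (multivariateGaussian 0 (S j)) μ)
    (hS : ∀ j, (S j).PosSemidef) (j : J) (c : κ → ℝ) (h : respVar (S j) c = 0) :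
    ∀ᵐ ω ∂μ, c ⬝ᵥ (V j ω).ofLp = 0 := by
  have := (hV j).isProbabilityMeasure
  have h1 := covariance_dotProduct hV hS j c c
  have h2 := memLp_dotProduct hV j c
  rw [covariance_self h2.1.aemeasurable] at h1
  filter_upwards [ae_eq_integral_of_variance_eq_zero h2 (h1.trans h)] with ω hω
  rw [hω, integral_dotProduct hV j c]

variable [Fintype J] [DecidableEq J]

/-- Tail bound for quadratic forms in independent Gaussian vectors. -/
lemma measure_abs_quadratic_ge_le [Fintype π] [DecidableEq π]
    (hV : ∀ j, HasLaw (V j) (multivariateGaussian 0 (S j)) μ)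
    (hS : ∀ j, (S j).PosSemidef) (hi : iIndepFun V μ) (f : J → π → κ → ℝ) (v : J → ℝ)
    (hf : ∀ j (w : π → ℝ),
      (∑ p, w p • f j p) ⬝ᵥ S j *ᵥ (∑ p, w p • f j p) ≤ v j * ∑ p, w p ^ 2)
    {b Q x t : ℝ} (hb : 0 < b) (hvb : ∀ j, 4 * v j ≤ b)
    (hQ : ∑ j, 2 * Fintype.card π * v j ^ 2 ≤ Q) (ht : 0 ≤ t) (h1 : 4 * Q * x ≤ t ^ 2)
    (h2 : 2 * b * x ≤ t) :
    μ {ω | t ≤ |∑ j, ∑ p, ((f j p ⬝ᵥ (V j ω).ofLp) ^ 2 - f j p ⬝ᵥ S j *ᵥ f j p)|}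
      ≤ 2 * ENNReal.ofReal (Real.exp (-x)) := by
  set ξ : Ω → ℝ := fun ω =>
    ∑ j, ∑ p, ((f j p ⬝ᵥ (V j ω).ofLp) ^ 2 - f j p ⬝ᵥ S j *ᵥ f j p) with hξ
  have hξm : AEMeasurable ξ μ := by
    refine Finset.aemeasurable_fun_sum _ fun j _ => Finset.aemeasurable_fun_sum _ fun p _ => ?_
    exact ((memLp_dotProduct hV j _).1.aemeasurable.pow_const 2).sub_const _
  have hQ0 : 0 ≤ Q := le_trans (Finset.sum_nonneg fun j _ => by positivity) hQ
  let Y : J → π → Ω → ℝ := fun j p ω => linearForm V (Pi.single j (f j p)) ω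
  have hY : ∀ j p ω, Y j p ω = f j p ⬝ᵥ (V j ω).ofLp := fun j p ω => linearForm_single V j _ ω
  have hYG : HasGaussianLaw (fun ω (x : J × π) => Y x.1 x.2 ω) μ :=
    hasGaussianLaw_linearForm hV hi fun x : J × π => Pi.single x.1 (f x.1 x.2)
  have hcov : ∀ j p q, cov[Y j p, Y j q; μ] = f j p ⬝ᵥ S j *ᵥ f j q := by
    intro j p q
    refine (covariance_linearForm hV hS hi _ _).trans ?_
    rw [Finset.sum_eq_single j]
    · simp
    · intro k _ hk
      rw [Pi.single_eq_of_ne hk]; simp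
    · simp
  have hYc : ∀ i j, i ≠ j → ∀ p q, cov[Y i p, Y j q; μ] = 0 := by
    intro i j hij p q
    refine (covariance_linearForm hV hS hi _ _).trans (Finset.sum_eq_zero fun k _ => ?_)
    by_cases hk : k = i
    · rw [Pi.single_eq_of_ne (show k ≠ j from hk ▸ hij)]; simp
    · rw [Pi.single_eq_of_ne hk]; simp
  have hτ : ∀ j (w : π → ℝ), ∑ p, ∑ q, w p * (w q * cov[Y j p, Y j q; μ])
      ≤ v j * ∑ p, w p ^ 2 := by
    intro j w
    refine le_of_eq_of_le ?_ (hf j w)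
    rw [mulVec_sum, sum_dotProduct]
    refine Finset.sum_congr rfl fun p _ => ?_
    rw [dotProduct_sum]
    refine Finset.sum_congr rfl fun q _ => ?_
    rw [hcov, mulVec_smul, smul_dotProduct, dotProduct_smul]; rfl
  have hmgf : ∀ s : ℝ, |s| * b ≤ 1 → ∫⁻ ω, ENNReal.ofReal (Real.exp (s * ξ ω)) ∂μ
      ≤ ENNReal.ofReal (Real.exp (s ^ 2 * Q)) := by
    intro s hs
    have key := lintegral_exp_block_quadratic_le hYG (fun j p => integral_linearForm hV _) hYc v hτ
      (fun _ _ => 0) s fun j => by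
        have h3 := mul_le_mul_of_nonneg_left (hvb j) (abs_nonneg s)
        linarith
    simp only [mul_zero, zero_mul, add_zero, ne_eq, OfNat.ofNat_ne_zero, not_false_eq_true,
      zero_pow, Finset.sum_const_zero, hY, hcov] at key
    refine key.trans (ENNReal.ofReal_le_ofReal (Real.exp_le_exp.2
      (mul_le_mul_of_nonneg_left hQ (sq_nonneg s))))
  have hset : {ω | t ≤ |ξ ω|} ⊆ {ω | t ≤ ξ ω} ∪ {ω | t ≤ -ξ ω} := by
    intro ω hω
    have hω' : t ≤ |ξ ω| := hω
    rcases le_abs.1 hω' with h | h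
    exacts [Or.inl h, Or.inr h]
  refine (measure_mono hset).trans ((measure_union_le _ _).trans ?_)
  rw [two_mul]
  refine add_le_add ?_ ?_
  · exact measure_le_of_lintegral_exp_le hξm hb hQ0
      (fun s hs0 hs => hmgf s (by rwa [abs_of_nonneg hs0])) ht h1 h2
  · refine measure_le_of_lintegral_exp_le hξm.neg hb hQ0 (fun s hs0 hs => ?_) ht h1 h2
    have := hmgf (-s) (by rwa [abs_neg, abs_of_nonneg hs0])
    simpa using this

/-- Tail bound for weighted sums of squares of the responses. -/
lemma measure_abs_sum_sq_response_ge_le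
    (hV : ∀ j, HasLaw (V j) (multivariateGaussian 0 (S j)) μ)
    (hS : ∀ j, (S j).PosSemidef) (hi : iIndepFun V μ) (c : J → κ → ℝ) (β : J → ℝ)
    (hβ : ∀ j, 0 ≤ β j) {b Q x t : ℝ} (hb : 0 < b)
    (hvb : ∀ j, 4 * (β j * respVar (S j) (c j)) ≤ b)
    (hQ : ∑ j, 2 * (β j * respVar (S j) (c j)) ^ 2 ≤ Q) (ht : 0 ≤ t) (h1 : 4 * Q * x ≤ t ^ 2)
    (h2 : 2 * b * x ≤ t) :
    μ {ω | t ≤ |∑ j, β j * ((c j ⬝ᵥ (V j ω).ofLp) ^ 2 - respVar (S j) (c j))|}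
      ≤ 2 * ENNReal.ofReal (Real.exp (-x)) := by
  -- One linear form per vector; the weight enters as `√(β j)` inside the square.
  have key := measure_abs_quadratic_ge_le hV hS hi (π := Unit) (fun j _ => √(β j) • c j)
    (fun j => β j * respVar (S j) (c j)) (fun j w => by
      refine le_of_eq ?_
      simp only [Finset.univ_unique, Finset.sum_singleton, smul_smul, mulVec_smul,
        smul_dotProduct, dotProduct_smul, smul_eq_mul, respVar]
      have := Real.mul_self_sqrt (hβ j)
      linear_combination (w default ^ 2 * (c j ⬝ᵥ S j *ᵥ c j)) * this)
    hb hvb (by simpa using hQ) ht h1 h2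
  have : ∀ ω j, β j * ((c j ⬝ᵥ (V j ω).ofLp) ^ 2 - respVar (S j) (c j))
      = ∑ _p : Unit, (((√(β j) • c j) ⬝ᵥ (V j ω).ofLp) ^ 2
        - (√(β j) • c j) ⬝ᵥ S j *ᵥ (√(β j) • c j)) := by
    intro ω j
    simp only [Finset.univ_unique, Finset.sum_singleton, mulVec_smul,
        smul_dotProduct, dotProduct_smul, smul_eq_mul, respVar]
    have := Real.mul_self_sqrt (hβ j)
    linear_combination -((c j ⬝ᵥ (V j ω).ofLp) ^ 2 - c j ⬝ᵥ S j *ᵥ c j) * this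
  simp_rw [this]
  exact key

end Tails

/-! ### Algebra of the model -/

section Algebra

variable {I T B P R : ℕ}

/-- The entries of the rank-one matrix `u wᵀ`. -/
def outerVec (u : Fin B → ℝ) (w : Fin P → ℝ) : Fin B × Fin P → ℝ := fun k => u k.1 * w k.2

/-- The coefficients of the response: the entries of `W Vᵀ`. -/
def respCoef (W : Matrix (Fin B) (Fin R) ℝ) (V : Matrix (Fin P) (Fin R) ℝ) : Fin B × Fin P → ℝ :=
  fun k => (W * Vᵀ) k.1 k.2

lemma outerVec_dotProduct (u : Fin B → ℝ) (w : Fin P → ℝ) (X : Matrix (Fin B) (Fin P) ℝ) :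
    outerVec u w ⬝ᵥ (fun k => X k.1 k.2) = u ⬝ᵥ X *ᵥ w := by
  simp only [dotProduct, outerVec, mulVec, Fintype.sum_prod_type, Finset.mul_sum]
  exact Finset.sum_congr rfl fun b _ => Finset.sum_congr rfl fun p _ => by ring

lemma outerVec_single_dotProduct (u : Fin B → ℝ) (p : Fin P) (X : Matrix (Fin B) (Fin P) ℝ) :
    outerVec u (Pi.single p 1) ⬝ᵥ (fun k => X k.1 k.2) = (Xᵀ *ᵥ u) p := by
  rw [outerVec_dotProduct, dotProduct_mulVec_mulVec]
  simp

lemma sum_smul_outerVec (u : Fin B → ℝ) (w : Fin P → ℝ) :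
    ∑ p, w p • outerVec u (Pi.single p 1) = outerVec u w := by
  ext k
  simp [outerVec, Pi.single_apply, mul_comm]

lemma kronecker_mulVec (Γ : Matrix (Fin B) (Fin B) ℝ) (Δ : Matrix (Fin P) (Fin P) ℝ)
    (C : Matrix (Fin B) (Fin P) ℝ) :
    (Γ ⊗ₖ Δ) *ᵥ (fun k => C k.1 k.2) = fun k => (Γ * C * Δᵀ) k.1 k.2 := by
  ext k
  simp only [mulVec, dotProduct, kroneckerMap_apply, Fintype.sum_prod_type, mul_apply,
    transpose_apply, Finset.sum_mul]
  rw [Finset.sum_comm]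
  exact Finset.sum_congr rfl fun b _ => Finset.sum_congr rfl fun p _ => by ring

lemma outerVec_kronecker (Γ : Matrix (Fin B) (Fin B) ℝ) (Δ : Matrix (Fin P) (Fin P) ℝ)
    (u u' : Fin B → ℝ) (w w' : Fin P → ℝ) :
    outerVec u w ⬝ᵥ (Γ ⊗ₖ Δ) *ᵥ outerVec u' w' = (u ⬝ᵥ Γ *ᵥ u') * (w ⬝ᵥ Δ *ᵥ w') := by
  have h1 : (Γ ⊗ₖ Δ) *ᵥ outerVec u' w' = outerVec (Γ *ᵥ u') (Δ *ᵥ w') := by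
    ext k
    simp only [mulVec, dotProduct, kroneckerMap_apply, Fintype.sum_prod_type, outerVec,
      Finset.sum_mul_sum]
    exact Finset.sum_congr rfl fun b _ => Finset.sum_congr rfl fun p _ => by ring
  rw [h1]
  simp only [dotProduct, outerVec, Fintype.sum_prod_type, Finset.sum_mul_sum]
  exact Finset.sum_congr rfl fun b _ => Finset.sum_congr rfl fun p _ => by ring

lemma trace_response (W : Matrix (Fin B) (Fin R) ℝ) (V : Matrix (Fin P) (Fin R) ℝ)
    (X : Matrix (Fin B) (Fin P) ℝ) :
    (Wᵀ * X * V).trace = respCoef W V ⬝ᵥ (vecOf X).ofLp := by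
  have h : (Wᵀ * X * V).trace = ((W * Vᵀ)ᵀ * X).trace := by
    rw [transpose_mul, transpose_transpose, Matrix.mul_assoc V, trace_mul_comm V]
  rw [h]
  simp only [trace, diag_apply, mul_apply, transpose_apply, dotProduct, respCoef, vecOf,
    Fintype.sum_prod_type]
  rw [Finset.sum_comm]

/-- The squared Frobenius norm. -/
def frobSq {m n : ℕ} (A : Matrix (Fin m) (Fin n) ℝ) : ℝ := ∑ i, ∑ j, A i j ^ 2

lemma frobSq_transpose {m n : ℕ} (A : Matrix (Fin m) (Fin n) ℝ) : frobSq Aᵀ = frobSq A := by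
  simp only [frobSq, transpose_apply]; exact Finset.sum_comm

lemma frobSq_nonneg {m n : ℕ} (A : Matrix (Fin m) (Fin n) ℝ) : 0 ≤ frobSq A :=
  Finset.sum_nonneg fun _ _ => Finset.sum_nonneg fun _ _ => sq_nonneg _

lemma frobSq_mul_le {l m n : ℕ} (A : Matrix (Fin l) (Fin m) ℝ) (C : Matrix (Fin m) (Fin n) ℝ) :
    frobSq (A * C) ≤ specNorm A ^ 2 * frobSq C := by
  rw [← frobSq_transpose, ← frobSq_transpose C]
  simp only [frobSq]
  rw [Finset.mul_sum]
  refine Finset.sum_le_sum fun j _ => ?_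
  have h := mulVec_dotProduct_self_le A fun k => C k j
  simpa [dotProduct, mulVec, mul_apply, sq] using h

/-- `V` has only `R` columns, so passing from spectral to Frobenius norm costs `R`. This is the
source of the powers of `R` in the sample size. -/
lemma frobSq_mul_transpose_le (W : Matrix (Fin B) (Fin R) ℝ) (V : Matrix (Fin P) (Fin R) ℝ) :
    frobSq (W * Vᵀ) ≤ R * (specNorm W ^ 2 * specNorm V ^ 2) := by
  have h1 := frobSq_mul_le W Vᵀ
  have h2 : frobSq Vᵀ ≤ specNorm V ^ 2 * R := by
    have h3 := frobSq_mul_le V (1 : Matrix (Fin R) (Fin R) ℝ)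
    rw [Matrix.mul_one] at h3
    rw [frobSq_transpose]
    refine h3.trans_eq ?_
    congr 1
    simp [frobSq, one_apply]
  calc _ ≤ _ := h1
    _ ≤ specNorm W ^ 2 * (specNorm V ^ 2 * R) := by gcongr
    _ = _ := by ring

/-- Cauchy–Schwarz between `C` and `Γ C Δᵀ` in the Frobenius inner product. -/
lemma respVar_kronecker_le (Γ : Matrix (Fin B) (Fin B) ℝ) (Δ : Matrix (Fin P) (Fin P) ℝ)
    (C : Matrix (Fin B) (Fin P) ℝ) :
    respVar (Γ ⊗ₖ Δ) (fun k => C k.1 k.2) ≤ specNorm Γ * specNorm Δ * frobSq C := by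
  have h1 : frobSq (Γ * C * Δᵀ) ≤ (specNorm Γ * specNorm Δ) ^ 2 * frobSq C := by
    rw [← frobSq_transpose, transpose_mul, transpose_transpose]
    refine (frobSq_mul_le _ _).trans ?_
    rw [frobSq_transpose, mul_pow, mul_comm (specNorm Γ ^ 2), mul_assoc]
    exact mul_le_mul_of_nonneg_left (frobSq_mul_le _ _) (by positivity)
  have h2 : respVar (Γ ⊗ₖ Δ) (fun k => C k.1 k.2) ^ 2 ≤ frobSq C * frobSq (Γ * C * Δᵀ) := by
    rw [respVar, kronecker_mulVec]
    simp only [frobSq, dotProduct, ← Fintype.sum_prod_type']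
    exact Finset.sum_mul_sq_le_sq_mul_sq _ _ _
  have h3 := frobSq_nonneg C
  have hg := specNorm_nonneg Γ
  have hd := specNorm_nonneg Δ
  refine le_of_sq_le_sq (h2.trans ?_) (by positivity)
  calc _ ≤ frobSq C * ((specNorm Γ * specNorm Δ) ^ 2 * frobSq C) := by gcongr
    _ = _ := by ring

/-- `M = Γ W Vᵀ Δ`, the covariance of the response and the covariates. -/
def signalMat (Γ : Matrix (Fin B) (Fin B) ℝ) (Δ : Matrix (Fin P) (Fin P) ℝ)
    (W : Matrix (Fin B) (Fin R) ℝ) (V : Matrix (Fin P) (Fin R) ℝ) : Matrix (Fin B) (Fin P) ℝ :=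
  Γ * (W * Vᵀ) * Δᵀ

variable {Γ : Matrix (Fin B) (Fin B) ℝ} {Δ : Fin I → Matrix (Fin P) (Fin P) ℝ}
  {W : Matrix (Fin B) (Fin R) ℝ} {V : Fin I → Matrix (Fin P) (Fin R) ℝ}

lemma Lcoef_nonneg (i : Fin I) : 0 ≤ Lcoef Γ Δ W V i := by
  rw [Lcoef]; positivity

/-- The covariance of the noise in `Â` involves the response variance times `‖Γ‖ ‖Δ_i‖`; this
expresses that product through the coefficient `L_i` that also bounds the signal. -/
lemma respVar_mul_le (i : Fin I) :
    respVar (Γ ⊗ₖ Δ i) (respCoef W (V i)) * (specNorm Γ * specNorm (Δ i))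
      ≤ R * Lcoef Γ Δ W V i := by
  have hg := specNorm_nonneg Γ
  have hd := specNorm_nonneg (Δ i)
  calc _ ≤ specNorm Γ * specNorm (Δ i) * (R * (specNorm W ^ 2 * specNorm (V i) ^ 2)) *
        (specNorm Γ * specNorm (Δ i)) := by
        gcongr
        exact (respVar_kronecker_le Γ (Δ i) (W * (V i)ᵀ)).trans
          (by gcongr; exact frobSq_mul_transpose_le W (V i))
    _ = _ := by rw [Lcoef]; ring

lemma signalMat_transpose_mulVec_le (i : Fin I) (u : Fin B → ℝ) :
    (signalMat Γ (Δ i) W (V i))ᵀ *ᵥ u ⬝ᵥ (signalMat Γ (Δ i) W (V i))ᵀ *ᵥ u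
      ≤ Lcoef Γ Δ W V i * (u ⬝ᵥ u) := by
  have h1 := mulVec_dotProduct_self_le (signalMat Γ (Δ i) W (V i))ᵀ u
  have h2 : specNorm (signalMat Γ (Δ i) W (V i))ᵀ
      ≤ specNorm Γ * (specNorm W * specNorm (V i)) * specNorm (Δ i) := by
    rw [specNorm_transpose, signalMat]
    have hg := specNorm_nonneg Γ
    have hd := specNorm_nonneg (Δ i)
    refine (specNorm_mul_le _ _).trans ?_
    rw [specNorm_transpose]
    gcongr
    refine (specNorm_mul_le _ _).trans ?_
    gcongr
    refine (specNorm_mul_le _ _).trans ?_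
    rw [specNorm_transpose]
  refine h1.trans (mul_le_mul_of_nonneg_right ?_ (dotProduct_self_nonneg' u))
  calc _ ≤ (specNorm Γ * (specNorm W * specNorm (V i)) * specNorm (Δ i)) ^ 2 :=
        pow_le_pow_left₀ (specNorm_nonneg _) h2 2
    _ = _ := by rw [Lcoef]; ring

lemma kronecker_mulVec_respCoef (i : Fin I) :
    (Γ ⊗ₖ Δ i) *ᵥ respCoef W (V i) = fun k => signalMat Γ (Δ i) W (V i) k.1 k.2 :=
  kronecker_mulVec Γ (Δ i) (W * (V i)ᵀ)

/-- The regression coefficients of the covariates on the response, as a matrix. -/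
noncomputable def regMat (Γ : Matrix (Fin B) (Fin B) ℝ) (Δ : Matrix (Fin P) (Fin P) ℝ)
    (W : Matrix (Fin B) (Fin R) ℝ) (V : Matrix (Fin P) (Fin R) ℝ) : Matrix (Fin B) (Fin P) ℝ :=
  (respVar (Γ ⊗ₖ Δ) (respCoef W V))⁻¹ • signalMat Γ Δ W V

lemma regCoef_eq_regMat (i : Fin I) :
    regCoef (Γ ⊗ₖ Δ i) (respCoef W (V i)) = fun k => regMat Γ (Δ i) W (V i) k.1 k.2 := by
  rw [regCoef, kronecker_mulVec_respCoef]; rfl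

lemma respVar_smul_regMat (hΓ : Γ.PosDef) (hΔ : ∀ i, (Δ i).PosSemidef) (i : Fin I) :
    respVar (Γ ⊗ₖ Δ i) (respCoef W (V i)) • regMat Γ (Δ i) W (V i)
      = signalMat Γ (Δ i) W (V i) := by
  have h := respVar_smul_regCoef (hΓ.posSemidef.kronecker (hΔ i)) (respCoef W (V i))
  rw [regCoef_eq_regMat, kronecker_mulVec_respCoef] at h
  ext b p
  exact congrFun h (b, p)

lemma trace_le_specNorm {n : ℕ} (A : Matrix (Fin n) (Fin n) ℝ) : A.trace ≤ n * specNorm A := by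
  calc A.trace = ∑ p, A p p := rfl
    _ ≤ ∑ _p : Fin n, specNorm A := by
      refine Finset.sum_le_sum fun p _ => ?_
      have := (le_abs_self _).trans (abs_dotProduct_mulVec_self_le A (Pi.single p 1))
      simpa using this
    _ = _ := by simp

/-- The signal `Γ W Q Wᵀ Γ` is the average of `M Mᵀ`. -/
lemma dotProduct_signal (hΓ : Γ.PosDef) (hΔ : ∀ i, (Δ i).PosSemidef) (u : Fin B → ℝ) :
    u ⬝ᵥ (Γ * W * Qmat Δ V * Wᵀ * Γ) *ᵥ u
      = (1 / (I : ℝ)) * ∑ i, ((signalMat Γ (Δ i) W (V i))ᵀ *ᵥ u ⬝ᵥ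
          (signalMat Γ (Δ i) W (V i))ᵀ *ᵥ u) := by
  have hΓt : Γᵀ = Γ := by rw [← conjTranspose_eq_transpose_of_trivial]; exact hΓ.1
  have h : Γ * W * Qmat Δ V * Wᵀ * Γ = (1 / (I : ℝ)) • ∑ i,
      signalMat Γ (Δ i) W (V i) * (signalMat Γ (Δ i) W (V i))ᵀ := by
    rw [Qmat, Matrix.mul_smul, Matrix.smul_mul, Matrix.smul_mul, Matrix.mul_sum, Matrix.sum_mul,
      Matrix.sum_mul]
    congr 1
    refine Finset.sum_congr rfl fun i _ => ?_
    have hΔt : (Δ i)ᵀ = Δ i := by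
      rw [← conjTranspose_eq_transpose_of_trivial]; exact (hΔ i).1
    simp only [signalMat, transpose_mul, transpose_transpose, hΔt, hΓt, Matrix.mul_assoc]
  rw [h, smul_mulVec, dotProduct_smul, smul_eq_mul, sum_mulVec, dotProduct_sum]
  congr 1
  refine Finset.sum_congr rfl fun i _ => ?_
  rw [← mulVec_mulVec, dotProduct_mulVec_mulVec]

lemma isHermitian_signal (hΓ : Γ.PosDef) (hΔ : ∀ i, (Δ i).PosSemidef) :
    (Γ * W * Qmat Δ V * Wᵀ * Γ).IsHermitian := by
  have hΓt : Γᵀ = Γ := by rw [← conjTranspose_eq_transpose_of_trivial]; exact hΓ.1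
  have hQ : (Qmat Δ V)ᵀ = Qmat Δ V := by
    rw [Qmat, transpose_smul, transpose_sum]
    congr 1
    refine Finset.sum_congr rfl fun i _ => ?_
    have hΔt : (Δ i)ᵀ = Δ i := by
      rw [← conjTranspose_eq_transpose_of_trivial]; exact (hΔ i).1
    simp only [transpose_mul, transpose_transpose, hΔt, Matrix.mul_assoc]
  rw [IsHermitian, conjTranspose_eq_transpose_of_trivial]
  simp only [transpose_mul, transpose_transpose, hΓt, hQ, Matrix.mul_assoc]

/-! ### Quadratic forms of the estimators -/

lemma dotProduct_GammaHat (x : Fin I → Fin T → Matrix (Fin B) (Fin P) ℝ) (u : Fin B → ℝ) :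
    u ⬝ᵥ GammaHat x *ᵥ u = (1 / ((I : ℝ) * T * P)) *
      ∑ j : Fin I × Fin T, ∑ p, (outerVec u (Pi.single p 1) ⬝ᵥ (vecOf (x j.1 j.2)).ofLp) ^ 2 := by
  rw [GammaHat, smul_mulVec, dotProduct_smul, smul_eq_mul, sum_mulVec, dotProduct_sum,
    Fintype.sum_prod_type]
  congr 1
  refine Finset.sum_congr rfl fun i _ => ?_
  rw [sum_mulVec, dotProduct_sum]
  refine Finset.sum_congr rfl fun t _ => ?_
  rw [← mulVec_mulVec, dotProduct_mulVec_mulVec, dotProduct]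
  refine Finset.sum_congr rfl fun p _ => ?_
  rw [← sq]
  congr 1
  exact (outerVec_single_dotProduct u p (x i t)).symm

lemma dotProduct_AHat (x : Fin I → Fin T → Matrix (Fin B) (Fin P) ℝ) (y : Fin I → Fin T → ℝ)
    (u : Fin B → ℝ) :
    u ⬝ᵥ AHat x y *ᵥ u = (1 / (I : ℝ)) * ∑ i, ∑ p,
      ((∑ t, y i t * (outerVec u (Pi.single p 1) ⬝ᵥ (vecOf (x i t)).ofLp)) / T) ^ 2 := by
  have hv : ∀ i t p, outerVec u (Pi.single p 1) ⬝ᵥ (vecOf (x i t)).ofLp = ((x i t)ᵀ *ᵥ u) p :=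
    fun i t p => outerVec_single_dotProduct u p (x i t)
  rw [AHat, smul_mulVec, dotProduct_smul, smul_eq_mul, sum_mulVec, dotProduct_sum, Finset.mul_sum,
    Finset.mul_sum]
  refine Finset.sum_congr rfl fun i _ => ?_
  have h1 : u ⬝ᵥ (∑ t, ∑ t', (y i t * y i t') • (x i t * (x i t')ᵀ)) *ᵥ u
      = ∑ p, (∑ t, y i t * ((x i t)ᵀ *ᵥ u) p) ^ 2 := by
    have h2 : ∀ t t', u ⬝ᵥ ((y i t * y i t') • (x i t * (x i t')ᵀ)) *ᵥ u
        = ∑ p, (y i t * ((x i t)ᵀ *ᵥ u) p) * (y i t' * ((x i t')ᵀ *ᵥ u) p) := by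
      intro t t'
      rw [smul_mulVec, dotProduct_smul, smul_eq_mul, ← mulVec_mulVec, dotProduct_mulVec_mulVec,
        dotProduct, Finset.mul_sum]
      exact Finset.sum_congr rfl fun p _ => by ring
    simp_rw [sum_mulVec, dotProduct_sum, h2, sq, Finset.sum_mul_sum]
    rw [Finset.sum_comm]
    refine (Finset.sum_congr rfl fun t _ => Finset.sum_comm).trans ?_
    rw [Finset.sum_comm]
    exact Finset.sum_congr rfl fun p _ => Finset.sum_comm
  rw [h1]
  simp_rw [hv, div_pow, ← Finset.sum_div]
  field_simp

end Algebra

/-! ### Conditional mean of `Â`: noise plus low-rank signal -/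

section Decomposition

variable {I T B P R : ℕ}

/-- The weighted average of the matrices `A_i A_iᵀ`, for the regression coefficients `A_i`. -/
noncomputable def weightedReg (Γ : Matrix (Fin B) (Fin B) ℝ) (Δ : Fin I → Matrix (Fin P) (Fin P) ℝ)
    (W : Matrix (Fin B) (Fin R) ℝ) (V : Fin I → Matrix (Fin P) (Fin R) ℝ) (w : Fin I → ℝ) :
    Matrix (Fin B) (Fin B) ℝ :=
  (1 / (I : ℝ)) • ∑ i, w i • (regMat Γ (Δ i) W (V i) * (regMat Γ (Δ i) W (V i))ᵀ)

/-- The coefficient of `Γ` in the conditional mean of `Â` given the responses. -/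
noncomputable def noiseCoef (Δ : Fin I → Matrix (Fin P) (Fin P) ℝ) (T : ℕ) (q : Fin I → ℝ) : ℝ :=
  (1 / (I : ℝ)) * ∑ i, q i / T * (Δ i).trace

variable {Γ : Matrix (Fin B) (Fin B) ℝ} {Δ : Fin I → Matrix (Fin P) (Fin P) ℝ}
  {W : Matrix (Fin B) (Fin R) ℝ} {V : Fin I → Matrix (Fin P) (Fin R) ℝ}

lemma isHermitian_weightedReg (w : Fin I → ℝ) : (weightedReg Γ Δ W V w).IsHermitian := by
  rw [IsHermitian, conjTranspose_eq_transpose_of_trivial, weightedReg]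
  simp only [transpose_smul, transpose_sum, transpose_mul, transpose_transpose]

lemma dotProduct_weightedReg (w : Fin I → ℝ) (u : Fin B → ℝ) :
    u ⬝ᵥ weightedReg Γ Δ W V w *ᵥ u = (1 / (I : ℝ)) * ∑ i, w i *
      ((regMat Γ (Δ i) W (V i))ᵀ *ᵥ u ⬝ᵥ (regMat Γ (Δ i) W (V i))ᵀ *ᵥ u) := by
  rw [weightedReg, smul_mulVec, dotProduct_smul, smul_eq_mul, sum_mulVec, dotProduct_sum]
  congr 1
  refine Finset.sum_congr rfl fun i _ => ?_
  rw [smul_mulVec, dotProduct_smul, smul_eq_mul, ← mulVec_mulVec, dotProduct_mulVec_mulVec]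

/-- Every `A_i` is a multiple of `Γ W V_iᵀ Δ_iᵀ`, so `Γ W` factors out on the left whatever the
weights are; the random weights cannot tilt the column space. -/
lemma exists_weightedReg_eq (w : Fin I → ℝ) :
    ∃ K : Matrix (Fin R) (Fin B) ℝ, weightedReg Γ Δ W V w = Γ * W * K := by
  refine ⟨(1 / (I : ℝ)) • ∑ i, (w i * (respVar (Γ ⊗ₖ Δ i) (respCoef W (V i)))⁻¹) •
    ((V i)ᵀ * (Δ i)ᵀ * (regMat Γ (Δ i) W (V i))ᵀ), ?_⟩
  rw [weightedReg, Matrix.mul_smul, Matrix.mul_sum]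
  congr 1
  refine Finset.sum_congr rfl fun i _ => ?_
  rw [Matrix.mul_smul, mul_smul]
  generalize (regMat Γ (Δ i) W (V i))ᵀ = N
  rw [regMat, Matrix.smul_mul, signalMat]
  simp only [Matrix.mul_assoc]

lemma regMat_sq_eq_signalMat (hΓ : Γ.PosDef) (hΔ : ∀ i, (Δ i).PosSemidef) (i : Fin I)
    (u : Fin B → ℝ) :
    respVar (Γ ⊗ₖ Δ i) (respCoef W (V i)) ^ 2 *
      ((regMat Γ (Δ i) W (V i))ᵀ *ᵥ u ⬝ᵥ (regMat Γ (Δ i) W (V i))ᵀ *ᵥ u)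
      = (signalMat Γ (Δ i) W (V i))ᵀ *ᵥ u ⬝ᵥ (signalMat Γ (Δ i) W (V i))ᵀ *ᵥ u := by
  rw [← respVar_smul_regMat hΓ hΔ i, transpose_smul, smul_mulVec, smul_dotProduct,
    dotProduct_smul]
  simp only [smul_eq_mul]; ring

lemma le_dotProduct_weightedReg (hΓ : Γ.PosDef) (hΔ : ∀ i, (Δ i).PosSemidef) (hT : 2 ≤ T)
    (q : Fin I → ℝ) {s : ℝ}
    (hs : specNorm (weightedReg Γ Δ W V fun i =>
      (q i - respVar (Γ ⊗ₖ Δ i) (respCoef W (V i))) * respVar (Γ ⊗ₖ Δ i) (respCoef W (V i))) ≤ s)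
    (u : Fin B → ℝ) :
    1 / 2 * (u ⬝ᵥ (Γ * W * Qmat Δ V * Wᵀ * Γ) *ᵥ u) - 2 * s * (u ⬝ᵥ u)
      ≤ u ⬝ᵥ (weightedReg Γ Δ W V fun i =>
        q i ^ 2 - q i * respVar (Γ ⊗ₖ Δ i) (respCoef W (V i)) / T) *ᵥ u := by
  have hT' : (2 : ℝ) ≤ T := by exact_mod_cast hT
  have hT1 : 1 / (T : ℝ) ≤ 1 / 2 := one_div_le_one_div_of_le (by norm_num) hT'
  have hT0 : 0 ≤ 1 / (T : ℝ) := by positivity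
  have h1 := (abs_dotProduct_mulVec_self_le (weightedReg Γ Δ W V fun i =>
    (q i - respVar (Γ ⊗ₖ Δ i) (respCoef W (V i))) * respVar (Γ ⊗ₖ Δ i) (respCoef W (V i))) u).trans
    (mul_le_mul_of_nonneg_right hs (dotProduct_self_nonneg' u))
  have hs0 : 0 ≤ s := (specNorm_nonneg _).trans hs
  have hS : 0 ≤ u ⬝ᵥ (Γ * W * Qmat Δ V * Wᵀ * Γ) *ᵥ u := by
    rw [dotProduct_signal hΓ hΔ]
    exact mul_nonneg (by positivity) (Finset.sum_nonneg fun i _ => dotProduct_self_nonneg' _)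
  -- With `σ` the response variance, `q² - qσ/T = (q-σ)² + (2-1/T)(q-σ)σ + (1-1/T)σ²`, and the
  -- square is dropped. Only a deviation linear in `q` survives, and `T ≥ 2` gives `1 - 1/T ≥ 1/2`.
  have h2 : (2 - 1 / (T : ℝ)) * (u ⬝ᵥ (weightedReg Γ Δ W V fun i =>
        (q i - respVar (Γ ⊗ₖ Δ i) (respCoef W (V i))) *
          respVar (Γ ⊗ₖ Δ i) (respCoef W (V i))) *ᵥ u)
      + (1 - 1 / (T : ℝ)) * (u ⬝ᵥ (Γ * W * Qmat Δ V * Wᵀ * Γ) *ᵥ u)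
      ≤ u ⬝ᵥ (weightedReg Γ Δ W V fun i =>
        q i ^ 2 - q i * respVar (Γ ⊗ₖ Δ i) (respCoef W (V i)) / T) *ᵥ u := by
    rw [dotProduct_signal hΓ hΔ, dotProduct_weightedReg, dotProduct_weightedReg]
    rw [mul_left_comm, mul_left_comm (1 - 1 / (T : ℝ)), ← mul_add]
    refine mul_le_mul_of_nonneg_left ?_ (by positivity)
    rw [Finset.mul_sum, Finset.mul_sum, ← Finset.sum_add_distrib]
    refine Finset.sum_le_sum fun i _ => ?_
    rw [← regMat_sq_eq_signalMat hΓ hΔ]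
    have h3 := dotProduct_self_nonneg' ((regMat Γ (Δ i) W (V i))ᵀ *ᵥ u)
    have h4 := mul_nonneg (sq_nonneg (q i - respVar (Γ ⊗ₖ Δ i) (respCoef W (V i)))) h3
    rw [div_eq_mul_one_div (q i * _)]
    nlinarith
  have h5 := (abs_le.1 h1).1
  have h6 : 0 ≤ s * (u ⬝ᵥ u) := mul_nonneg hs0 (dotProduct_self_nonneg' u)
  nlinarith

lemma isHermitian_GammaHat (x : Fin I → Fin T → Matrix (Fin B) (Fin P) ℝ) :
    (GammaHat x).IsHermitian := by
  rw [IsHermitian, conjTranspose_eq_transpose_of_trivial, GammaHat]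
  simp only [transpose_smul, transpose_sum, transpose_mul, transpose_transpose]

lemma isHermitian_AHat (x : Fin I → Fin T → Matrix (Fin B) (Fin P) ℝ) (y : Fin I → Fin T → ℝ) :
    (AHat x y).IsHermitian := by
  rw [IsHermitian, conjTranspose_eq_transpose_of_trivial, AHat]
  simp only [transpose_smul, transpose_sum, transpose_mul, transpose_transpose]
  congr 1
  refine Finset.sum_congr rfl fun i _ => ?_
  rw [Finset.sum_comm]
  exact Finset.sum_congr rfl fun t _ => Finset.sum_congr rfl fun t' _ => by rw [mul_comm (y i t')]

lemma outerVec_single_dotProduct_regCoef (u : Fin B → ℝ) (p : Fin P) (i : Fin I) :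
    outerVec u (Pi.single p 1) ⬝ᵥ regCoef (Γ ⊗ₖ Δ i) (respCoef W (V i))
      = ((regMat Γ (Δ i) W (V i))ᵀ *ᵥ u) p := by
  rw [regCoef_eq_regMat, outerVec_single_dotProduct]

lemma sum_sq_outerVec_single_regCoef (u : Fin B → ℝ) (i : Fin I) :
    ∑ p, (outerVec u (Pi.single p 1) ⬝ᵥ regCoef (Γ ⊗ₖ Δ i) (respCoef W (V i))) ^ 2
      = (regMat Γ (Δ i) W (V i))ᵀ *ᵥ u ⬝ᵥ (regMat Γ (Δ i) W (V i))ᵀ *ᵥ u := by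
  simp_rw [outerVec_single_dotProduct_regCoef, dotProduct, sq]

/-- The conditional deviation is the quadratic form of `Â` minus its conditional mean. -/
lemma condDev_eq {Ω : Type*} (hI : I ≠ 0) (X : Fin I → Fin T → Ω → Matrix (Fin B) (Fin P) ℝ)
    (y : Fin I → Fin T → Ω → ℝ)
    (hy : ∀ i t ω, y i t ω = respCoef W (V i) ⬝ᵥ (vecOf (X i t ω)).ofLp) (u : Fin B → ℝ) (ω : Ω) :
    condDev (fun i => Γ ⊗ₖ Δ i) (fun i => respCoef W (V i))
        (fun p : Fin P => outerVec u (Pi.single p 1)) T (fun j : Fin I × Fin T => y j.1 j.2 ω)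
        (residuals (fun (j : Fin I × Fin T) ω => vecOf (X j.1 j.2 ω)) (fun i => Γ ⊗ₖ Δ i)
          (fun i => respCoef W (V i)) ω)
      = I * (u ⬝ᵥ (AHat (fun i t => X i t ω) (fun i t => y i t ω)
          - noiseCoef Δ T (fun i => (∑ t, y i t ω ^ 2) / T) • Γ
          - weightedReg Γ Δ W V (fun i => ((∑ t, y i t ω ^ 2) / T) ^ 2
            - (∑ t, y i t ω ^ 2) / T * respVar (Γ ⊗ₖ Δ i) (respCoef W (V i)) / T)) *ᵥ u) := by
  have hI' : (I : ℝ) ≠ 0 := by exact_mod_cast hI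
  rw [sub_mulVec, sub_mulVec, dotProduct_sub, dotProduct_sub, dotProduct_AHat,
    dotProduct_weightedReg, smul_mulVec, dotProduct_smul, smul_eq_mul, noiseCoef, mul_assoc,
    ← mul_sub, ← mul_sub, ← mul_assoc, mul_one_div_cancel hI', one_mul, Finset.sum_mul,
    ← Finset.sum_sub_distrib, ← Finset.sum_sub_distrib, condDev]
  refine Finset.sum_congr rfl fun i _ => ?_
  rw [← sum_sq_outerVec_single_regCoef, trace, Finset.mul_sum, Finset.mul_sum, Finset.sum_mul,
    ← Finset.sum_sub_distrib, ← Finset.sum_sub_distrib]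
  refine Finset.sum_congr rfl fun p _ => ?_
  have h1 : (∑ t, y i t ω ^ 2) / T * (outerVec u (Pi.single p 1) ⬝ᵥ
        regCoef (Γ ⊗ₖ Δ i) (respCoef W (V i))) + (∑ t, y i t ω * (outerVec u (Pi.single p 1) ⬝ᵥ
        fun k => residuals (fun (j : Fin I × Fin T) ω => vecOf (X j.1 j.2 ω)) (fun i => Γ ⊗ₖ Δ i)
          (fun i => respCoef W (V i)) ω ((i, t), k))) / T
      = (∑ t, y i t ω * (outerVec u (Pi.single p 1) ⬝ᵥ (vecOf (X i t ω)).ofLp)) / T := by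
    rw [div_mul_eq_mul_div, ← add_div, Finset.sum_mul, ← Finset.sum_add_distrib]
    congr 1
    refine Finset.sum_congr rfl fun t _ => ?_
    have h2 : (outerVec u (Pi.single p 1) ⬝ᵥ
        fun k => residuals (fun (j : Fin I × Fin T) ω => vecOf (X j.1 j.2 ω)) (fun i => Γ ⊗ₖ Δ i)
          (fun i => respCoef W (V i)) ω ((i, t), k))
        = outerVec u (Pi.single p 1) ⬝ᵥ residual (Γ ⊗ₖ Δ i) (respCoef W (V i))
          (vecOf (X i t ω)).ofLp := rfl
    rw [h2, residual, dotProduct_sub, dotProduct_smul, ← hy, smul_eq_mul]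
    ring
  rw [h1, outerVec_kronecker]
  simp only [single_one_dotProduct, mulVec_single_one, diag_apply, col_apply]
  ring

end Decomposition

/-! ### Relations between the coefficients, and nondegeneracy forced by `λ > 0` -/

section Coefficients

variable {I B P R : ℕ} {Γ : Matrix (Fin B) (Fin B) ℝ} {Δ : Fin I → Matrix (Fin P) (Fin P) ℝ}
  {W : Matrix (Fin B) (Fin R) ℝ} {V : Fin I → Matrix (Fin P) (Fin R) ℝ}

/-- Out of range, `eig` takes the default value `0`, which the positivity of `λ` excludes. -/
lemma rank_bounds_of_lamSignal_pos (hlam : 0 < lamSignal Γ Δ W V) : 1 ≤ R ∧ R ≤ B := by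
  by_contra h
  rw [lamSignal, eig_eq_zero fun h' => h h'.2] at hlam
  exact lt_irrefl _ hlam

lemma avg_mono {f g : Fin I → ℝ} (h : ∀ i, f i ≤ g i) : avg f ≤ avg g :=
  mul_le_mul_of_nonneg_left (Finset.sum_le_sum fun i _ => h i) (by positivity)

lemma avg_nonneg {f : Fin I → ℝ} (h : ∀ i, 0 ≤ f i) : 0 ≤ avg f :=
  mul_nonneg (by positivity) (Finset.sum_nonneg fun i _ => h i)

lemma avg_const_mul (a : ℝ) (f : Fin I → ℝ) : avg (fun i => a * f i) = a * avg f := by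
  simp only [avg, ← Finset.mul_sum]; ring

lemma avg_const (hI : I ≠ 0) (a : ℝ) : avg (fun _ : Fin I => a) = a := by
  have : (I : ℝ) ≠ 0 := by exact_mod_cast hI
  simp [avg, this]

lemma sum_eq_mul_avg (hI : I ≠ 0) (f : Fin I → ℝ) : ∑ i, f i = I * avg f := by
  have : (I : ℝ) ≠ 0 := by exact_mod_cast hI
  rw [avg, ← mul_assoc, mul_one_div_cancel this, one_mul]

lemma eig_pos (hΓ : Γ.PosDef) (hB : 1 ≤ B) : 0 < eig Γ B := by
  rw [eig, dif_pos ⟨hΓ.1, hB, le_rfl⟩]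
  have := hΓ.eigenvalues_pos ((Fintype.equivOfCardEq (Fintype.card_fin _))
    ⟨B - 1, by rw [Fintype.card_fin]; omega⟩)
  simpa [IsHermitian.eigenvalues] using this

lemma eig_le_specNorm (hΓ : Γ.PosDef) (hB : 1 ≤ B) : eig Γ B ≤ specNorm Γ := by
  have h1 := eig_mul_dotProduct_le hΓ.1 (Pi.single (⟨0, hB⟩ : Fin B) 1)
  have h2 := (le_abs_self _).trans
    (abs_dotProduct_mulVec_self_le Γ (Pi.single (⟨0, hB⟩ : Fin B) 1))
  have h3 := h1.trans h2
  simpa using h3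

lemma one_le_kappa (hΓ : Γ.PosDef) (hB : 1 ≤ B) : 1 ≤ kappa Γ := by
  rw [kappa, one_le_div (eig_pos hΓ hB)]; exact eig_le_specNorm hΓ hB

/-- Each of the coefficients is at most `k'`. -/
lemma coef_le_kPrime :
    alphaCoef Γ Δ W V ≤ kPrime Γ Δ W V 1 1 1 1 ∧ nuCoef Γ Δ W V ≤ kPrime Γ Δ W V 1 1 1 1 ∧
      nuCoef Γ Δ W V ^ 2 ≤ kPrime Γ Δ W V 1 1 1 1 ∧
      kappa Γ * etaCoef Γ Δ W V * chiCoef Δ ≤ kPrime Γ Δ W V 1 1 1 1 ∧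
      kappa Γ ^ 2 * etaCoef Γ Δ W V ^ 2 * psiCoef Δ ≤ kPrime Γ Δ W V 1 1 1 1 := by
  have h1 : 0 ≤ alphaCoef Γ Δ W V := by
    exact div_nonneg (avg_nonneg fun i => sq_nonneg _) (sq_nonneg _)
  have h2 : 0 ≤ muCoef Γ Δ W V := div_nonneg (Real.sqrt_nonneg _) (sq_nonneg _)
  have h3 : 0 ≤ nuCoef Γ Δ W V ^ 2 := sq_nonneg _
  have h4 : 0 ≤ kappa Γ ^ 2 * etaCoef Γ Δ W V ^ 2 * psiCoef Δ :=
    mul_nonneg (by positivity) (div_nonneg (avg_nonneg fun i => sq_nonneg _) (sq_nonneg _))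
  have h5 := le_max_left (nuCoef Γ Δ W V) (nuCoef Γ Δ W V ^ 2)
  have h6 := le_max_right (nuCoef Γ Δ W V) (nuCoef Γ Δ W V ^ 2)
  have h7 := le_max_left (kappa Γ * etaCoef Γ Δ W V * chiCoef Δ)
    (kappa Γ ^ 2 * etaCoef Γ Δ W V ^ 2 * psiCoef Δ)
  have h8 := le_max_right (kappa Γ * etaCoef Γ Δ W V * chiCoef Δ)
    (kappa Γ ^ 2 * etaCoef Γ Δ W V ^ 2 * psiCoef Δ)
  rw [kPrime]
  refine ⟨?_, ?_, ?_, ?_, ?_⟩ <;> linarith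

lemma avg_Lcoef_eq (hlam : 0 < lamSignal Γ Δ W V) :
    avg (fun i => Lcoef Γ Δ W V i) = etaCoef Γ Δ W V * lamSignal Γ Δ W V := by
  rw [etaCoef, div_mul_cancel₀ _ hlam.ne']

lemma avg_Lcoef_sq_eq (hlam : 0 < lamSignal Γ Δ W V) :
    avg (fun i => Lcoef Γ Δ W V i ^ 2) = alphaCoef Γ Δ W V * lamSignal Γ Δ W V ^ 2 := by
  rw [alphaCoef, div_mul_cancel₀ _ (by positivity)]

lemma Lcoef_le (hlam : 0 < lamSignal Γ Δ W V) (i : Fin I) :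
    Lcoef Γ Δ W V i ≤ nuCoef Γ Δ W V * lamSignal Γ Δ W V := by
  rw [nuCoef, div_mul_cancel₀ _ hlam.ne']
  exact le_ciSup (Set.finite_range fun i => Lcoef Γ Δ W V i).bddAbove i

/-- The signal is the average of `M_i M_iᵀ`, each at most `L_i`; testing it on one vector of the top
eigenspace compares `λ` with the average. Hence `η ≥ 1` and `ν ≥ 1`, so every coefficient condition
also controls the bare sample size. -/
lemma lamSignal_le_avg (hΓ : Γ.PosDef) (hΔ : ∀ i, (Δ i).PosSemidef)
    (hlam : 0 < lamSignal Γ Δ W V) : lamSignal Γ Δ W V ≤ avg (fun i => Lcoef Γ Δ W V i) := by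
  obtain ⟨h1, h2⟩ := rank_bounds_of_lamSignal_pos hlam
  obtain ⟨Y, hY, hYe⟩ := exists_frame_eig_le (isHermitian_signal (W := W) (V := V) hΓ hΔ) h2
  set a : Fin R → ℝ := Pi.single ⟨0, h1⟩ 1 with ha
  have hpos : 0 < Y *ᵥ a ⬝ᵥ Y *ᵥ a := by
    refine lt_of_le_of_ne (dotProduct_self_nonneg' _) fun h0 => ?_
    have h3 := congrFun (hY a (dotProduct_self_eq_zero.1 h0.symm)) ⟨0, h1⟩
    simp [ha] at h3
  have h4 := hYe a
  rw [dotProduct_signal hΓ hΔ] at h4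
  have h5 := h4.trans (avg_mono fun i => signalMat_transpose_mulVec_le i (Y *ᵥ a))
  simp_rw [mul_comm (Lcoef _ _ _ _ _), avg_const_mul] at h5
  rw [mul_comm] at h5
  exact le_of_mul_le_mul_left h5 hpos

lemma one_le_etaCoef (hΓ : Γ.PosDef) (hΔ : ∀ i, (Δ i).PosSemidef)
    (hlam : 0 < lamSignal Γ Δ W V) : 1 ≤ etaCoef Γ Δ W V := by
  rw [etaCoef, one_le_div hlam]; exact lamSignal_le_avg hΓ hΔ hlam

lemma exists_Lcoef_pos (hΓ : Γ.PosDef) (hΔ : ∀ i, (Δ i).PosSemidef)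
    (hlam : 0 < lamSignal Γ Δ W V) : ∃ i, 0 < Lcoef Γ Δ W V i := by
  by_contra! h
  have h1 : avg (fun i => Lcoef Γ Δ W V i) ≤ 0 :=
    mul_nonpos_of_nonneg_of_nonpos (by positivity) (Finset.sum_nonpos fun i _ => h i)
  linarith [lamSignal_le_avg hΓ hΔ hlam]

lemma tasks_ne_zero (hΓ : Γ.PosDef) (hΔ : ∀ i, (Δ i).PosSemidef)
    (hlam : 0 < lamSignal Γ Δ W V) : I ≠ 0 := by
  obtain ⟨i, _⟩ := exists_Lcoef_pos hΓ hΔ hlam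
  exact (Nat.zero_lt_of_lt i.2).ne'

lemma etaCoef_le_nuCoef (hΓ : Γ.PosDef) (hΔ : ∀ i, (Δ i).PosSemidef)
    (hlam : 0 < lamSignal Γ Δ W V) : etaCoef Γ Δ W V ≤ nuCoef Γ Δ W V := by
  have h := avg_mono (Lcoef_le hlam)
  rw [avg_const (tasks_ne_zero hΓ hΔ hlam), avg_Lcoef_eq hlam] at h
  exact le_of_mul_le_mul_right h hlam

lemma exists_ne_zero (hΓ : Γ.PosDef) (hΔ : ∀ i, (Δ i).PosSemidef)
    (hlam : 0 < lamSignal Γ Δ W V) : ∃ i, Δ i ≠ 0 := by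
  obtain ⟨i, hi⟩ := exists_Lcoef_pos hΓ hΔ hlam
  refine ⟨i, fun h0 => ?_⟩
  have : specNorm (0 : Matrix (Fin P) (Fin P) ℝ) = 0 := by simp [specNorm]
  rw [Lcoef, h0, this] at hi
  simp at hi

lemma covariates_ne_zero (hΓ : Γ.PosDef) (hΔ : ∀ i, (Δ i).PosSemidef)
    (hlam : 0 < lamSignal Γ Δ W V) : P ≠ 0 := by
  obtain ⟨i, hi⟩ := exists_ne_zero hΓ hΔ hlam
  rintro rfl
  exact hi (Subsingleton.elim _ _)

lemma traceScale_pos (hΓ : Γ.PosDef) (hΔ : ∀ i, (Δ i).PosSemidef)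
    (hlam : 0 < lamSignal Γ Δ W V) : 0 < traceScale Δ := by
  obtain ⟨i, hi⟩ := exists_ne_zero hΓ hΔ hlam
  have h1 : (0 : ℝ) < I := by exact_mod_cast Nat.pos_of_ne_zero (tasks_ne_zero hΓ hΔ hlam)
  have h2 : (0 : ℝ) < P := by exact_mod_cast Nat.pos_of_ne_zero (covariates_ne_zero hΓ hΔ hlam)
  refine mul_pos (by positivity) (Finset.sum_pos' (fun j _ => (hΔ j).trace_nonneg)
    ⟨i, Finset.mem_univ i, lt_of_le_of_ne (hΔ i).trace_nonneg fun h => hi ?_⟩)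
  exact (hΔ i).trace_eq_zero_iff.1 h.symm

lemma specNorm_le_chiCoef (hΓ : Γ.PosDef) (hΔ : ∀ i, (Δ i).PosSemidef)
    (hlam : 0 < lamSignal Γ Δ W V) (i : Fin I) : specNorm (Δ i) ≤ chiCoef Δ * traceScale Δ := by
  rw [chiCoef, div_mul_cancel₀ _ (traceScale_pos hΓ hΔ hlam).ne']
  exact le_ciSup (Set.finite_range fun i => specNorm (Δ i)).bddAbove i

lemma chiCoef_pos (hΓ : Γ.PosDef) (hΔ : ∀ i, (Δ i).PosSemidef)
    (hlam : 0 < lamSignal Γ Δ W V) : 0 < chiCoef Δ := by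
  obtain ⟨i, hi⟩ := exists_ne_zero hΓ hΔ hlam
  exact pos_of_mul_pos_left ((specNorm_pos_of_ne_zero hi).trans_le
    (specNorm_le_chiCoef hΓ hΔ hlam i)) (traceScale_pos hΓ hΔ hlam).le

lemma avg_specNorm_sq_eq (hΓ : Γ.PosDef) (hΔ : ∀ i, (Δ i).PosSemidef)
    (hlam : 0 < lamSignal Γ Δ W V) :
    avg (fun i => specNorm (Δ i) ^ 2) = psiCoef Δ * traceScale Δ ^ 2 := by
  rw [psiCoef, div_mul_cancel₀ _ (pow_pos (traceScale_pos hΓ hΔ hlam) 2).ne']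

end Coefficients

/-! ### Size of the empirical response variances -/

section Events

variable {I T B P R : ℕ} {Γ : Matrix (Fin B) (Fin B) ℝ} {Δ : Fin I → Matrix (Fin P) (Fin P) ℝ}
  {W : Matrix (Fin B) (Fin R) ℝ} {V : Fin I → Matrix (Fin P) (Fin R) ℝ}
  {Ω : Type*} {X : Fin I → Fin T → Ω → Matrix (Fin B) (Fin P) ℝ}

/-- The empirical second moment of the responses of a task. -/
noncomputable def sampleVar (W : Matrix (Fin B) (Fin R) ℝ) (V : Fin I → Matrix (Fin P) (Fin R) ℝ)
    (X : Fin I → Fin T → Ω → Matrix (Fin B) (Fin P) ℝ) (i : Fin I) (ω : Ω) : ℝ :=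
  (∑ t, (respCoef W (V i) ⬝ᵥ (vecOf (X i t ω)).ofLp) ^ 2) / T

lemma kronecker_posSemidef (hΓ : Γ.PosDef) (hΔ : ∀ i, (Δ i).PosSemidef) (i : Fin I) :
    (Γ ⊗ₖ Δ i).PosSemidef := hΓ.posSemidef.kronecker (hΔ i)

lemma sampleVar_nonneg (i : Fin I) (ω : Ω) : 0 ≤ sampleVar W V X i ω := by
  rw [sampleVar]; positivity

lemma sum_weight_sampleVar (hT : T ≠ 0) (β : Fin I → ℝ) (ω : Ω) (v : Fin I → ℝ) :
    ∑ j : Fin I × Fin T, β j.1 *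
        ((respCoef W (V j.1) ⬝ᵥ (vecOf (X j.1 j.2 ω)).ofLp) ^ 2 - v j.1)
      = T * ∑ i, β i * (sampleVar W V X i ω - v i) := by
  have hT' : (T : ℝ) ≠ 0 := by exact_mod_cast hT
  rw [Fintype.sum_prod_type, Finset.mul_sum]
  refine Finset.sum_congr rfl fun i _ => ?_
  dsimp only
  rw [← Finset.mul_sum, Finset.sum_sub_distrib, sampleVar]
  simp only [Finset.sum_const, Finset.card_univ, Fintype.card_fin, nsmul_eq_mul]
  field_simp

variable [MeasurableSpace Ω] {μ : Measure Ω}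

lemma measure_weight_sampleVar_le (hΓ : Γ.PosDef) (hΔ : ∀ i, (Δ i).PosSemidef)
    (hX : GaussianModel μ Γ Δ X) (hT : T ≠ 0) (β : Fin I → ℝ) (hβ : ∀ i, 0 ≤ β i)
    {b Q x t : ℝ} (hb : 0 < b)
    (hvb : ∀ i, 4 * (β i * respVar (Γ ⊗ₖ Δ i) (respCoef W (V i))) ≤ b)
    (hQ : T * ∑ i, 2 * (β i * respVar (Γ ⊗ₖ Δ i) (respCoef W (V i))) ^ 2 ≤ Q) (ht : 0 ≤ t)
    (h1 : 4 * Q * x ≤ t ^ 2) (h2 : 2 * b * x ≤ t) :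
    μ {ω | t ≤ |T * ∑ i, β i *
        (sampleVar W V X i ω - respVar (Γ ⊗ₖ Δ i) (respCoef W (V i)))|}
      ≤ 2 * ENNReal.ofReal (Real.exp (-x)) := by
  have key := measure_abs_sum_sq_response_ge_le (μ := μ)
    (V := fun (j : Fin I × Fin T) ω => vecOf (X j.1 j.2 ω)) (S := fun j => Γ ⊗ₖ Δ j.1)
    (fun j => hX.1 j.1 j.2) (fun j => kronecker_posSemidef hΓ hΔ j.1) hX.2
    (fun j => respCoef W (V j.1)) (fun j => β j.1) (fun j => hβ j.1) hb (fun j => hvb j.1)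
    (Q := Q) (le_of_eq_of_le (by
      rw [Fintype.sum_prod_type, Finset.mul_sum]
      refine Finset.sum_congr rfl fun i _ => ?_
      simp) hQ) ht h1 h2
  simpa only [sum_weight_sampleVar hT β _
    (fun i => respVar (Γ ⊗ₖ Δ i) (respCoef W (V i)))] using key

/-- A large deviation bound with exponent proportional to `T`: the factor `Λ` allows a later union
over all `I` tasks. -/
lemma measure_lt_sampleVar_le (hΓ : Γ.PosDef) (hΔ : ∀ i, (Δ i).PosSemidef)
    (hX : GaussianModel μ Γ Δ X) (hT : T ≠ 0) {Λ : ℝ} (hΛ : 1 ≤ Λ) (i : Fin I) :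
    μ {ω | 17 * Λ * respVar (Γ ⊗ₖ Δ i) (respCoef W (V i)) < sampleVar W V X i ω}
      ≤ 2 * ENNReal.ofReal (Real.exp (-(2 * Λ * T))) := by
  classical
  have hT0 : (0 : ℝ) < T := by exact_mod_cast Nat.pos_of_ne_zero hT
  have hv0 := respVar_nonneg (kronecker_posSemidef hΓ hΔ i) (respCoef W (V i))
  rcases hv0.eq_or_lt with hv | hv
  · have h0 : ∀ᵐ ω ∂μ, ∀ t, respCoef W (V i) ⬝ᵥ (vecOf (X i t ω)).ofLp = 0 := by
      rw [ae_all_iff]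
      intro t
      exact response_ae_eq_zero (V := fun (j : Fin I × Fin T) ω => vecOf (X j.1 j.2 ω))
        (S := fun j => Γ ⊗ₖ Δ j.1) (fun j => hX.1 j.1 j.2)
        (fun j => kronecker_posSemidef hΓ hΔ j.1) (i, t) _ hv.symm
    refine le_of_eq_of_le (measure_eq_zero_iff_ae_notMem.2 ?_) zero_le
    filter_upwards [h0] with ω hω
    simp [sampleVar, hω, ← hv]
  · set σ := respVar (Γ ⊗ₖ Δ i) (respCoef W (V i)) with hσ
    -- The factor `17` is the mean plus `16`, and `16 Λ T σ = 2 b x` exactly for `b = 4σ`, `x =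
    -- 2ΛT`.
    have key := measure_weight_sampleVar_le (W := W) (V := V) hΓ hΔ hX hT (Pi.single i 1)
      (fun k => by
        by_cases hk : k = i
        · subst hk; simp
        · rw [Pi.single_eq_of_ne hk]) (b := 4 * σ) (Q := 2 * T * σ ^ 2) (x := 2 * Λ * T)
      (t := 16 * Λ * T * σ) (by positivity)
      (fun k => by
        by_cases hk : k = i
        · subst hk; simp [hσ]
        · rw [Pi.single_eq_of_ne hk, zero_mul, mul_zero]; positivity)
      (by
        rw [Finset.sum_eq_single i (fun k _ hk => by rw [Pi.single_eq_of_ne hk]; simp) (by simp),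
          Pi.single_eq_same, one_mul, ← hσ]
        exact le_of_eq (by ring))
      (by positivity)
      (by
        have : Λ * 1 ≤ Λ * Λ := mul_le_mul_of_nonneg_left hΛ (by linarith)
        have h3 : (0 : ℝ) ≤ T ^ 2 * σ ^ 2 := by positivity
        nlinarith [mul_le_mul_of_nonneg_right this h3,
          mul_nonneg (show (0 : ℝ) ≤ Λ by linarith) h3])
      (le_of_eq (by ring))
    refine (measure_mono fun ω hω => ?_).trans key
    have hω' : 17 * Λ * σ < sampleVar W V X i ω := hω
    show 16 * Λ * T * σ ≤ _
    rw [Finset.sum_eq_single i (fun k _ hk => by rw [Pi.single_eq_of_ne hk]; simp) (by simp),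
      Pi.single_eq_same, one_mul, ← hσ]
    refine le_trans ?_ (le_abs_self _)
    have h4 : 16 * Λ * σ ≤ sampleVar W V X i ω - σ := by
      nlinarith
    nlinarith [mul_le_mul_of_nonneg_left h4 hT0.le]

lemma measure_exists_lt_sampleVar_le (hΓ : Γ.PosDef) (hΔ : ∀ i, (Δ i).PosSemidef)
    (hX : GaussianModel μ Γ Δ X) (hT : T ≠ 0) {Λ : ℝ} (hΛ : 1 ≤ Λ) :
    μ {ω | ∃ i, 17 * Λ * respVar (Γ ⊗ₖ Δ i) (respCoef W (V i)) < sampleVar W V X i ω}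
      ≤ I * (2 * ENNReal.ofReal (Real.exp (-(2 * Λ * T)))) := by
  rw [Set.ofPred_exists]
  refine (measure_iUnion_fintype_le μ _).trans ?_
  refine (Finset.sum_le_sum fun i _ => measure_lt_sampleVar_le hΓ hΔ hX hT hΛ i).trans ?_
  simp

/-- Averaging over tasks avoids the factor `Λ` of the uniform bound. In the variance of `Â` one of
three factors `q_i` is treated this way, which leaves `Λ²` where the uniform bound alone would give
`Λ³`. -/
lemma measure_lt_avg_sampleVar_le (hΓ : Γ.PosDef) (hΔ : ∀ i, (Δ i).PosSemidef)
    (hlam : 0 < lamSignal Γ Δ W V) (hX : GaussianModel μ Γ Δ X) (hT : T ≠ 0)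
    (hB : nuCoef Γ Δ W V ^ 2 * B ≤ I * T) :
    μ {ω | 17 * R * lamSignal Γ Δ W V ^ 2 * (alphaCoef Γ Δ W V + 1)
        < avg fun i => sampleVar W V X i ω *
          (Lcoef Γ Δ W V i * (specNorm Γ * specNorm (Δ i)))}
      ≤ 2 * ENNReal.ofReal (Real.exp (-(B : ℝ))) := by
  have hI := tasks_ne_zero hΓ hΔ hlam
  have hT0 : (0 : ℝ) < T := by exact_mod_cast Nat.pos_of_ne_zero hT
  have hI0 : (0 : ℝ) < I := by exact_mod_cast Nat.pos_of_ne_zero hI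
  have hR0 : (1 : ℝ) ≤ R := by exact_mod_cast (rank_bounds_of_lamSignal_pos hlam).1
  have hν1 := (one_le_etaCoef hΓ hΔ hlam).trans (etaCoef_le_nuCoef hΓ hΔ hlam)
  have hL := Lcoef_le hlam
  have hα := avg_Lcoef_sq_eq hlam
  have hα0 : 0 ≤ alphaCoef Γ Δ W V :=
    div_nonneg (avg_nonneg fun i => sq_nonneg _) (sq_nonneg _)
  set ν := nuCoef Γ Δ W V
  set lam := lamSignal Γ Δ W V
  set α := alphaCoef Γ Δ W V
  have hν0 : 0 < ν := by linarith
  set β : Fin I → ℝ := fun i => Lcoef Γ Δ W V i * (specNorm Γ * specNorm (Δ i)) / (I * T) with hβ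
  have hg := specNorm_nonneg Γ
  have hL0 : ∀ i, 0 ≤ Lcoef Γ Δ W V i := Lcoef_nonneg
  have hβ0 : ∀ i, 0 ≤ β i := fun i => by
    have := specNorm_nonneg (Δ i)
    have := hL0 i
    positivity
  have hσ0 : ∀ i, 0 ≤ respVar (Γ ⊗ₖ Δ i) (respCoef W (V i)) := fun i =>
    respVar_nonneg (kronecker_posSemidef hΓ hΔ i) _
  have hβσ : ∀ i, β i * respVar (Γ ⊗ₖ Δ i) (respCoef W (V i))
      ≤ R * Lcoef Γ Δ W V i ^ 2 / (I * T) := by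
    intro i
    rw [hβ]
    simp only
    rw [div_mul_eq_mul_div]
    refine div_le_div_of_nonneg_right ?_ (by positivity)
    have := mul_le_mul_of_nonneg_left (respVar_mul_le (Γ := Γ) (Δ := Δ) (W := W) (V := V) i) (hL0 i)
    linarith
  have hL2 : ∀ i, Lcoef Γ Δ W V i ^ 2 ≤ ν ^ 2 * lam ^ 2 := fun i => by
    rw [← mul_pow]; exact pow_le_pow_left₀ (hL0 i) (hL i) 2
  have key := measure_weight_sampleVar_le (W := W) (V := V) hΓ hΔ hX hT β hβ0
    (b := 4 * (R * (ν ^ 2 * lam ^ 2) / (I * T)))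
    (Q := 2 * (R ^ 2 * (ν ^ 2 * lam ^ 2) * (α * lam ^ 2) / (I * T))) (x := B)
    (t := 8 * R * lam ^ 2 * (α + 1)) (by positivity)
    (fun i => by
      refine mul_le_mul_of_nonneg_left ((hβσ i).trans ?_) (by norm_num)
      gcongr
      exact hL2 i)
    (by
      rw [sum_eq_mul_avg hI, ← hα]
      have h3 : ∀ i, 2 * (β i * respVar (Γ ⊗ₖ Δ i) (respCoef W (V i))) ^ 2
          ≤ 2 * R ^ 2 * (ν ^ 2 * lam ^ 2) / (I * T) ^ 2 * Lcoef Γ Δ W V i ^ 2 := by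
        intro i
        have h4 := pow_le_pow_left₀ (mul_nonneg (hβ0 i) (hσ0 i)) (hβσ i) 2
        calc _ ≤ 2 * (R * Lcoef Γ Δ W V i ^ 2 / (I * T)) ^ 2 := by linarith
          _ = 2 * R ^ 2 * Lcoef Γ Δ W V i ^ 2 / (I * T) ^ 2 * Lcoef Γ Δ W V i ^ 2 := by ring
          _ ≤ _ := by
            gcongr
            exact hL2 i
      calc _ ≤ (T : ℝ) * (I * avg fun i =>
              2 * R ^ 2 * (ν ^ 2 * lam ^ 2) / (I * T) ^ 2 * Lcoef Γ Δ W V i ^ 2) := by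
            gcongr
            exact avg_mono h3
        _ = _ := by rw [avg_const_mul]; field_simp)
    (by positivity)
    (by
      have h5 : ν ^ 2 * B / (I * T) ≤ 1 := by rw [div_le_one (by positivity)]; exact hB
      have h6 : α ≤ (α + 1) ^ 2 := by nlinarith
      calc _ = 8 * R ^ 2 * lam ^ 4 * α * (ν ^ 2 * B / (I * T)) := by ring
        _ ≤ 8 * R ^ 2 * lam ^ 4 * (α + 1) ^ 2 * 1 := by gcongr
        _ ≤ 64 * R ^ 2 * lam ^ 4 * (α + 1) ^ 2 * 1 := by gcongr; norm_num
        _ = _ := by ring)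
    (by
      have h5 : ν ^ 2 * B / (I * T) ≤ 1 := by rw [div_le_one (by positivity)]; exact hB
      calc _ = 8 * R * lam ^ 2 * (ν ^ 2 * B / (I * T)) := by ring
        _ ≤ 8 * R * lam ^ 2 * (α + 1) := by gcongr; linarith)
  refine (measure_mono fun ω hω => ?_).trans key
  have hω' : 17 * R * lam ^ 2 * (α + 1) < avg fun i => sampleVar W V X i ω *
      (Lcoef Γ Δ W V i * (specNorm Γ * specNorm (Δ i))) := hω
  show 8 * R * lam ^ 2 * (α + 1) ≤ _
  refine le_trans ?_ (le_abs_self _)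
  have h7 : (avg fun i => β i * respVar (Γ ⊗ₖ Δ i) (respCoef W (V i)))
      ≤ R * (α * lam ^ 2) / (I * T) := by
    refine (avg_mono hβσ).trans_eq ?_
    rw [← hα, div_eq_inv_mul, ← mul_assoc, ← avg_const_mul]
    congr 1; ext i; ring
  have h8 : (avg fun i => sampleVar W V X i ω *
      (Lcoef Γ Δ W V i * (specNorm Γ * specNorm (Δ i))))
      = T * ∑ i, β i * sampleVar W V X i ω := by
    rw [sum_eq_mul_avg hI, ← mul_assoc, ← avg_const_mul]
    congr 1; ext i
    rw [hβ]; field_simp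
  have h9 : (T : ℝ) * ∑ i, β i * respVar (Γ ⊗ₖ Δ i) (respCoef W (V i)) ≤ R * (α * lam ^ 2) := by
    rw [sum_eq_mul_avg hI]
    calc _ ≤ (T : ℝ) * (I * (R * (α * lam ^ 2) / (I * T))) := by gcongr
      _ = _ := by field_simp
  simp_rw [mul_sub]
  rw [Finset.sum_sub_distrib, mul_sub, ← h8]
  have h10 : 0 ≤ R * lam ^ 2 * (α + 1) := by positivity
  have h11 : (R : ℝ) * (α * lam ^ 2) ≤ R * lam ^ 2 * (α + 1) := by
    have : (0 : ℝ) ≤ R * lam ^ 2 := by positivity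
    nlinarith
  linarith

end Events

/-! ### Deviations of the three matrices at a fixed unit vector -/

section QuadraticEvents

variable {I T B P R : ℕ} {Γ : Matrix (Fin B) (Fin B) ℝ} {Δ : Fin I → Matrix (Fin P) (Fin P) ℝ}
  {W : Matrix (Fin B) (Fin R) ℝ} {V : Fin I → Matrix (Fin P) (Fin R) ℝ}
  {Ω : Type*} {X : Fin I → Fin T → Ω → Matrix (Fin B) (Fin P) ℝ}

lemma sum_smul_outerVec_kronecker_le {u : Fin B → ℝ} (hu : u ⬝ᵥ u = 1) (hΓ : Γ.PosDef)
    (i : Fin I) (w : Fin P → ℝ) :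
    (∑ p, w p • outerVec u (Pi.single p 1)) ⬝ᵥ (Γ ⊗ₖ Δ i) *ᵥ
        (∑ p, w p • outerVec u (Pi.single p 1))
      ≤ specNorm Γ * specNorm (Δ i) * ∑ p, w p ^ 2 := by
  rw [sum_smul_outerVec, outerVec_kronecker]
  have h1 := (le_abs_self _).trans (abs_dotProduct_mulVec_self_le Γ u)
  have h2 := (le_abs_self _).trans (abs_dotProduct_mulVec_self_le (Δ i) w)
  have h3 : w ⬝ᵥ w = ∑ p, w p ^ 2 := by simp only [dotProduct, sq]
  have h0 : 0 ≤ u ⬝ᵥ Γ *ᵥ u := by simpa using hΓ.posSemidef.dotProduct_mulVec_nonneg u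
  rw [hu, mul_one] at h1
  rw [h3] at h2
  have h4 := specNorm_nonneg (Δ i)
  calc _ ≤ (u ⬝ᵥ Γ *ᵥ u) * (specNorm (Δ i) * ∑ p, w p ^ 2) := by gcongr
    _ ≤ specNorm Γ * (specNorm (Δ i) * ∑ p, w p ^ 2) := by gcongr
    _ = _ := by ring

variable [MeasurableSpace Ω] {μ : Measure Ω}

/-- Each observation contributes `P` squares, so the effective sample size is `ITP`. Taking `x = 4B`
in the Bernstein bound, here and in the next two lemmas, leaves room for the union over a net; with
`b = 4 ‖Γ‖ max_i ‖Δ_i‖` this makes both constants `32`. -/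
lemma measure_lt_abs_GammaHat_le (hΓ : Γ.PosDef) (hΔ : ∀ i, (Δ i).PosSemidef)
    (hlam : 0 < lamSignal Γ Δ W V) (hX : GaussianModel μ Γ Δ X) (hT : T ≠ 0) {e : ℝ} (he : 0 ≤ e)
    (h1 : 32 * psiCoef Δ * B ≤ I * T * P * e ^ 2) (h2 : 32 * chiCoef Δ * B ≤ I * T * P * e)
    {u : Fin B → ℝ} (hu : u ⬝ᵥ u = 1) :
    μ {ω | traceScale Δ * specNorm Γ * e
        < |u ⬝ᵥ (GammaHat (fun i t => X i t ω) - traceScale Δ • Γ) *ᵥ u|}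
      ≤ 2 * ENNReal.ofReal (Real.exp (-(4 * B : ℝ))) := by
  have hI := tasks_ne_zero hΓ hΔ hlam
  have hP := covariates_ne_zero hΓ hΔ hlam
  have hT0 : (0 : ℝ) < T := by exact_mod_cast Nat.pos_of_ne_zero hT
  have hI0 : (0 : ℝ) < I := by exact_mod_cast Nat.pos_of_ne_zero hI
  have hP0 : (0 : ℝ) < P := by exact_mod_cast Nat.pos_of_ne_zero hP
  have hts := traceScale_pos hΓ hΔ hlam
  have hχ := chiCoef_pos hΓ hΔ hlam
  have hB : 1 ≤ B := (rank_bounds_of_lamSignal_pos hlam).1.trans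
    (rank_bounds_of_lamSignal_pos hlam).2
  have hg : 0 < specNorm Γ := (eig_pos hΓ hB).trans_le (eig_le_specNorm hΓ hB)
  have hψ := avg_specNorm_sq_eq hΓ hΔ hlam
  have hd := specNorm_le_chiCoef hΓ hΔ hlam
  have htr : ∑ i, (Δ i).trace = I * P * traceScale Δ := by
    rw [traceScale]; field_simp
  set ts := traceScale Δ
  set g := specNorm Γ
  set χ := chiCoef Δ
  set ψ := psiCoef Δ
  have key := measure_abs_quadratic_ge_le (μ := μ) (π := Fin P)
    (V := fun (j : Fin I × Fin T) ω => vecOf (X j.1 j.2 ω)) (S := fun j => Γ ⊗ₖ Δ j.1)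
    (fun j => hX.1 j.1 j.2) (fun j => kronecker_posSemidef hΓ hΔ j.1) hX.2
    (fun _ p => outerVec u (Pi.single p 1)) (fun j => g * specNorm (Δ j.1))
    (fun j w => sum_smul_outerVec_kronecker_le hu hΓ j.1 w)
    (b := 4 * (g * (χ * ts))) (Q := 2 * P * (I * T) * (g ^ 2 * (ψ * ts ^ 2))) (x := 4 * B)
    (t := I * T * P * (ts * g * e)) (by positivity)
    (fun j => by
      have := hd j.1
      gcongr)
    (le_of_eq (by
      rw [Fintype.sum_prod_type]
      simp only [Finset.sum_const, Finset.card_univ, Fintype.card_fin, nsmul_eq_mul, mul_pow]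
      rw [sum_eq_mul_avg hI, ← hψ, ← avg_const_mul, ← avg_const_mul, ← avg_const_mul]
      congr 1; ext i; ring))
    (by positivity)
    (by
      have h3 : 0 ≤ (I * T * P) * (ts * g) ^ 2 := by positivity
      have := mul_le_mul_of_nonneg_left h1 h3
      nlinarith)
    (by
      have h3 : 0 ≤ ts * g := by positivity
      have := mul_le_mul_of_nonneg_left h2 h3
      nlinarith)
  refine (measure_mono fun ω hω => ?_).trans key
  have hω' : ts * g * e < |u ⬝ᵥ (GammaHat (fun i t => X i t ω) - ts • Γ) *ᵥ u| := hω
  show I * T * P * (ts * g * e) ≤ _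
  have h4 : ∑ j : Fin I × Fin T, ∑ p, ((outerVec u (Pi.single p 1) ⬝ᵥ
        (vecOf (X j.1 j.2 ω)).ofLp) ^ 2 - outerVec u (Pi.single p 1) ⬝ᵥ
          (Γ ⊗ₖ Δ j.1) *ᵥ outerVec u (Pi.single p 1))
      = I * T * P * (u ⬝ᵥ (GammaHat (fun i t => X i t ω) - ts • Γ) *ᵥ u) := by
    simp only [Finset.sum_sub_distrib]
    rw [sub_mulVec, dotProduct_sub, dotProduct_GammaHat, smul_mulVec, dotProduct_smul, smul_eq_mul,
      mul_sub, ← mul_assoc, mul_one_div_cancel (by positivity), one_mul]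
    congr 1
    simp only [outerVec_kronecker, single_one_dotProduct, mulVec_single_one, col_apply,
      ← Finset.mul_sum]
    rw [Fintype.sum_prod_type]
    have h5 : ∀ i, ∑ p, (Δ i) p p = (Δ i).trace := fun i => rfl
    simp only [Finset.sum_const, Finset.card_univ, Fintype.card_fin, nsmul_eq_mul, h5,
      ← Finset.mul_sum]
    rw [htr]; ring
  rw [h4, abs_mul, abs_of_pos (by positivity : (0 : ℝ) < I * T * P)]
  gcongr

/-- The quadratic form is a weighted sum of `q_i - σ_i` with weights proportional to `σ_i ‖A_iᵀ
u‖²`, and `σ_i² ‖A_iᵀ u‖² = ‖M_iᵀ u‖² ≤ L_i`. So `α` governs the variance and `ν` the largest term.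
-/
lemma measure_lt_abs_weightedReg_le (hΓ : Γ.PosDef) (hΔ : ∀ i, (Δ i).PosSemidef)
    (hlam : 0 < lamSignal Γ Δ W V) (hX : GaussianModel μ Γ Δ X) (hT : T ≠ 0) {θ : ℝ} (hθ : 0 ≤ θ)
    (h1 : alphaCoef Γ Δ W V * B ≤ θ ^ 2 * (I * T)) (h2 : nuCoef Γ Δ W V * B ≤ θ * (I * T))
    {u : Fin B → ℝ} (hu : u ⬝ᵥ u = 1) :
    μ {ω | 32 * θ * lamSignal Γ Δ W V
        < |u ⬝ᵥ (weightedReg Γ Δ W V fun i =>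
          (sampleVar W V X i ω - respVar (Γ ⊗ₖ Δ i) (respCoef W (V i)))
            * respVar (Γ ⊗ₖ Δ i) (respCoef W (V i))) *ᵥ u|}
      ≤ 2 * ENNReal.ofReal (Real.exp (-(4 * B : ℝ))) := by
  have hI := tasks_ne_zero hΓ hΔ hlam
  have hT0 : (0 : ℝ) < T := by exact_mod_cast Nat.pos_of_ne_zero hT
  have hI0 : (0 : ℝ) < I := by exact_mod_cast Nat.pos_of_ne_zero hI
  have hν1 := (one_le_etaCoef hΓ hΔ hlam).trans (etaCoef_le_nuCoef hΓ hΔ hlam)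
  have hL := Lcoef_le hlam
  have hα := avg_Lcoef_sq_eq hlam
  set ν := nuCoef Γ Δ W V
  set lam := lamSignal Γ Δ W V
  set α := alphaCoef Γ Δ W V
  have hν0 : 0 < ν := by linarith
  have hσ0 : ∀ i, 0 ≤ respVar (Γ ⊗ₖ Δ i) (respCoef W (V i)) := fun i =>
    respVar_nonneg (kronecker_posSemidef hΓ hΔ i) _
  set β : Fin I → ℝ := fun i => respVar (Γ ⊗ₖ Δ i) (respCoef W (V i)) *
    ((regMat Γ (Δ i) W (V i))ᵀ *ᵥ u ⬝ᵥ (regMat Γ (Δ i) W (V i))ᵀ *ᵥ u) / (I * T) with hβ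
  have hβ0 : ∀ i, 0 ≤ β i := fun i =>
    div_nonneg (mul_nonneg (hσ0 i) (dotProduct_self_nonneg' _)) (by positivity)
  have hβσ : ∀ i, β i * respVar (Γ ⊗ₖ Δ i) (respCoef W (V i)) ≤ Lcoef Γ Δ W V i / (I * T) := by
    intro i
    have h3 := signalMat_transpose_mulVec_le (Γ := Γ) (Δ := Δ) (W := W) (V := V) i u
    rw [hu, mul_one, ← regMat_sq_eq_signalMat hΓ hΔ] at h3
    rw [hβ]
    simp only
    rw [div_mul_eq_mul_div]
    refine div_le_div_of_nonneg_right (le_of_eq_of_le (by ring) h3) (by positivity)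
  have key := measure_weight_sampleVar_le (W := W) (V := V) hΓ hΔ hX hT β hβ0
    (b := 4 * (ν * lam / (I * T))) (Q := 2 * (α * lam ^ 2 / (I * T))) (x := 4 * B)
    (t := 32 * θ * lam) (by positivity)
    (fun i => by
      refine mul_le_mul_of_nonneg_left ((hβσ i).trans ?_) (by norm_num)
      exact div_le_div_of_nonneg_right (hL i) (by positivity))
    (by
      rw [sum_eq_mul_avg hI, ← hα]
      have h3 : ∀ i, 2 * (β i * respVar (Γ ⊗ₖ Δ i) (respCoef W (V i))) ^ 2
          ≤ 2 / (I * T) ^ 2 * Lcoef Γ Δ W V i ^ 2 := by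
        intro i
        have h4 := pow_le_pow_left₀ (mul_nonneg (hβ0 i) (hσ0 i)) (hβσ i) 2
        rw [div_pow] at h4
        calc _ ≤ 2 * (Lcoef Γ Δ W V i ^ 2 / (I * T) ^ 2) := by linarith
          _ = _ := by ring
      calc _ ≤ (T : ℝ) * (I * avg fun i => 2 / (I * T) ^ 2 * Lcoef Γ Δ W V i ^ 2) := by
            gcongr
            exact avg_mono h3
        _ = _ := by rw [avg_const_mul]; field_simp)
    (by positivity)
    (by
      have h5 : α * B / (I * T) ≤ θ ^ 2 := by rw [div_le_iff₀ (by positivity)]; exact h1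
      calc _ = 32 * lam ^ 2 * (α * B / (I * T)) := by ring
        _ ≤ 32 * lam ^ 2 * θ ^ 2 := by gcongr
        _ ≤ 1024 * lam ^ 2 * θ ^ 2 := by gcongr; norm_num
        _ = _ := by ring)
    (by
      have h5 : ν * B / (I * T) ≤ θ := by rw [div_le_iff₀ (by positivity)]; exact h2
      calc _ = 32 * lam * (ν * B / (I * T)) := by ring
        _ ≤ 32 * lam * θ := by gcongr
        _ = _ := by ring)
  refine (measure_mono fun ω hω => ?_).trans key
  refine (le_of_lt (show 32 * θ * lam < _ from hω)).trans_eq ?_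
  rw [dotProduct_weightedReg, Finset.mul_sum, Finset.mul_sum]
  congr 1
  refine Finset.sum_congr rfl fun i _ => ?_
  rw [hβ]; field_simp

/-- The quadratic form of `Â - cΓ - H` is `condDev / I`. Its conditional variance has a part from
products of residuals, proportional to `P/T`, and a part mixing residuals with the regression term;
both are controlled only for responses in the good set. -/
lemma measure_lt_abs_AHat_le [IsProbabilityMeasure μ] (hΓ : Γ.PosDef)
    (hΔ : ∀ i, (Δ i).PosSemidef)
    (hlam : 0 < lamSignal Γ Δ W V) (hX : GaussianModel μ Γ Δ X) (hT : T ≠ 0) {θ Λ pm : ℝ}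
    (hθ : 0 ≤ θ) (hΛ : 1 ≤ Λ) (hpm : 1 ≤ pm) (hPT : P / T ≤ pm)
    (h1 : (alphaCoef Γ Δ W V + 1) * (R ^ 2 * Λ ^ 2 * pm * B) ≤ 2 * θ ^ 2 * (I * T))
    (h2 : nuCoef Γ Δ W V * (R * Λ * B) ≤ θ * (I * T))
    {u : Fin B → ℝ} (hu : u ⬝ᵥ u = 1) :
    μ {ω | ((∀ i, sampleVar W V X i ω ≤ 17 * Λ * respVar (Γ ⊗ₖ Δ i) (respCoef W (V i))) ∧
        (avg fun i => sampleVar W V X i ω * (Lcoef Γ Δ W V i * (specNorm Γ * specNorm (Δ i))))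
          ≤ 17 * R * lamSignal Γ Δ W V ^ 2 * (alphaCoef Γ Δ W V + 1)) ∧
        805 * θ * lamSignal Γ Δ W V
        < |u ⬝ᵥ (AHat (fun i t => X i t ω)
              (fun i t => respCoef W (V i) ⬝ᵥ (vecOf (X i t ω)).ofLp)
            - noiseCoef Δ T (fun i => sampleVar W V X i ω) • Γ
            - weightedReg Γ Δ W V fun i => sampleVar W V X i ω ^ 2
              - sampleVar W V X i ω * respVar (Γ ⊗ₖ Δ i) (respCoef W (V i)) / T) *ᵥ u|}
      ≤ 2 * ENNReal.ofReal (Real.exp (-(4 * B : ℝ))) := by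
  have hI := tasks_ne_zero hΓ hΔ hlam
  have hT0 : (0 : ℝ) < T := by exact_mod_cast Nat.pos_of_ne_zero hT
  have hI0 : (0 : ℝ) < I := by exact_mod_cast Nat.pos_of_ne_zero hI
  have hR1 : (1 : ℝ) ≤ R := by exact_mod_cast (rank_bounds_of_lamSignal_pos hlam).1
  have hν1 := (one_le_etaCoef hΓ hΔ hlam).trans (etaCoef_le_nuCoef hΓ hΔ hlam)
  have hL := Lcoef_le hlam
  have hα := avg_Lcoef_sq_eq hlam
  have hα0 : 0 ≤ alphaCoef Γ Δ W V :=
    div_nonneg (avg_nonneg fun i => sq_nonneg _) (sq_nonneg _)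
  have hrv := respVar_mul_le (Γ := Γ) (Δ := Δ) (W := W) (V := V)
  have hL0 : ∀ i, 0 ≤ Lcoef Γ Δ W V i := Lcoef_nonneg
  set ν := nuCoef Γ Δ W V
  set lam := lamSignal Γ Δ W V
  set α := alphaCoef Γ Δ W V
  have hν0 : 0 < ν := by linarith
  have hσ0 : ∀ i, 0 ≤ respVar (Γ ⊗ₖ Δ i) (respCoef W (V i)) := fun i =>
    respVar_nonneg (kronecker_posSemidef hΓ hΔ i) _
  have hg0 : ∀ i, 0 ≤ specNorm Γ * specNorm (Δ i) := fun i =>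
    mul_nonneg (specNorm_nonneg _) (specNorm_nonneg _)
  set G : Set (Fin I × Fin T → ℝ) := {r |
    (∀ i, (∑ t, r (i, t) ^ 2) / T ≤ 17 * Λ * respVar (Γ ⊗ₖ Δ i) (respCoef W (V i))) ∧
    (avg fun i => (∑ t, r (i, t) ^ 2) / T *
      (Lcoef Γ Δ W V i * (specNorm Γ * specNorm (Δ i)))) ≤ 17 * R * lam ^ 2 * (α + 1)} with hG
  have hGm : MeasurableSet G := by
    rw [hG, Set.ofPred_and, Set.ofPred_forall]
    refine MeasurableSet.inter ?_ ?_
    · refine MeasurableSet.iInter fun i => measurableSet_le ?_ measurable_const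
      fun_prop
    · refine measurableSet_le ?_ measurable_const
      simp only [avg]
      fun_prop
  have hvq : ∀ r ∈ G, ∀ i, specNorm Γ * specNorm (Δ i) * ((∑ t, r (i, t) ^ 2) / (T : ℝ) ^ 2)
      ≤ 17 * Λ * R * Lcoef Γ Δ W V i / T := by
    intro r hr i
    rw [sq, ← div_div, ← mul_div_assoc]
    refine div_le_div_of_nonneg_right ?_ hT0.le
    calc _ ≤ specNorm Γ * specNorm (Δ i) *
          (17 * Λ * respVar (Γ ⊗ₖ Δ i) (respCoef W (V i))) :=
          mul_le_mul_of_nonneg_left (hr.1 i) (hg0 i)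
      _ = 17 * Λ * (respVar (Γ ⊗ₖ Δ i) (respCoef W (V i)) *
          (specNorm Γ * specNorm (Δ i))) := by ring
      _ ≤ 17 * Λ * (R * Lcoef Γ Δ W V i) :=
          mul_le_mul_of_nonneg_left (hrv i) (by linarith)
      _ = _ := by ring
  have hqA : ∀ r ∈ G, ∀ i, ∑ p, ((∑ t, r (i, t) ^ 2) / T * (outerVec u (Pi.single p 1) ⬝ᵥ
      regCoef (Γ ⊗ₖ Δ i) (respCoef W (V i)))) ^ 2 ≤ 289 * Λ ^ 2 * Lcoef Γ Δ W V i := by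
    intro r hr i
    simp_rw [mul_pow]
    rw [← Finset.mul_sum, sum_sq_outerVec_single_regCoef]
    have h3 := signalMat_transpose_mulVec_le (Γ := Γ) (Δ := Δ) (W := W) (V := V) i u
    rw [hu, mul_one, ← regMat_sq_eq_signalMat hΓ hΔ] at h3
    have h4 := pow_le_pow_left₀ (by positivity) (hr.1 i) 2
    calc _ ≤ (17 * Λ * respVar (Γ ⊗ₖ Δ i) (respCoef W (V i))) ^ 2 * _ :=
          mul_le_mul_of_nonneg_right h4 (dotProduct_self_nonneg' _)
      _ = 289 * Λ ^ 2 * (respVar (Γ ⊗ₖ Δ i) (respCoef W (V i)) ^ 2 *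
        ((regMat Γ (Δ i) W (V i))ᵀ *ᵥ u ⬝ᵥ (regMat Γ (Δ i) W (V i))ᵀ *ᵥ u)) := by ring
      _ ≤ _ := by gcongr
  have key := measure_mem_and_abs_condDev_ge_le (μ := μ) (π := Fin P)
    (V := fun (j : Fin I × Fin T) ω => vecOf (X j.1 j.2 ω)) (S := fun i => Γ ⊗ₖ Δ i)
    (fun j => hX.1 j.1 j.2) (fun i => kronecker_posSemidef hΓ hΔ i) hX.2
    (fun i => respCoef W (V i)) (fun p => outerVec u (Pi.single p 1)) T
    (fun i => specNorm Γ * specNorm (Δ i))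
    (fun i w => sum_smul_outerVec_kronecker_le hu hΓ i w) hGm
    (b := 68 * Λ * R * (ν * lam) / T)
    (Q := 20230 * (I / T * Λ ^ 2 * R ^ 2 * pm * lam ^ 2 * (α + 1))) (x := 4 * B)
    (t := I * (805 * θ * lam)) (by positivity) (by positivity)
    (fun r hr i => by
      calc _ ≤ 4 * (17 * Λ * R * Lcoef Γ Δ W V i / T) :=
            mul_le_mul_of_nonneg_left (hvq r hr i) (by norm_num)
        _ ≤ 4 * (17 * Λ * R * (ν * lam) / T) := by gcongr; exact hL i
        _ = _ := by ring)
    -- The pure residual part yields `578 = 2·17²`, the mixed part `19652 = 4·17²·17`; their sum is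
    -- `20230`. In the mixed part two factors `q` use the uniform bound and the third the averaged
    -- one.
    (fun r hr => by
      have h3 : ∀ i, 2 * (Fintype.card (Fin P) : ℝ) * (specNorm Γ * specNorm (Δ i) *
            ((∑ t, r (i, t) ^ 2) / (T : ℝ) ^ 2)) ^ 2
          + 4 * (specNorm Γ * specNorm (Δ i) * ((∑ t, r (i, t) ^ 2) / (T : ℝ) ^ 2)) *
            ∑ p, ((∑ t, r (i, t) ^ 2) / T * (outerVec u (Pi.single p 1) ⬝ᵥ
              regCoef (Γ ⊗ₖ Δ i) (respCoef W (V i)))) ^ 2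
          ≤ 578 * P * Λ ^ 2 * R ^ 2 / T ^ 2 * Lcoef Γ Δ W V i ^ 2
            + 1156 * Λ ^ 2 / T * ((∑ t, r (i, t) ^ 2) / T *
              (Lcoef Γ Δ W V i * (specNorm Γ * specNorm (Δ i)))) := by
        intro i
        have h4 : 0 ≤ specNorm Γ * specNorm (Δ i) * ((∑ t, r (i, t) ^ 2) / (T : ℝ) ^ 2) :=
          mul_nonneg (hg0 i) (by positivity)
        refine add_le_add ?_ ?_
        · rw [Fintype.card_fin]
          calc _ ≤ 2 * (P : ℝ) * (17 * Λ * R * Lcoef Γ Δ W V i / T) ^ 2 := by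
                gcongr; exact hvq r hr i
            _ = _ := by ring
        · calc _ ≤ 4 * (specNorm Γ * specNorm (Δ i) * ((∑ t, r (i, t) ^ 2) / (T : ℝ) ^ 2)) *
                (289 * Λ ^ 2 * Lcoef Γ Δ W V i) :=
                mul_le_mul_of_nonneg_left (hqA r hr i) (by positivity)
            _ = _ := by ring
      refine (Finset.sum_le_sum fun i _ => h3 i).trans ?_
      rw [Finset.sum_add_distrib, sum_eq_mul_avg hI, sum_eq_mul_avg hI, avg_const_mul,
        avg_const_mul, hα]
      have h5 := hr.2
      have h6 : (1 : ℝ) ≤ R * pm := by nlinarith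
      calc _ ≤ I * (578 * P * Λ ^ 2 * R ^ 2 / T ^ 2 * (α * lam ^ 2))
            + I * (1156 * Λ ^ 2 / T * (17 * R * lam ^ 2 * (α + 1))) := by gcongr
        _ = 578 * (I / T * Λ ^ 2 * R ^ 2 * lam ^ 2) * ((P / T) * α)
            + 19652 * (I / T * Λ ^ 2 * R * lam ^ 2 * (α + 1)) * 1 := by
            field_simp; ring
        _ ≤ 578 * (I / T * Λ ^ 2 * R ^ 2 * lam ^ 2) * (pm * (α + 1))
            + 19652 * (I / T * Λ ^ 2 * R * lam ^ 2 * (α + 1)) * (R * pm) := by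
            gcongr
            linarith
        _ = _ := by ring)
    (by positivity)
    -- The constant `805` is chosen so that `805² = 648025` exceeds `2·16·20230 = 647360`.
    (by
      calc _ = 323680 * (lam ^ 2 * (I / T)) * ((α + 1) * (R ^ 2 * Λ ^ 2 * pm * B)) := by ring
        _ ≤ 323680 * (lam ^ 2 * (I / T)) * (2 * θ ^ 2 * (I * T)) := by gcongr
        _ = 647360 * (I * θ * lam) ^ 2 := by field_simp; ring
        _ ≤ 648025 * (I * θ * lam) ^ 2 := by gcongr; norm_num
        _ = _ := by ring)
    (by
      calc _ = 544 * (lam / T) * (ν * (R * Λ * B)) := by ring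
        _ ≤ 544 * (lam / T) * (θ * (I * T)) := by gcongr
        _ = 544 * (I * θ * lam) := by field_simp
        _ ≤ 805 * (I * θ * lam) := by gcongr; norm_num
        _ = _ := by ring)
  refine (measure_mono fun ω hω => ?_).trans key
  refine ⟨hω.1, ?_⟩
  have h7 := condDev_eq (Γ := Γ) (Δ := Δ) (W := W) (V := V) hI X
    (fun i t ω => respCoef W (V i) ⬝ᵥ (vecOf (X i t ω)).ofLp) (fun _ _ _ => rfl) u ω
  have h8 := hω.2.le
  refine le_of_le_of_eq ?_ (congrArg abs h7).symm
  rw [abs_mul, abs_of_pos hI0]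
  exact mul_le_mul_of_nonneg_left h8 hI0.le

end QuadraticEvents

/-! ### From deviation bounds to the distance, and union bounds -/

section Conclusion

variable {I T B P R : ℕ} {Γ : Matrix (Fin B) (Fin B) ℝ} {Δ : Fin I → Matrix (Fin P) (Fin P) ℝ}
  {W : Matrix (Fin B) (Fin R) ℝ} {V : Fin I → Matrix (Fin P) (Fin R) ℝ}
  {Ω : Type*} {X : Fin I → Fin T → Ω → Matrix (Fin B) (Fin P) ℝ}

lemma noiseCoef_nonneg (hΔ : ∀ i, (Δ i).PosSemidef) {q : Fin I → ℝ} (hq : ∀ i, 0 ≤ q i) :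
    0 ≤ noiseCoef Δ T q :=
  mul_nonneg (by positivity) (Finset.sum_nonneg fun i _ =>
    mul_nonneg (div_nonneg (hq i) (by positivity)) (hΔ i).trace_nonneg)

/-- The size of the noise relative to the signal. It can grow like `P/T`, and the accuracy required
of `Γ̂` has to be scaled down accordingly. -/
lemma noiseCoef_mul_le (hΓ : Γ.PosDef) (hΔ : ∀ i, (Δ i).PosSemidef)
    (hlam : 0 < lamSignal Γ Δ W V) {q : Fin I → ℝ} {Λ : ℝ} (hΛ : 1 ≤ Λ) (hq0 : ∀ i, 0 ≤ q i)
    (hq : ∀ i, q i ≤ 17 * Λ * respVar (Γ ⊗ₖ Δ i) (respCoef W (V i))) :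
    noiseCoef Δ T q * specNorm Γ
      ≤ 17 * (P * R * Λ * etaCoef Γ Δ W V / T) * lamSignal Γ Δ W V := by
  have h1 : ∀ i, specNorm Γ * (q i / T * (Δ i).trace)
      ≤ 17 * (P * R * Λ / T) * Lcoef Γ Δ W V i := by
    intro i
    have hg := specNorm_nonneg Γ
    have hd := specNorm_nonneg (Δ i)
    have hσ := respVar_nonneg (kronecker_posSemidef hΓ hΔ i) (respCoef W (V i))
    have hqi := hq0 i
    calc specNorm Γ * (q i / T * (Δ i).trace)
        ≤ specNorm Γ * (q i / T * (P * specNorm (Δ i))) := by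
          gcongr; exact trace_le_specNorm _
      _ ≤ specNorm Γ * (17 * Λ * respVar (Γ ⊗ₖ Δ i) (respCoef W (V i)) / T *
            (P * specNorm (Δ i))) := by gcongr; exact hq i
      _ = 17 * (P * Λ / T) * (respVar (Γ ⊗ₖ Δ i) (respCoef W (V i)) *
            (specNorm Γ * specNorm (Δ i))) := by ring
      _ ≤ 17 * (P * Λ / T) * (R * Lcoef Γ Δ W V i) :=
          mul_le_mul_of_nonneg_left (respVar_mul_le i) (by positivity)
      _ = _ := by ring
  have h2 := avg_mono h1
  rw [avg_const_mul, avg_const_mul, avg_Lcoef_eq hlam] at h2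
  calc noiseCoef Δ T q * specNorm Γ = specNorm Γ * avg fun i => q i / T * (Δ i).trace := by
        rw [noiseCoef, avg]; ring
    _ ≤ _ := h2
    _ = _ := by ring

-- The accuracy `e = 1024 θ / D` of `Γ̂` serves two purposes, one for each entry of the maximum `D`:
-- `κ e = O(θ)`, so that `Γ̂` is well conditioned, and `c ‖Γ‖ e = O(θ λ)`, so that replacing `Γ` by
-- `Γ̂` in the noise costs no more than the other errors.
set_option maxHeartbeats 1000000 in
lemma subspaceDist_lt_of_deviations (hΓ : Γ.PosDef) (hΔ : ∀ i, (Δ i).PosSemidef)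
    (hlam : 0 < lamSignal Γ Δ W V) (hT : 2 ≤ T) {ε θ Λ D : ℝ} (hε : 0 < ε) (hε1 : ε ≤ 1)
    (hΛ : 1 ≤ Λ) (hθ : θ = ε / (4000000 * (1 + kappa Γ ^ 2)))
    (hD : D = max (kappa Γ) (P * R * Λ * etaCoef Γ Δ W V / T))
    {x : Fin I → Fin T → Matrix (Fin B) (Fin P) ℝ} {y : Fin I → Fin T → ℝ} {q : Fin I → ℝ}
    (hq0 : ∀ i, 0 ≤ q i)
    (hq : ∀ i, q i ≤ 17 * Λ * respVar (Γ ⊗ₖ Δ i) (respCoef W (V i)))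
    (hG : specNorm (GammaHat x - traceScale Δ • Γ)
      ≤ 32 * (traceScale Δ * specNorm Γ * (32 * θ / D)))
    (hR : specNorm (weightedReg Γ Δ W V fun i =>
      (q i - respVar (Γ ⊗ₖ Δ i) (respCoef W (V i))) * respVar (Γ ⊗ₖ Δ i) (respCoef W (V i)))
        ≤ 32 * (32 * θ * lamSignal Γ Δ W V))
    (hA : specNorm (AHat x y - noiseCoef Δ T q • Γ - weightedReg Γ Δ W V fun i =>
      q i ^ 2 - q i * respVar (Γ ⊗ₖ Δ i) (respCoef W (V i)) / T)
        ≤ 32 * (805 * θ * lamSignal Γ Δ W V))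
    {What : Matrix (Fin B) (Fin R) ℝ} (hout : IsOutput x y What) :
    subspaceDist What W < ε := by
  obtain ⟨U, hU, hWhat⟩ := hout
  obtain ⟨h1R, hRB⟩ := rank_bounds_of_lamSignal_pos hlam
  have hB : 1 ≤ B := h1R.trans hRB
  have hl := eig_pos hΓ hB
  have hlg := eig_le_specNorm hΓ hB
  have hg : 0 < specNorm Γ := hl.trans_le hlg
  have hκ := one_le_kappa hΓ hB
  have hts := traceScale_pos hΓ hΔ hlam
  have hDκ : kappa Γ ≤ D := hD ▸ le_max_left _ _
  have hDη : P * R * Λ * etaCoef Γ Δ W V / T ≤ D := hD ▸ le_max_right _ _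
  have hD0 : 0 < D := by linarith
  have hθ0 : 0 < θ := by rw [hθ]; positivity
  have hθε : θ * (4000000 * (1 + kappa Γ ^ 2)) = ε := by
    rw [hθ, div_mul_cancel₀ _ (by positivity)]
  have hθ1 : θ ≤ 1 / 4000000 := by
    nlinarith [mul_nonneg hθ0.le (sq_nonneg (kappa Γ))]
  have hcg := noiseCoef_mul_le (T := T) hΓ hΔ hlam hΛ hq0 hq
  have hc0 := noiseCoef_nonneg (T := T) hΔ hq0
  have hκdef : specNorm Γ = kappa Γ * eig Γ B := by rw [kappa, div_mul_cancel₀ _ hl.ne']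
  set lam := lamSignal Γ Δ W V with hlamdef
  set g := specNorm Γ
  set c := noiseCoef Δ T q
  set l := eig Γ B
  set k := kappa Γ
  set e := 1024 * θ / D with he
  have he0 : 0 ≤ e := by positivity
  have hke : k * e ≤ 1024 * θ := by
    rw [he, mul_div_assoc', div_le_iff₀ hD0]
    nlinarith
  have hce : c * (g * e) ≤ 17408 * θ * lam := by
    calc c * (g * e) = (c * g) * e := by ring
      _ ≤ (17 * D * lam) * e := by
        refine mul_le_mul_of_nonneg_right (hcg.trans ?_) he0
        gcongr
      _ = _ := by rw [he]; field_simp; ring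
  obtain ⟨K, hK⟩ := exists_weightedReg_eq (Γ := Γ) (Δ := Δ) (W := W) (V := V) fun i =>
    q i ^ 2 - q i * respVar (Γ ⊗ₖ Δ i) (respCoef W (V i)) / T
  obtain ⟨Y, hY, hYe⟩ := exists_frame_eig_le (isHermitian_signal (W := W) (V := V) hΓ hΔ) hRB
  -- Half of the signal survives the linearization, and the linear deviation `2048 θ λ` takes away
  -- at most `λ / 4` more.
  have hYH : ∀ a, lam / 4 * (Y *ᵥ a ⬝ᵥ Y *ᵥ a) ≤ Y *ᵥ a ⬝ᵥ (Γ * W * K) *ᵥ (Y *ᵥ a) := by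
    intro a
    rw [← hK]
    have h3 := le_dotProduct_weightedReg hΓ hΔ hT q hR (Y *ᵥ a)
    have h4 := hYe a
    rw [← lamSignal, ← hlamdef] at h4
    have h5 := dotProduct_self_nonneg' (Y *ᵥ a)
    have h6 : 2 * (32 * (32 * θ * lam)) ≤ lam / 4 := by nlinarith
    have h7 := mul_le_mul_of_nonneg_right h6 h5
    linarith
  rw [hK] at hA
  set t := 32 * (805 * θ * lam) with ht
  have ht0 : 0 ≤ t := by positivity
  have ht2 : t + c * (g * e) ≤ 43168 * θ * lam := by rw [ht]; linarith
  set δ := 6 * (g / l) ^ 2 * ((t + c * (g * e)) / (lam / 4)) + g * e / l with hδ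
  have hgl : g / l = k := by rw [hκdef, mul_div_cancel_right₀ _ hl.ne']
  -- The error is `32·805 + 17·1024 = 43168` times `θλ`. Division by `λ/4` and the factor `6` give
  -- `1036032`, and the term `κ e` adds `1024`. Three times the total stays below `4000000`.
  have hδle : δ ≤ 1037056 * k ^ 2 * θ := by
    have h8 : (t + c * (g * e)) / (lam / 4) ≤ 172672 * θ := by
      rw [div_le_iff₀ (by positivity)]; linarith
    have h9 : g * e / l = k * e := by rw [← hgl]; ring
    rw [hδ, h9, hgl]
    have h10 : 6 * k ^ 2 * ((t + c * (g * e)) / (lam / 4)) ≤ 6 * k ^ 2 * (172672 * θ) := by gcongr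
    have h11 : θ ≤ k ^ 2 * θ := le_mul_of_one_le_left hθ0.le (one_le_pow₀ hκ)
    linarith
  have hkθ : 0 ≤ k ^ 2 * θ := by positivity
  have hδε : 3 * δ < ε := by rw [← hθε]; nlinarith
  have key := subspaceDist_output_le h1R hRB hl (eig_mul_dotProduct_le hΓ.1) hlg
    (isHermitian_GammaHat x) hts he0 (hG.trans_eq (by rw [he]; ring))
    (by
      have : g * e = k * e * l := by rw [hκdef]; ring
      rw [this]
      nlinarith)
    (isHermitian_AHat x y) hc0 ht0 hA hY hYH (by positivity)
    (by nlinarith) hU hWhat hδ (by linarith)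
  exact key.trans_lt hδε

/-- The net has `5 ^ B` points and the tail is `2 e^{-4B}`; since `5 e^{-3} ≤ 1/2`, a single factor
`e^{-3B}` pays for the net and for the factor `2`. -/
lemma five_pow_mul_exp_le (hB : 1 ≤ B) :
    (5 : ℝ) ^ B * (2 * Real.exp (-(4 * B : ℝ))) ≤ Real.exp (-(B : ℝ)) := by
  have h1 : (10 : ℝ) ≤ Real.exp 3 := by
    have h2 : Real.exp 3 = Real.exp 1 ^ 3 := by rw [← Real.exp_nat_mul]; norm_num
    have h3 := Real.exp_one_gt_d9
    rw [h2]
    calc (10 : ℝ) ≤ 2.7182818283 ^ 3 := by norm_num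
      _ ≤ _ := by gcongr
  have h4 : 5 * Real.exp (-3) ≤ 1 / 2 := by
    rw [Real.exp_neg, ← div_eq_mul_inv, div_le_iff₀ (by positivity)]; linarith
  have h5 : (5 * Real.exp (-3)) ^ B ≤ 1 / 2 :=
    (pow_le_of_le_one (by positivity) (by linarith) (by omega)).trans h4
  have h6 : Real.exp (-(4 * B : ℝ)) = Real.exp (-3) ^ B * Real.exp (-(B : ℝ)) := by
    rw [← Real.exp_nat_mul, ← Real.exp_add]; congr 1; ring
  calc _ = (5 * Real.exp (-3)) ^ B * 2 * Real.exp (-(B : ℝ)) := by rw [h6, mul_pow]; ring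
    _ ≤ 1 / 2 * 2 * Real.exp (-(B : ℝ)) := by gcongr
    _ = _ := by ring

variable [MeasurableSpace Ω] {μ : Measure Ω}

lemma measure_biUnion_net_le (hB : 1 ≤ B) {N : Finset (Fin B → ℝ)} (hN : N.card ≤ 5 ^ B)
    {E : (Fin B → ℝ) → Set Ω}
    (hE : ∀ u ∈ N, μ (E u) ≤ 2 * ENNReal.ofReal (Real.exp (-(4 * B : ℝ)))) :
    μ (⋃ u ∈ N, E u) ≤ ENNReal.ofReal (Real.exp (-(B : ℝ))) := by
  refine (measure_biUnion_finset_le N E).trans ((Finset.sum_le_sum hE).trans ?_)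
  rw [Finset.sum_const, nsmul_eq_mul]
  calc _ ≤ ((5 ^ B : ℕ) : ENNReal) * (2 * ENNReal.ofReal (Real.exp (-(4 * B : ℝ)))) := by
        gcongr
    _ = ENNReal.ofReal ((5 : ℝ) ^ B * (2 * Real.exp (-(4 * B : ℝ)))) := by
        rw [ENNReal.ofReal_mul (by positivity), ENNReal.ofReal_mul (by positivity),
          ENNReal.ofReal_pow (by positivity)]
        norm_num
    _ ≤ _ := ENNReal.ofReal_le_ofReal (five_pow_mul_exp_le hB)

/-- Since `ΛT ≥ log(IT)`, the sum is at most `2I / (IT)² = 2 / (T · IT)`, and `T ≥ 2` with `IT ≥ B`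
finishes. -/
lemma tasks_mul_exp_le (hI : I ≠ 0) (hT : 2 ≤ T) (hB : 1 ≤ B) (hBI : (B : ℝ) ≤ I * T) {Λ : ℝ}
    (hΛ : Real.log (I * T) / T ≤ Λ) :
    (I : ENNReal) * (2 * ENNReal.ofReal (Real.exp (-(2 * Λ * T))))
      ≤ ENNReal.ofReal (1 / (B : ℝ)) := by
  have hT' : (2 : ℝ) ≤ T := by exact_mod_cast hT
  have hI0 : (0 : ℝ) < I := by exact_mod_cast Nat.pos_of_ne_zero hI
  have hB0 : (0 : ℝ) < B := by exact_mod_cast hB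
  have hN0 : (0 : ℝ) < I * T := by positivity
  have h1 : Real.log (I * T) ≤ Λ * T := (div_le_iff₀ (by linarith)).1 hΛ
  have h2 : Real.exp (-(2 * Λ * T)) ≤ ((I * T : ℝ) ^ 2)⁻¹ := by
    calc Real.exp (-(2 * Λ * T)) ≤ Real.exp (-(2 * Real.log (I * T))) :=
          Real.exp_le_exp.2 (by linarith)
      _ = _ := by
        rw [Real.exp_neg, show 2 * Real.log (I * T) = (2 : ℕ) * Real.log (I * T) by norm_num,
          Real.exp_nat_mul, Real.exp_log hN0]
  have h3 : (I : ℝ) * (2 * Real.exp (-(2 * Λ * T))) ≤ 1 / B := by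
    calc (I : ℝ) * (2 * Real.exp (-(2 * Λ * T))) ≤ I * (2 * ((I * T : ℝ) ^ 2)⁻¹) := by gcongr
      _ = 2 / (T * (I * T)) := by field_simp
      _ ≤ 2 / (2 * B) := by gcongr
      _ = 1 / B := by field_simp
  calc _ = ENNReal.ofReal ((I : ℝ) * (2 * Real.exp (-(2 * Λ * T)))) := by
        rw [ENNReal.ofReal_mul (by positivity), ENNReal.ofReal_mul (by positivity)]
        simp
    _ ≤ _ := ENNReal.ofReal_le_ofReal h3

end Conclusion

/-! ### Use of the sample size and assembly -/

section Main

variable {I T B P R : ℕ} {Γ : Matrix (Fin B) (Fin B) ℝ} {Δ : Fin I → Matrix (Fin P) (Fin P) ℝ}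
  {W : Matrix (Fin B) (Fin R) ℝ} {V : Fin I → Matrix (Fin P) (Fin R) ℝ}

lemma coef_mul_le_of_sample_size {N M k c ε a : ℝ} (hc : 0 < c) (hε : 0 < ε) (hM : 0 ≤ M)
    (h : c ^ 2 * k * (ε ^ 2)⁻¹ * M ≤ N) (ha : a ≤ k) : a * M ≤ (ε / c) ^ 2 * N := by
  calc a * M ≤ k * M := by gcongr
    _ = (ε / c) ^ 2 * (c ^ 2 * k * (ε ^ 2)⁻¹ * M) := by field_simp
    _ ≤ _ := by gcongr

/-- The sample size controls the deviation of the sample covariance. -/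
lemma covariance_sample_size {N M Λ pm κ η χ ψ θ D b p t r : ℝ} (hb : 0 ≤ b) (hr : 1 ≤ r)
    (hp : 1 ≤ p) (ht : 1 ≤ t) (hΛ : 1 ≤ Λ) (hpm : 1 ≤ pm) (hpt : p / t ≤ pm) (hκ : 1 ≤ κ)
    (hη : 1 ≤ η) (hχ : 0 ≤ χ) (hψ : 0 ≤ ψ) (hθ : 0 < θ) (hθ1 : θ ≤ 1) (hN : 0 ≤ N)
    (hM : M = r ^ 4 * Λ ^ 2 * pm * b) (hD : D = max κ (p * r * Λ * η / t))
    (h1 : κ * η * χ * M ≤ θ ^ 2 * N) (h2 : κ ^ 2 * η ^ 2 * ψ * M ≤ θ ^ 2 * N) :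
    32 * ψ * b ≤ N * p * (32 * θ / D) ^ 2 ∧ 32 * χ * b ≤ N * p * (32 * θ / D) := by
  have hD0 : 0 < D := hD ▸ lt_max_of_lt_left (by linarith)
  have hr4 : r ≤ r ^ 4 := le_self_pow₀ hr (by norm_num)
  have hr42 : r ^ 2 ≤ r ^ 4 := pow_le_pow_right₀ hr (by norm_num)
  have hΛ2 : Λ ≤ Λ ^ 2 := le_self_pow₀ hΛ (by norm_num)
  have hr0 : 1 ≤ r ^ 4 := hr.trans hr4
  have hΛ0 : 1 ≤ Λ ^ 2 := hΛ.trans hΛ2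
  have hηκ : 1 ≤ κ * η := one_le_mul_of_one_le_of_one_le hκ hη
  have hit : 1 / t ≤ 1 := by rw [div_le_one (by linarith)]; exact ht
  have hθN : θ ^ 2 * N ≤ θ * N := by
    refine mul_le_mul_of_nonneg_right ?_ hN
    nlinarith
  have hNp : θ * N ≤ θ * N * p := le_mul_of_one_le_right (by positivity) hp
  have hNp2 : θ ^ 2 * N ≤ θ ^ 2 * N * p := le_mul_of_one_le_right (by positivity) hp
  have hbM : b ≤ M := by
    rw [hM]
    exact le_mul_of_one_le_left hb (one_le_mul_of_one_le_of_one_le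
      (one_le_mul_of_one_le_of_one_le hr0 hΛ0) hpm)
  have hM0 : 0 ≤ M := hb.trans hbM
  -- When `D` is its second entry, `D²` contains `p²/t² = p · (p/t) · (1/t)`: one `p` is absorbed by
  -- the effective sample size `N p`, and `p/t` by `pm`.
  have key1 : ψ * b * D ^ 2 ≤ θ ^ 2 * N * p := by
    rcases max_choice κ (p * r * Λ * η / t) with h | h <;> rw [hD, h]
    · calc ψ * b * κ ^ 2 = κ ^ 2 * 1 * ψ * b := by ring
        _ ≤ κ ^ 2 * η ^ 2 * ψ * M := by gcongr; exact one_le_pow₀ hη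
        _ ≤ _ := h2.trans hNp2
    · calc ψ * b * (p * r * Λ * η / t) ^ 2
          = p * (1 * η ^ 2 * ψ * (r ^ 2 * Λ ^ 2 * ((p / t) * (1 / t)) * b)) := by ring
        _ ≤ p * (κ ^ 2 * η ^ 2 * ψ * (r ^ 4 * Λ ^ 2 * (pm * 1) * b)) := by
            gcongr; exact one_le_pow₀ hκ
        _ = p * (κ ^ 2 * η ^ 2 * ψ * M) := by rw [hM]; ring
        _ ≤ p * (θ ^ 2 * N) := by gcongr
        _ = _ := by ring
  have key2 : χ * b * D ≤ θ * N * p := by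
    rcases max_choice κ (p * r * Λ * η / t) with h | h <;> rw [hD, h]
    · calc χ * b * κ = κ * 1 * χ * b := by ring
        _ ≤ κ * η * χ * M := by gcongr
        _ ≤ _ := h1.trans (hθN.trans hNp)
    · calc χ * b * (p * r * Λ * η / t) = p * (1 * η * χ * (r * Λ * (1 / t) * b)) := by ring
        _ ≤ p * (κ * η * χ * (r ^ 4 * Λ ^ 2 * pm * b)) := by
            gcongr; exact hit.trans hpm
        _ = p * (κ * η * χ * M) := by rw [hM]
        _ ≤ p * (θ * N) := mul_le_mul_of_nonneg_left (h1.trans hθN) (by linarith)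
        _ = _ := by ring
  have hp0 : 0 ≤ θ ^ 2 * N * p := by positivity
  constructor
  · rw [div_pow, mul_div_assoc', le_div_iff₀ (by positivity)]
    linarith
  · rw [mul_div_assoc', le_div_iff₀ hD0]
    linarith

lemma measureReal_le_of_events {Ω : Type*} [MeasurableSpace Ω] {μ : Measure Ω}
    {S E₁ E₂ E₃ E₄ E₅ : Set Ω} {a b : ℝ} (ha : 0 ≤ a) (hb : 0 ≤ b)
    (hS : S ⊆ E₁ ∪ (E₂ ∪ (E₃ ∪ (E₄ ∪ E₅)))) (h₁ : μ E₁ ≤ ENNReal.ofReal a)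
    (h₂ : μ E₂ ≤ 2 * ENNReal.ofReal b) (h₃ : μ E₃ ≤ ENNReal.ofReal b)
    (h₄ : μ E₄ ≤ ENNReal.ofReal b) (h₅ : μ E₅ ≤ ENNReal.ofReal b) :
    μ.real S ≤ a + 9 * b := by
  refine ENNReal.toReal_le_of_le_ofReal (by positivity) ?_
  have h : μ S ≤ ENNReal.ofReal a + (2 * ENNReal.ofReal b + (ENNReal.ofReal b +
      (ENNReal.ofReal b + ENNReal.ofReal b))) := by
    refine (measure_mono hS).trans ((measure_union_le _ _).trans (add_le_add h₁ ?_))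
    refine (measure_union_le _ _).trans (add_le_add h₂ ?_)
    refine (measure_union_le _ _).trans (add_le_add h₃ ?_)
    exact (measure_union_le _ _).trans (add_le_add h₄ h₅)
  refine h.trans ?_
  rw [show (2 : ENNReal) = ENNReal.ofReal 2 by simp, ← ENNReal.ofReal_mul (by norm_num),
    ← ENNReal.ofReal_add hb hb, ← ENNReal.ofReal_add hb (by positivity),
    ← ENNReal.ofReal_add (by positivity) (by positivity), ← ENNReal.ofReal_add ha (by positivity)]
  exact ENNReal.ofReal_le_ofReal (by linarith)

-- The bad event is covered by five events: a large individual `q_i`, a large weighted mean of the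
-- `q_i`, and one union over the net for each of the three matrices.
set_option maxHeartbeats 1000000 in
lemma measureReal_subspaceDist_ge_le (hΓ : Γ.PosDef) (hΔ : ∀ i, (Δ i).PosSemidef)
    (hlam : 0 < lamSignal Γ Δ W V) {Ω : Type*} [MeasurableSpace Ω] {μ : Measure Ω}
    [IsProbabilityMeasure μ] {X : Fin I → Fin T → Ω → Matrix (Fin B) (Fin P) ℝ}
    {What : Ω → Matrix (Fin B) (Fin R) ℝ} {ε : ℝ} (hX : GaussianModel μ Γ Δ X)
    (hout : ∀ ω, IsOutput (fun i t => X i t ω)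
      (fun i t => respCoef W (V i) ⬝ᵥ (vecOf (X i t ω)).ofLp) (What ω))
    (hε : 0 < ε) (hε1 : ε ≤ 1) (hRT : R < T)
    (hN : kConst Γ Δ W V 1 1 1 1 (fun x => 4000000 * (1 + x ^ 2)) * (ε ^ 2)⁻¹ * (R : ℝ) ^ 4
      * max (Real.log ((I : ℝ) * T) / T) 1 ^ 2 * max ((P : ℝ) / T) 1 * B ≤ (I : ℝ) * T) :
    μ.real {ω | subspaceDist (What ω) W ≥ ε} ≤ 1 / (B : ℝ) + 9 * Real.exp (-(B : ℝ)) := by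
  obtain ⟨h1R, hRB⟩ := rank_bounds_of_lamSignal_pos hlam
  have hB : 1 ≤ B := h1R.trans hRB
  have hT2 : 2 ≤ T := by omega
  have hT0 : T ≠ 0 := by omega
  have hI := tasks_ne_zero hΓ hΔ hlam
  have hP := covariates_ne_zero hΓ hΔ hlam
  have hκ := one_le_kappa hΓ hB
  have hη := one_le_etaCoef hΓ hΔ hlam
  have hν := hη.trans (etaCoef_le_nuCoef hΓ hΔ hlam)
  have hχ := chiCoef_pos hΓ hΔ hlam
  have hψ : 0 ≤ psiCoef Δ := div_nonneg (avg_nonneg fun i => sq_nonneg _) (sq_nonneg _)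
  have hα : 0 ≤ alphaCoef Γ Δ W V :=
    div_nonneg (avg_nonneg fun i => sq_nonneg _) (sq_nonneg _)
  have hIr : (1 : ℝ) ≤ I := by exact_mod_cast Nat.one_le_iff_ne_zero.2 hI
  have hTr : (1 : ℝ) ≤ T := by exact_mod_cast Nat.one_le_iff_ne_zero.2 hT0
  have hPr : (1 : ℝ) ≤ P := by exact_mod_cast Nat.one_le_iff_ne_zero.2 hP
  have hRr : (1 : ℝ) ≤ R := by exact_mod_cast h1R
  have hBr : (1 : ℝ) ≤ B := by exact_mod_cast hB
  obtain ⟨Λ, hΛdef⟩ : ∃ z, z = max (Real.log ((I : ℝ) * T) / T) 1 := ⟨_, rfl⟩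
  obtain ⟨pm, hpmdef⟩ : ∃ z, z = max ((P : ℝ) / T) 1 := ⟨_, rfl⟩
  have hΛ : 1 ≤ Λ := hΛdef ▸ le_max_right _ _
  have hΛlog : Real.log ((I : ℝ) * T) / T ≤ Λ := hΛdef ▸ le_max_left _ _
  have hpm : 1 ≤ pm := hpmdef ▸ le_max_right _ _
  have hPT : (P : ℝ) / T ≤ pm := hpmdef ▸ le_max_left _ _
  rw [← hΛdef, ← hpmdef, kConst] at hN
  obtain ⟨θ, hθ⟩ : ∃ z, z = ε / (4000000 * (1 + kappa Γ ^ 2)) := ⟨_, rfl⟩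
  obtain ⟨M, hM⟩ : ∃ z, z = (R : ℝ) ^ 4 * Λ ^ 2 * pm * B := ⟨_, rfl⟩
  obtain ⟨D, hD⟩ : ∃ z, z = max (kappa Γ) (P * R * Λ * etaCoef Γ Δ W V / T) := ⟨_, rfl⟩
  have hθ0 : 0 < θ := by rw [hθ]; positivity
  have hθ1 : θ ≤ 1 := by
    rw [hθ, div_le_one (by positivity)]
    nlinarith [sq_nonneg (kappa Γ)]
  have hM0 : 0 ≤ M := by rw [hM]; positivity
  -- Each coefficient in `k'` separately yields a condition `a M ≤ θ² I T`, which is the form the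
  -- deviation lemmas ask for.
  have hsize : ∀ {a : ℝ}, a ≤ kPrime Γ Δ W V 1 1 1 1 → a * M ≤ θ ^ 2 * (I * T) := fun ha => by
    rw [hθ]
    refine coef_mul_le_of_sample_size (by positivity) hε hM0 (le_of_eq_of_le ?_ hN) ha
    rw [hM]; ring
  obtain ⟨k1, k2, k3, k4, k5⟩ := coef_le_kPrime (Γ := Γ) (Δ := Δ) (W := W) (V := V)
  have s1 := hsize k1
  have s2 := hsize k2
  have s3 := hsize k3
  have s4 := hsize k4
  have s5 := hsize k5
  have hR4 : (R : ℝ) ≤ R ^ 4 := le_self_pow₀ hRr (by norm_num)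
  have hR24 : (R : ℝ) ^ 2 ≤ R ^ 4 := pow_le_pow_right₀ hRr (by norm_num)
  have hΛ2 : Λ ≤ Λ ^ 2 := le_self_pow₀ hΛ (by norm_num)
  have hBM : (B : ℝ) ≤ M := by
    rw [hM]
    exact le_mul_of_one_le_left (by linarith) (one_le_mul_of_one_le_of_one_le
      (one_le_mul_of_one_le_of_one_le (hRr.trans hR4) (hΛ.trans hΛ2)) hpm)
  have hRΛB : R * Λ * B ≤ M := by
    calc (R : ℝ) * Λ * B = R * Λ * 1 * B := by ring
      _ ≤ R ^ 4 * Λ ^ 2 * pm * B := by gcongr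
      _ = M := hM.symm
  have hR2M : (R : ℝ) ^ 2 * Λ ^ 2 * pm * B ≤ M := by rw [hM]; gcongr
  have hNθ : θ ^ 2 * (I * T) ≤ θ * (I * T : ℝ) := by
    refine mul_le_mul_of_nonneg_right ?_ (by positivity)
    nlinarith
  have hNθ1 : θ * (I * T) ≤ (I * T : ℝ) := mul_le_of_le_one_left (by positivity) hθ1
  -- As `ν ≥ 1`, the condition for `ν²` implies the one with coefficient `1`. It supplies the
  -- summand `1` in `α + 1`.
  have hMN : M ≤ θ ^ 2 * (I * T) :=
    (le_mul_of_one_le_left hM0 (one_le_pow₀ hν)).trans s3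
  have hν0 : 0 ≤ nuCoef Γ Δ W V := by linarith
  obtain ⟨e1, e2⟩ := covariance_sample_size (N := I * T) (by linarith) hRr hPr hTr hΛ hpm hPT hκ hη
    hχ.le hψ hθ0 hθ1 (by positivity) hM hD s4 s5
  obtain ⟨N, hNc, hNu, hNA⟩ := exists_quadratic_net B
  have hD0 : 0 < D := hD ▸ lt_max_of_lt_left (by linarith)
  have hts := traceScale_pos hΓ hΔ hlam
  have hg := specNorm_nonneg Γ
  refine measureReal_le_of_events (by positivity) (Real.exp_pos _).le ?_
    ((measure_exists_lt_sampleVar_le (W := W) (V := V) hΓ hΔ hX hT0 hΛ).trans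
      (tasks_mul_exp_le hI hT2 hB (hBM.trans (hMN.trans (hNθ.trans hNθ1))) hΛlog))
    (measure_lt_avg_sampleVar_le (W := W) (V := V) hΓ hΔ hlam hX hT0
      ((mul_le_mul_of_nonneg_left hBM (sq_nonneg _)).trans (s3.trans (hNθ.trans hNθ1))))
    (measure_biUnion_net_le hB hNc fun u hu => measure_lt_abs_GammaHat_le hΓ hΔ hlam hX hT0
      (e := 32 * θ / D) (by positivity) e1 e2 (hNu u hu))
    (measure_biUnion_net_le hB hNc fun u hu => measure_lt_abs_weightedReg_le hΓ hΔ hlam hX hT0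
      hθ0.le ((mul_le_mul_of_nonneg_left hBM hα).trans s1)
      ((mul_le_mul_of_nonneg_left hBM hν0).trans (s2.trans hNθ)) (hNu u hu))
    (measure_biUnion_net_le hB hNc fun u hu => measure_lt_abs_AHat_le hΓ hΔ hlam hX hT0
      hθ0.le hΛ hpm hPT
      ((mul_le_mul_of_nonneg_left hR2M (by positivity)).trans (by linarith))
      ((mul_le_mul_of_nonneg_left hRΛB hν0).trans (s2.trans hNθ)) (hNu u hu))
  intro ω hω
  by_contra hbad
  simp only [Set.mem_union, Set.mem_iUnion, Set.mem_ofPred_eq, not_or, not_exists, not_lt,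
    not_and] at hbad
  obtain ⟨b1, b2, b3, b4, b5⟩ := hbad
  refine absurd (show ε ≤ subspaceDist (What ω) W from hω) (not_le.2 ?_)
  refine subspaceDist_lt_of_deviations hΓ hΔ hlam hT2 hε hε1 hΛ hθ hD
    (fun i => sampleVar_nonneg i ω) b1 ?_ ?_ ?_ (hout ω)
  · refine hNA _ ((isHermitian_GammaHat _).sub ?_) _ (by positivity) b3
    rw [IsHermitian, conjTranspose_smul, star_trivial, hΓ.1]
  · exact hNA _ (isHermitian_weightedReg _) _ (by positivity) b4
  -- The deviation of `Â` is only excluded together with the first two events, so `b1` and `b2` are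
  -- needed again.
  · refine hNA _ (((isHermitian_AHat _ _).sub ?_).sub (isHermitian_weightedReg _)) _
      (by positivity) fun u hu => b5 u hu ⟨b1, b2⟩
    rw [IsHermitian, conjTranspose_smul, star_trivial, hΓ.1]

end Main

end MultiTask

/-! ### The theorem -/

theorem theorem1 :
    ∃ (c₁ c₂ c₃ D' : ℝ) (c : ℝ → ℝ),
      0 < c₁ ∧ 0 < c₂ ∧ 0 < c₃ ∧ 0 < D' ∧ (∀ x, 1 < c x) ∧
      ∀ (I T B P R : ℕ) (Γ : Matrix (Fin B) (Fin B) ℝ)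
        (Δ : Fin I → Matrix (Fin P) (Fin P) ℝ)
        (W : Matrix (Fin B) (Fin R) ℝ) (V : Fin I → Matrix (Fin P) (Fin R) ℝ),
        Γ.PosDef → (∀ i, (Δ i).PosSemidef) → 0 < MultiTask.lamSignal Γ Δ W V →
        ∀ (Ω : Type*) [MeasurableSpace Ω] (Pr : MeasureTheory.Measure Ω)
          [MeasureTheory.IsProbabilityMeasure Pr]
          (X : Fin I → Fin T → Ω → Matrix (Fin B) (Fin P) ℝ)
          (y : Fin I → Fin T → Ω → ℝ)
          (What : Ω → Matrix (Fin B) (Fin R) ℝ) (ε : ℝ),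
          MultiTask.GaussianModel Pr Γ Δ X →
          (∀ i t ω, y i t ω = Matrix.trace (W.transpose * X i t ω * V i)) →
          (∀ ω, MultiTask.IsOutput (fun i t => X i t ω) (fun i t => y i t ω) (What ω)) →
          0 < ε →
          R < T →
          (I : ℝ) * T ≥ MultiTask.kConst Γ Δ W V c₁ c₂ c₃ D' c * (ε ^ 2)⁻¹ * (R : ℝ) ^ 4
              * max (Real.log ((I : ℝ) * T) / T) 1 ^ 2 * max ((P : ℝ) / T) 1 * B →
          Pr.real {ω | MultiTask.subspaceDist (What ω) W ≥ ε}
            ≤ 1 / (B : ℝ) + 9 * Real.exp (-(B : ℝ)) := by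
  -- All numerical losses go into `c`, so that `θ = ε / c(κ_Γ)` and the other constants can be `1`.
  refine ⟨1, 1, 1, 1, fun x => 4000000 * (1 + x ^ 2), one_pos, one_pos, one_pos, one_pos,
    fun x => by nlinarith [sq_nonneg x], ?_⟩
  intro I T B P R Γ Δ W V hΓ hΔ hlam Ω _ Pr _ X y What ε hX hy hout hε hRT hN
  -- The distance never exceeds `1`, so the event is empty for `ε > 1`.
  rcases le_or_gt ε 1 with hε1 | hε1
  · refine MultiTask.measureReal_subspaceDist_ge_le hΓ hΔ hlam hX (fun ω => ?_) hε hε1 hRT hN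
    have h := hout ω
    simp only [hy, MultiTask.trace_response] at h
    exact h
  · have h0 : {ω | MultiTask.subspaceDist (What ω) W ≥ ε} = ∅ := by
      refine Set.eq_empty_of_forall_notMem fun ω hω => ?_
      have h1 : ε ≤ MultiTask.subspaceDist (What ω) W := hω
      linarith [MultiTask.subspaceDist_le_one (What ω) W]
    rw [h0, measureReal_empty]
    positivity
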